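/- Let $\mathbb F$ be a field with $|\mathbb F|\ge 3$ and let $V$ be a vector space over $\mathbb F$ of finite dimension $n\ge 4$, endowed with a symplectic (that is, alternating bilinear) form $\mathsf s$ of maximal rank; equivalently, $\dim \mathrm{Rad}(V)\le 1$, where for a subspace $U\le V$ one puts $U^\perp=\{v\in V\mid \mathsf s(u,v)=0\ \forall u\in U\}$ and $\mathrm{Rad}(U)=U\cap U^\perp$. Let $G=\mathrm{Sp}(V)$ be the group of all linear automorphisms of $V$ preserving $\mathsf s$. Let $\Gamma$ be the following geometry over the type set $I=\{1,2,\dots,n-1\}$. The objects of type $i\in I$ are the $i$-dimensional subspaces $U\le V$ with $U\cap \mathrm{Rad}(V)=0$ and $\dim\mathrm{Rad}(U)\le 1$. Two objects $X,Y$ are incident if $X=Y$, or $X\subseteq Y$ and $X\cap\mathrm{Rad}(Y)=0$, or $Y\subseteq X$ and $Y\cap \mathrm{Rad}(X)=0$. A chamber is a set $C=\{C_i\}_{i\in I}$ of pairwise incident objects with $C_i$ of type $i$. The group $G$ acts on $\Gamma$ by $U\mapsto gU$. Fix any chamber $C=\{C_i\}_{i\in I}$ of $\Gamma$ and, for $J\subseteq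 I$, let $P_J$ be the standard parabolic subgroup of type $J$, that is, the stabilizer in $G$ of the flag $\{C_i\mid i\in I-J\}$. Then $G$ is the universal completion of the amalgam $\mathcal A_{\le 2}=\{P_J\mid J\subseteq I,\ |J|\le 2\}$ with the inclusion maps $P_M\to P_K$ for $M\subset K$. Explicitly: let $\hat G$ be the quotient of the free product of the groups $P_J$ ($|J|\le 2$) by the normal closure of the elements that identify each $a\in P_M$ with its image in $P_K$, for all $M\subset K$ with $|K|\le 2$; then the homomorphism $\hat G\to G$ induced by the inclusions $P_J\le G$ is an isomorphism. -/

import Mathlib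

open Module
open scoped Pointwise

universe u v

/-! ### Amalgams of groups and their universal completions -/

/-- An amalgam of groups over a partially ordered set `(B, <)`: a group for each `b : B` and a
compatible system of homomorphisms `grp b →* grp c` for `b < c`. -/
structure GroupAmalgam (B : Type u) [PartialOrder B] where
  grp : B → Type v
  [group : ∀ b, Group (grp b)]
  hom : ∀ {b c : B}, b < c → (grp b →* grp c)
  hom_comp : ∀ {b c d : B} (hbc : b < c) (hcd : c < d),
    (hom hcd).comp (hom hbc) = hom (hbc.trans hcd)

attribute [instance] GroupAmalgam.group

namespace GroupAmalgam

variable {B : Type u} [PartialOrder B] (A : GroupAmalgam.{u, v} B)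

/-- In the free product of the groups `A.grp b` (words in the elements of these groups, subject to
the relations holding in each of them), the elements which identify `a` with its image
`A.hom h a`, for `h : b < c` and `a : A.grp b`. -/
def identifications : Set (Monoid.CoprodI A.grp) :=
  {x | ∃ (b c : B) (h : b < c) (a : A.grp b),
    x = Monoid.CoprodI.of (A.hom h a) * (Monoid.CoprodI.of a)⁻¹}

/-- The universal completion (amalgamated sum) of an amalgam of groups. -/
abbrev UniversalCompletion : Type (max u v) :=
  Monoid.CoprodI A.grp ⧸ Subgroup.normalClosure A.identifications

/-- The canonical homomorphism from a group of the amalgam to the universal completion. -/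
def toCompletion (b : B) : A.grp b →* A.UniversalCompletion :=
  (QuotientGroup.mk' _).comp Monoid.CoprodI.of

/-- The homomorphism from the universal completion to a group `G` induced by a family of
homomorphisms `A.grp b →* G` that respects the maps of the amalgam. -/
def completionLift {G : Type*} [Group G] (f : ∀ b, A.grp b →* G)
    (hf : ∀ {b c : B} (h : b < c) (a : A.grp b), f c (A.hom h a) = f b a) :
    A.UniversalCompletion →* G :=
  QuotientGroup.lift _ (Monoid.CoprodI.lift f) <| by
    have : Subgroup.normalClosure A.identifications ≤ (Monoid.CoprodI.lift f).ker := by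
      apply Subgroup.normalClosure_le_normal
      rintro _ ⟨b, c, h, a, rfl⟩
      simp [MonoidHom.mem_ker, hf h a]
    exact fun x hx => this hx

theorem completionLift_toCompletion {G : Type*} [Group G] (f : ∀ b, A.grp b →* G)
    (hf : ∀ {b c : B} (h : b < c) (a : A.grp b), f c (A.hom h a) = f b a)
    (b : B) (a : A.grp b) : A.completionLift f hf (A.toCompletion b a) = f b a := by
  simp [completionLift, toCompletion]

end GroupAmalgam

/-! ### Pre-geometries, chambers and parabolic subgroups -/

/-- A pre-geometry over a type set `I`. -/
structure PreGeometry (I : Type u) where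
  Obj : Type v
  typ : Obj → I
  Inc : Obj → Obj → Prop
  inc_refl : ∀ X, Inc X X
  inc_symm : ∀ X Y, Inc X Y → Inc Y X
  eq_or_typ_ne : ∀ X Y, Inc X Y → X = Y ∨ typ X ≠ typ Y

namespace PreGeometry

variable {I : Type u} (Γ : PreGeometry.{u, v} I)

/-- A flag is a set of pairwise incident objects. -/
def IsFlag (S : Set Γ.Obj) : Prop := ∀ X ∈ S, ∀ Y ∈ S, Γ.Inc X Y

/-- A chamber is a flag whose type is the whole type set. -/
structure Chamber where
  carrier : Set Γ.Obj
  isFlag : Γ.IsFlag carrier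
  typ_eq : Γ.typ '' carrier = Set.univ

/-- The group `G` acts on the pre-geometry `Γ`: it preserves types and incidence. -/
class IsAutomorphismAction (G : Type*) [Group G] [MulAction G Γ.Obj] : Prop where
  typ_smul : ∀ (g : G) (X : Γ.Obj), Γ.typ (g • X) = Γ.typ X
  inc_smul : ∀ (g : G) (X Y : Γ.Obj), Γ.Inc (g • X) (g • Y) ↔ Γ.Inc X Y

variable {Γ}

/-- The subflag of cotype `J` of the chamber `C`, that is, the set of all objects of `C` whose
type does not lie in `J`. -/
def Chamber.subflag (C : Γ.Chamber) (J : Finset I) : Set Γ.Obj :=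
  {X | X ∈ C.carrier ∧ Γ.typ X ∉ J}

/-- The standard parabolic subgroup of type `J` with respect to the chamber `C`: the stabilizer
in `G` of the flag of cotype `J` on `C`. -/
def parabolic (G : Type*) [Group G] [MulAction G Γ.Obj] (C : Γ.Chamber) (J : Finset I) :
    Subgroup G :=
  MulAction.stabilizer G (C.subflag J)

theorem parabolic_mono (G : Type*) [Group G] [MulAction G Γ.Obj] [Γ.IsAutomorphismAction G]
    (C : Γ.Chamber) {J K : Finset I} (h : J ≤ K) : parabolic G C J ≤ parabolic G C K := by
  have key : ∀ g ∈ parabolic G C J, ∀ X ∈ C.subflag K, g • X ∈ C.subflag K := by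
    intro g hg X hX
    have hX' : X ∈ C.subflag J := ⟨hX.1, fun hJ => hX.2 (h hJ)⟩
    have hg' : g • C.subflag J = C.subflag J := hg
    have hgX : g • X ∈ C.subflag J := by
      rw [← hg']
      exact Set.smul_mem_smul_set hX'
    refine ⟨hgX.1, ?_⟩
    rw [IsAutomorphismAction.typ_smul (Γ := Γ) g X]
    exact hX.2
  intro g hg
  change g • C.subflag K = C.subflag K
  apply Set.Subset.antisymm
  · rintro _ ⟨X, hX, rfl⟩
    exact key g hg X hX
  · intro X hX
    exact ⟨g⁻¹ • X, key g⁻¹ (inv_mem hg) X hX, smul_inv_smul g X⟩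

/-- The amalgam of the standard parabolic subgroups of type `J` with `|J| ≤ k`, with respect to
the chamber `C`, together with the inclusion maps. -/
def parabolicAmalgam (G : Type v) [Group G] [MulAction G Γ.Obj] [Γ.IsAutomorphismAction G]
    (C : Γ.Chamber) (k : ℕ) : GroupAmalgam.{u, v} {J : Finset I // J.card ≤ k} where
  grp J := parabolic G C J.1
  hom h := Subgroup.inclusion (parabolic_mono G C (le_of_lt h))
  hom_comp _ _ := rfl

/-- The canonical homomorphism from the universal completion of the amalgam of the standard
parabolic subgroups of type `J` with `|J| ≤ k` to `G`, induced by the inclusions. -/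
def parabolicCompletionHom (G : Type v) [Group G] [MulAction G Γ.Obj]
    [Γ.IsAutomorphismAction G] (C : Γ.Chamber) (k : ℕ) :
    (parabolicAmalgam G C k).UniversalCompletion →* G :=
  (parabolicAmalgam G C k).completionLift (fun J => (parabolic G C J.1).subtype)
    (fun _ _ => rfl)

end PreGeometry

/-! ### The quasi-Phan geometry of a symplectic space -/

section Symplectic

variable {F : Type u} {V : Type v} [Field F] [AddCommGroup V] [Module F V]

/-- The radical `U ∩ U^⊥` of a subspace `U`. -/
def subspaceRadical (s : LinearMap.BilinForm F V) (U : Submodule F V) : Submodule F V :=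
  U ⊓ s.orthogonal U

/-- The group of all linear automorphisms of `V` that preserve the form `s`. -/
def symplecticGroupOf (s : LinearMap.BilinForm F V) : Subgroup (V ≃ₗ[F] V) where
  carrier := {g | ∀ x y, s (g x) (g y) = s x y}
  mul_mem' {a b} ha hb x y := by
    rw [LinearEquiv.mul_apply, LinearEquiv.mul_apply, ha, hb]
  one_mem' _ _ := rfl
  inv_mem' {a} ha x y := by
    have := ha (a⁻¹ x) (a⁻¹ y)
    rw [← LinearEquiv.mul_apply, ← LinearEquiv.mul_apply, mul_inv_cancel] at this
    exact this.symm

/-- The type set `{1, …, n - 1}`, where `n = dim V`. -/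
abbrev QuasiPhanTypes (F : Type u) (V : Type v) [Field F] [AddCommGroup V] [Module F V] :
    Type :=
  {i : ℕ // 1 ≤ i ∧ i < finrank F V}

/-- The objects of the quasi-Phan geometry: the subspaces `U` of `V` of dimension `1, …, n - 1`
that meet `Rad(V)` trivially and whose radical has dimension at most `1`. -/
def IsQuasiPhanObject (s : LinearMap.BilinForm F V) (U : Submodule F V) : Prop :=
  (1 ≤ finrank F U ∧ finrank F U < finrank F V) ∧
    U ⊓ subspaceRadical s ⊤ = ⊥ ∧ finrank F (subspaceRadical s U) ≤ 1

/-- `X ⊆ Y - Rad(Y)` for subspaces `X`, `Y`: every nonzero vector of `X` lies in `Y` and not in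
`Rad(Y)`. -/
def ContainedOffRadical (s : LinearMap.BilinForm F V) (X Y : Submodule F V) : Prop :=
  X ≤ Y ∧ X ⊓ subspaceRadical s Y = ⊥

/-- The quasi-Phan geometry `Γ(V)`; the type of an object is its dimension, and two distinct
objects are incident if one of them is contained in the other off the radical of the latter. -/
noncomputable def quasiPhanGeometry [FiniteDimensional F V] (s : LinearMap.BilinForm F V) :
    PreGeometry.{0, v} (QuasiPhanTypes F V) where
  Obj := {U : Submodule F V // IsQuasiPhanObject s U}
  typ U := ⟨finrank F U.1, U.2.1⟩
  Inc X Y := X = Y ∨ ContainedOffRadical s X.1 Y.1 ∨ ContainedOffRadical s Y.1 X.1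
  inc_refl _ := Or.inl rfl
  inc_symm X Y h := by
    rcases h with h | h | h
    · exact Or.inl h.symm
    · exact Or.inr (Or.inr h)
    · exact Or.inr (Or.inl h)
  eq_or_typ_ne X Y h := by
    by_cases ht : finrank F X.1 = finrank F Y.1
    · left
      rcases h with h | h | h
      · exact h
      · exact Subtype.ext (Submodule.eq_of_le_of_finrank_eq h.1 ht)
      · exact (Subtype.ext (Submodule.eq_of_le_of_finrank_eq h.1 ht.symm)).symm
    · right
      intro h'
      exact ht (congrArg Subtype.val h')

theorem symplecticGroupOf_map_radical (s : LinearMap.BilinForm F V) (g : symplecticGroupOf s)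
    (U : Submodule F V) :
    subspaceRadical s (U.map (g.1 : V →ₗ[F] V)) =
      (subspaceRadical s U).map (g.1 : V →ₗ[F] V) := by
  ext x
  simp only [subspaceRadical, Submodule.mem_inf, LinearMap.BilinForm.mem_orthogonal_iff,
    Submodule.mem_map]
  constructor
  · rintro ⟨⟨u, hu, rfl⟩, h⟩
    refine ⟨u, ⟨hu, fun w hw => ?_⟩, rfl⟩
    have := h _ ⟨w, hw, rfl⟩
    exact (g.2 w u).symm.trans this
  · rintro ⟨u, ⟨hu, h⟩, rfl⟩
    refine ⟨⟨u, hu, rfl⟩, ?_⟩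
    rintro _ ⟨w, hw, rfl⟩
    exact (g.2 w u).trans (h w hw)

theorem symplecticGroupOf_map_inf (s : LinearMap.BilinForm F V) (g : symplecticGroupOf s)
    (U W : Submodule F V) :
    (U ⊓ W).map (g.1 : V →ₗ[F] V) =
      U.map (g.1 : V →ₗ[F] V) ⊓ W.map (g.1 : V →ₗ[F] V) :=
  Submodule.map_inf _ g.1.injective

theorem symplecticGroupOf_map_containedOffRadical (s : LinearMap.BilinForm F V)
    (g : symplecticGroupOf s) (X Y : Submodule F V) :
    ContainedOffRadical s (X.map (g.1 : V →ₗ[F] V)) (Y.map (g.1 : V →ₗ[F] V)) ↔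
      ContainedOffRadical s X Y := by
  have hinj : Function.Injective (Submodule.map (g.1 : V →ₗ[F] V)) :=
    Submodule.map_injective_of_injective g.1.injective
  unfold ContainedOffRadical
  rw [symplecticGroupOf_map_radical, ← symplecticGroupOf_map_inf,
    Submodule.map_le_map_iff_of_injective g.1.injective]
  refine and_congr Iff.rfl ⟨fun h => hinj ?_, fun h => ?_⟩
  · rw [h, Submodule.map_bot]
  · rw [h, Submodule.map_bot]

theorem IsQuasiPhanObject.map {s : LinearMap.BilinForm F V} (g : symplecticGroupOf s)
    {U : Submodule F V} (hU : IsQuasiPhanObject s U) :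
    IsQuasiPhanObject s (U.map (g.1 : V →ₗ[F] V)) := by
  have htop : subspaceRadical s ⊤ = (subspaceRadical s ⊤).map (g.1 : V →ₗ[F] V) := by
    rw [← symplecticGroupOf_map_radical]
    congr 1
    exact (LinearEquiv.range g.1).symm.trans (LinearMap.range_eq_map _)
  refine ⟨?_, ?_, ?_⟩
  · rw [LinearEquiv.finrank_map_eq]
    exact hU.1
  · rw [htop, ← symplecticGroupOf_map_inf, hU.2.1, Submodule.map_bot]
  · rw [symplecticGroupOf_map_radical, LinearEquiv.finrank_map_eq]
    exact hU.2.2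

/-- The action of the symplectic group on the objects of the quasi-Phan geometry: `g • U` is the
image of `U` under `g`. -/
instance quasiPhanMulAction [FiniteDimensional F V] (s : LinearMap.BilinForm F V) :
    MulAction (symplecticGroupOf s) (quasiPhanGeometry s).Obj where
  smul g U := ⟨U.1.map (g.1 : V →ₗ[F] V), U.2.map g⟩
  one_smul U := Subtype.ext (Submodule.map_id U.1)
  mul_smul g h U := Subtype.ext (Submodule.map_comp (h.1 : V →ₗ[F] V) (g.1 : V →ₗ[F] V) U.1)

instance quasiPhanIsAutomorphismAction [FiniteDimensional F V] (s : LinearMap.BilinForm F V) :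
    (quasiPhanGeometry s).IsAutomorphismAction (symplecticGroupOf s) where
  typ_smul g U := Subtype.ext (LinearEquiv.finrank_map_eq g.1 U.1)
  inc_smul g X Y :=
    or_congr (MulAction.injective (β := (quasiPhanGeometry s).Obj) g).eq_iff
      (or_congr (symplecticGroupOf_map_containedOffRadical s g X.1 Y.1)
        (symplecticGroupOf_map_containedOffRadical s g Y.1 X.1))

end Symplectic

/-! ### Coverings of the system of flags of a group -/

/-! The argument is the covering-theoretic one behind Tits' lemma, carried out inside the completion
`Ĝ`. For a set `K` of types let `Q K ≤ Ĝ` be generated by the images of the parabolics of rank at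
most one and type inside `K`. The projection `π : Ĝ → G` maps `Q K` onto `P_K`, because stabilizers
are generated by those of rank at most one, and `Q I` is all of `Ĝ`. It remains to see that `π` is
injective on each `Q K`, by induction on `|K|`.

For `|K| ≤ 2`, `Q K` lies in the image of `P_K`, which embeds. If `K` has a gap `c`, then `P_K` is
the product of its parts below and above `c`. The rank two case lifts this commutation to `Q K`, and
injectivity follows from the two parts (`injective_of_product`). If `K = [a, b]` has at least three
elements, the cosets of `Q (K \ {a})` and `Q (K \ {a + 1})` are the points and lines of a covering
of the residue. Proper residues are not unfolded, by induction, so edges lift uniquely and triangles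
in a plane lift to closed triangles. Every triangle is planar or a cone over planar triangles, and
quadrangles split into triangles. As any three points have a common neighbour, every point of the
cover is joined to the base point by a path of length two. Unique lifting then puts the kernel into
`Q (K \ {a})`, where it is trivial.

The geometry enters through complete flags whose even-dimensional members are nondegenerate; adapted
symplectic bases make `Sp(V)` transitive on them. If `a = 2k + 1`, points are given by vectors `v`
of `C (b + 1)` orthogonal to `C (2k)`, and adjacency is `s v w ≠ 0`. If `a = 2k + 2` and `e` spans
the radical of `C (2k + 1)`, points are given by vectors `f` with `s e f = 1`, which form an affine
space; non-adjacency is congruence modulo a subspace, and a triangle is planar once `s (g - f) (h -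
f) ≠ 0`. The condition `|F| ≥ 3` is used because three proper hyperplanes then do not cover a space.
-/

section FlagCover

variable {A G X : Type*} [Group A] [Group G] [MulAction G X]

/-- Two families agree at all indices outside `J`. -/
def AgreeOff (J : Set ℕ) (D E : ℕ → X) : Prop := ∀ i ∉ J, D i = E i

namespace AgreeOff

theorem refl (J : Set ℕ) (D : ℕ → X) : AgreeOff J D D := fun _ _ => rfl

theorem symm {J : Set ℕ} {D E : ℕ → X} (h : AgreeOff J D E) : AgreeOff J E D :=
  fun i hi => (h i hi).symm

theorem trans {J : Set ℕ} {D E D' : ℕ → X} (h : AgreeOff J D E) (h' : AgreeOff J E D') :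
    AgreeOff J D D' :=
  fun i hi => (h i hi).trans (h' i hi)

theorem mono {J K : Set ℕ} {D E : ℕ → X} (hJK : J ⊆ K) (h : AgreeOff J D E) : AgreeOff K D E :=
  fun i hi => h i fun hJ => hi (hJK hJ)

theorem diff_singleton {K : Set ℕ} {a : ℕ} {D E : ℕ → X} (h : AgreeOff K D E) (ha : D a = E a) :
    AgreeOff (K \ {a}) D E := by
  intro i hi
  by_cases hia : i = a
  · rw [hia, ha]
  · exact h i fun hK => hi ⟨hK, hia⟩

end AgreeOff

variable (G) in
/-- The elements of `G` that fix `C i` for every `i` outside `J`. -/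
def flagStabilizer (C : ℕ → X) (J : Set ℕ) : Subgroup G where
  carrier := {g | ∀ i ∉ J, g • C i = C i}
  mul_mem' ha hb i hi := by rw [mul_smul, hb i hi, ha i hi]
  one_mem' i _ := one_smul G (C i)
  inv_mem' ha i hi := by rw [inv_smul_eq_iff, ha i hi]

theorem mem_flagStabilizer {C : ℕ → X} {J : Set ℕ} {g : G} :
    g ∈ flagStabilizer G C J ↔ ∀ i ∉ J, g • C i = C i := Iff.rfl

theorem flagStabilizer_mono (C : ℕ → X) {J K : Set ℕ} (h : J ⊆ K) :
    flagStabilizer G C J ≤ flagStabilizer G C K :=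
  fun _ hg i hi => hg i fun hJ => hi (h hJ)

/-- A set of chambers, written as families indexed by `ℕ`, on which `G` acts transitively. -/
structure IsChamberOrbit (G : Type*) [Group G] [MulAction G X] (C : ℕ → X)
    (S : Set (ℕ → X)) : Prop where
  base_mem : C ∈ S
  smul_mem : ∀ (g : G), ∀ D ∈ S, g • D ∈ S
  exists_smul_eq : ∀ D ∈ S, ∃ g : G, g • C = D

/-! ### Points of a residue and their adjacency -/

section Adjacency

variable (C : ℕ → X) (S : Set (ℕ → X)) (K : Set ℕ) (a : ℕ)

/-- `x` and `y` are distinct entries at `a` of two chambers of the residue of type `K` that differ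
at most at `a`. -/
def PointAdj (x y : X) : Prop :=
  x ≠ y ∧ ∃ D ∈ S, ∃ D' ∈ S, AgreeOff K D C ∧ AgreeOff {a} D D' ∧ D a = x ∧ D' a = y

/-- Adjacency realized by chambers with entry `t` at `a + 2`. -/
def PointAdjIn (t x y : X) : Prop :=
  x ≠ y ∧ ∃ D ∈ S, ∃ D' ∈ S, AgreeOff K D C ∧ AgreeOff {a} D D' ∧ D a = x ∧ D' a = y ∧
    D (a + 2) = t

/-- Three pairwise adjacent points in a common plane. -/
def IsPlanar (x y z : X) : Prop :=
  ∃ t, PointAdjIn C S K a t x y ∧ PointAdjIn C S K a t x z ∧ PointAdjIn C S K a t y z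

variable {C S K a}

theorem PointAdjIn.pointAdj {t x y : X} (h : PointAdjIn C S K a t x y) : PointAdj C S K a x y := by
  obtain ⟨hne, D, hD, D', hD', h1, h2, h3, h4, _⟩ := h
  exact ⟨hne, D, hD, D', hD', h1, h2, h3, h4⟩

theorem PointAdjIn.symm (ha : a ∈ K) {t x y : X} (h : PointAdjIn C S K a t x y) :
    PointAdjIn C S K a t y x := by
  obtain ⟨hne, D, hD, D', hD', h1, h2, h3, h4, h5⟩ := h
  refine ⟨hne.symm, D', hD', D, hD, ?_, h2.symm, h4, h3, ?_⟩
  · exact (h2.symm.mono (Set.singleton_subset_iff.2 ha)).trans h1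
  · rw [← h2 _ (by simp), h5]

theorem IsPlanar.rotate (ha : a ∈ K) {x y z : X} (h : IsPlanar C S K a x y z) :
    IsPlanar C S K a z x y := by
  obtain ⟨t, h1, h2, h3⟩ := h
  exact ⟨t, h2.symm ha, h3.symm ha, h1⟩

theorem PointAdj.symm (ha : a ∈ K) {x y : X} (h : PointAdj C S K a x y) :
    PointAdj C S K a y x := by
  obtain ⟨hne, D, hD, D', hD', h1, h2, h3, h4⟩ := h
  refine ⟨hne.symm, D', hD', D, hD, ?_, h2.symm, h4, h3⟩
  exact (h2.symm.mono (Set.singleton_subset_iff.2 ha)).trans h1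

end Adjacency

section Connectivity

variable {C : ℕ → X} {S : Set (ℕ → X)} {K : Set ℕ} {a : ℕ}

theorem IsChamberOrbit.exists_mul (hS : IsChamberOrbit G C S) {g : G} {J : Set ℕ} {D : ℕ → X}
    (hD : D ∈ S) (h : AgreeOff J (g • C) D) : ∃ p ∈ flagStabilizer G C J, (g * p) • C = D := by
  obtain ⟨k, rfl⟩ := hS.exists_smul_eq D hD
  refine ⟨g⁻¹ * k, fun i hi => ?_, by simp⟩
  have := h i hi
  simp only [Pi.smul_apply] at this
  rw [mul_smul, ← this, inv_smul_smul]

/-- The dictionary between cosets of stabilizers and flags, used in both directions throughout. -/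
theorem inv_mul_mem_flagStabilizer {g h : G} {J : Set ℕ} :
    g⁻¹ * h ∈ flagStabilizer G C J ↔ AgreeOff J (g • C) (h • C) := by
  refine forall₂_congr fun i _ => ?_
  rw [mul_smul, inv_smul_eq_iff, Pi.smul_apply, Pi.smul_apply, eq_comm]

/-- If any two points have a common neighbour, then the stabilizer of type `K` is generated by the
stabilizers of type `K \ {a}` and `{a}`. -/
theorem IsChamberOrbit.mem_of_commonNeighbour (hS : IsChamberOrbit G C S) (ha : a ∈ K)
    {R : Subgroup G} (hH : flagStabilizer G C (K \ {a}) ≤ R) (hL : flagStabilizer G C {a} ≤ R)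
    {g : G} (hg : g ∈ flagStabilizer G C K) {w : X} (h1 : PointAdj C S K a (C a) w)
    (h2 : PointAdj C S K a (g • C a) w) : g ∈ R := by
  -- An edge of the point graph factors as a product: `k • C` is moved to `D` inside `P_{K \ {a}}`,
  -- `D` to `D'` inside `P_{a}`, and `D'` to `l • C` inside `P_{K \ {a}}` again.
  have step : ∀ {k l : G}, k ∈ R → k ∈ flagStabilizer G C K → l ∈ flagStabilizer G C K →
      PointAdj C S K a (k • C a) (l • C a) → l ∈ R := by
    rintro k l hk hkK hlK ⟨-, D, hD, D', hD', hDC, hDD', hDa, hDa'⟩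
    have e1 : AgreeOff (K \ {a}) (k • C) D := by
      refine AgreeOff.diff_singleton (fun i hi => ?_) hDa.symm
      rw [Pi.smul_apply, hkK i hi, hDC i hi]
    obtain ⟨p, hp, e2⟩ := hS.exists_mul hD e1
    obtain ⟨q, hq, e3⟩ := hS.exists_mul (g := k * p) (J := {a}) hD' (by rwa [e2])
    have e4 : (k * p * q)⁻¹ * l ∈ flagStabilizer G C (K \ {a}) := by
      rw [inv_mul_mem_flagStabilizer, e3]
      refine AgreeOff.diff_singleton (fun i hi => ?_) hDa'
      rw [Pi.smul_apply, hlK i hi, ← hDC i hi, hDD' i fun h => hi (h ▸ ha)]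
    have := R.mul_mem (R.mul_mem (R.mul_mem hk (hH hp)) (hL hq)) (hH e4)
    rwa [mul_inv_cancel_left] at this
  obtain ⟨-, D, hD, D', hD', hDC, hDD', -, hDa'⟩ := id h1
  obtain ⟨l, rfl⟩ := hS.exists_smul_eq D' hD'
  have hl : l ∈ flagStabilizer G C K := fun i hi => by
    rw [← Pi.smul_apply, ← hDD' i fun h => hi (h ▸ ha), hDC i hi]
  rw [← hDa'] at h1 h2
  have hlR := step R.one_mem (one_mem _) hl (by simpa using h1)
  exact step hlR hl hg (h2.symm ha)

end Connectivity

/-- Subgroups `Q J` of `A`, mapped onto the stabilizers of type `J` by `π`. -/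
structure IsFlagCover (π : A →* G) (C : ℕ → X) (S : Set (ℕ → X)) (Q : Set ℕ → Subgroup A) :
    Prop extends IsChamberOrbit G C S where
  mono : Monotone Q
  map_eq : ∀ J, (Q J).map π = flagStabilizer G C J

/-- `π` is injective on `H`. -/
def InjectiveOnSubgroup (π : A →* G) (H : Subgroup A) : Prop := ∀ g ∈ H, π g = 1 → g = 1

theorem InjectiveOnSubgroup.of_ssubset {π : A →* G} {Q : Set ℕ → Subgroup A} {K : Set ℕ}
    (hinj : ∀ J ⊂ K, InjectiveOnSubgroup π (Q J)) {b : ℕ} (hb : b ∈ K) : InjectiveOnSubgroup π (Q (K \ {b})) :=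
  hinj _ ⟨Set.sdiff_subset, fun h => (h hb).2 rfl⟩

namespace IsFlagCover

variable {π : A →* G} {C : ℕ → X} {S : Set (ℕ → X)} {Q : Set ℕ → Subgroup A}
  (hc : IsFlagCover π C S Q)
include hc

theorem map_mem {J : Set ℕ} {g : A} (hg : g ∈ Q J) : π g ∈ flagStabilizer G C J := by
  rw [← hc.map_eq]
  exact Subgroup.mem_map_of_mem π hg

theorem agreeOff {J : Set ℕ} {s t : A} (h : s⁻¹ * t ∈ Q J) :
    AgreeOff J (π s • C) (π t • C) := by
  have := hc.map_mem h
  rwa [map_mul, map_inv, inv_mul_mem_flagStabilizer] at this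

theorem exists_lift {J : Set ℕ} {s : A} {D : ℕ → X} (hD : D ∈ S) (h : AgreeOff J (π s • C) D) :
    ∃ t, s⁻¹ * t ∈ Q J ∧ π t • C = D := by
  obtain ⟨p, hp, e⟩ := hc.exists_mul hD h
  rw [← hc.map_eq] at hp
  obtain ⟨q, hq, rfl⟩ := hp
  exact ⟨s * q, by simpa using hq, by simpa using e⟩

/-- The image of `s⁻¹ * t` lies in `P_J ∩ P_J' = P_{J ∩ J'}`, hence is the image of an element of `Q
(J ∩ J')`; injectivity on `Q J` makes the two elements equal. This is how induction transfers
incidences from the geometry to its cover. -/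
theorem mem_of_agreeOff {J J' M : Set ℕ} (hJ : InjectiveOnSubgroup π (Q J)) {s t : A}
    (h : s⁻¹ * t ∈ Q J) (h' : AgreeOff J' (π s • C) (π t • C)) (hM : J ∩ J' ⊆ M) :
    s⁻¹ * t ∈ Q M := by
  have h1 := hc.map_mem h
  have h2 : π (s⁻¹ * t) ∈ flagStabilizer G C J' := by
    rwa [map_mul, map_inv, inv_mul_mem_flagStabilizer]
  have h3 : π (s⁻¹ * t) ∈ flagStabilizer G C (J ∩ J') := by
    intro i hi
    by_cases hiJ : i ∈ J
    · exact h2 i fun hi' => hi ⟨hiJ, hi'⟩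
    · exact h1 i hiJ
  rw [← hc.map_eq] at h3
  obtain ⟨g, hg, e⟩ := h3
  have : g = s⁻¹ * t := by
    have := hJ (g⁻¹ * (s⁻¹ * t))
      ((Q J).mul_mem ((Q J).inv_mem (hc.mono Set.inter_subset_left hg)) h) (by
        rw [map_mul, map_inv, e, inv_mul_cancel])
    rwa [inv_mul_eq_one] at this
  exact hc.mono hM (this ▸ hg)

end IsFlagCover

/-- The combinatorial properties of the graph of points of a residue which imply that the residue
is simply connected. -/
structure IsSimplyConnectedAt (C : ℕ → X) (S : Set (ℕ → X)) (K : Set ℕ) (a : ℕ) : Prop where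
  mem : a ∈ K
  succ_mem : a + 1 ∈ K
  add_two_mem : a + 2 ∈ K
  line_unique : ∀ D₁ ∈ S, ∀ E₁ ∈ S, ∀ D₂ ∈ S, ∀ E₂ ∈ S, D₁ (a + 1) = E₁ (a + 1) →
    D₂ (a + 1) = E₂ (a + 1) → D₁ a = D₂ a → E₁ a = E₂ a → D₁ a ≠ E₁ a → D₁ (a + 1) = D₂ (a + 1)
  triangle : ∀ x y z, PointAdj C S K a x y → PointAdj C S K a x z → PointAdj C S K a y z →
    IsPlanar C S K a x y z ∨
      ∃ w, IsPlanar C S K a x y w ∧ IsPlanar C S K a x z w ∧ IsPlanar C S K a y z w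
  square : ∀ x y z z', PointAdj C S K a x z → PointAdj C S K a x z' → PointAdj C S K a y z →
    PointAdj C S K a y z' → x ≠ y → z ≠ z' → ¬ PointAdj C S K a x y → ¬ PointAdj C S K a z z' →
    ∃ w, PointAdj C S K a x w ∧ PointAdj C S K a y w ∧ PointAdj C S K a z w ∧
      PointAdj C S K a z' w
  three : ∀ D₁ ∈ S, ∀ D₂ ∈ S, ∀ D₃ ∈ S, AgreeOff K D₁ C → AgreeOff K D₂ C → AgreeOff K D₃ C →
    ∃ w, PointAdj C S K a (D₁ a) w ∧ PointAdj C S K a (D₂ a) w ∧ PointAdj C S K a (D₃ a) w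

/-! ### Lifting paths of points to the cover -/

namespace IsFlagCover

section

variable (π : A →* G) (C : ℕ → X) (S : Set (ℕ → X)) (Q : Set ℕ → Subgroup A) (K : Set ℕ) (a : ℕ)

/-- Two elements of the covering group lie over adjacent points, along a lifted line. -/
def Near (s t : A) : Prop :=
  PointAdj C S K a (π s • C a) (π t • C a) ∧
    ∃ u v, s⁻¹ * u ∈ Q (K \ {a}) ∧ u⁻¹ * v ∈ Q (K \ {a + 1}) ∧ v⁻¹ * t ∈ Q (K \ {a})

end

variable {π : A →* G} {C : ℕ → X} {S : Set (ℕ → X)} {Q : Set ℕ → Subgroup A}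
  {K : Set ℕ} {a : ℕ}

theorem inv_mul_mem_symm {H : Subgroup A} {s t : A} (h : s⁻¹ * t ∈ H) : t⁻¹ * s ∈ H := by
  simpa using H.inv_mem h

theorem inv_mul_mem_trans {H : Subgroup A} {s t r : A} (h : s⁻¹ * t ∈ H) (h' : t⁻¹ * r ∈ H) :
    s⁻¹ * r ∈ H := by
  simpa [mul_assoc] using H.mul_mem h h'

theorem Near.symm (ha : a ∈ K) {s t : A} (h : Near π C S Q K a s t) : Near π C S Q K a t s := by
  obtain ⟨h0, u, v, h1, h2, h3⟩ := h
  exact ⟨h0.symm ha, v, u, inv_mul_mem_symm h3, inv_mul_mem_symm h2, inv_mul_mem_symm h1⟩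

variable (hc : IsFlagCover π C S Q)
include hc

theorem smul_eq_of_mem {s t : A} {i : ℕ} {J : Set ℕ} (h : s⁻¹ * t ∈ Q J) (hi : i ∉ J) :
    π s • C i = π t • C i :=
  hc.agreeOff h i hi

/-- Together with symmetry this makes `Near` a relation between cosets of `Q (K \ {a})`, the points
of the cover. -/
theorem Near.congr {s t t' : A} (h : Near π C S Q K a s t)
    (h' : t⁻¹ * t' ∈ Q (K \ {a})) : Near π C S Q K a s t' := by
  obtain ⟨h0, u, v, h1, h2, h3⟩ := h
  refine ⟨?_, u, v, h1, h2, inv_mul_mem_trans h3 h'⟩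
  rwa [← hc.smul_eq_of_mem h' (by simp)]

theorem smul_mem_orbit (g : A) : π g • C ∈ S := hc.smul_mem _ _ hc.base_mem

/-- Lifting an edge, together with a pair of chambers realizing it. -/
theorem exists_near_of_chambers (hK : IsSimplyConnectedAt C S K a) {s : A} (hs : s ∈ Q K) {D D' : ℕ → X} (hD : D ∈ S) (hD' : D' ∈ S)
    (hDC : AgreeOff K D C) (hDD' : AgreeOff {a} D D') (hDa : D a = π s • C a)
    (hne : D a ≠ D' a) :
    ∃ u v, s⁻¹ * u ∈ Q (K \ {a}) ∧ u⁻¹ * v ∈ Q {a} ∧ π u • C = D ∧ π v • C = D' ∧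
      v ∈ Q K ∧ Near π C S Q K a s v := by
  have e1 : AgreeOff (K \ {a}) (π s • C) D := by
    refine AgreeOff.diff_singleton (fun i hi => ?_) hDa.symm
    rw [Pi.smul_apply, hc.map_mem hs i hi, hDC i hi]
  obtain ⟨u, hu, eu⟩ := hc.exists_lift hD e1
  obtain ⟨v, hv, ev⟩ := hc.exists_lift (s := u) (J := {a}) hD' (by rwa [eu])
  have hvK : v ∈ Q K := by
    have h1 := (Q K).mul_mem hs (hc.mono Set.sdiff_subset hu)
    have h2 := (Q K).mul_mem h1 (hc.mono (Set.singleton_subset_iff.2 hK.mem) hv)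
    simpa using h2
  refine ⟨u, v, hu, hv, eu, ev, hvK, ⟨?_, D, hD, D', hD', hDC, hDD', hDa, ?_⟩, u, v, hu, ?_, ?_⟩
  · rw [← hDa, ← Pi.smul_apply, ev]
    exact hne
  · rw [← ev, Pi.smul_apply]
  · refine hc.mono ?_ hv
    rintro _ rfl
    exact ⟨hK.mem, by simp⟩
  · simp

theorem exists_near (hK : IsSimplyConnectedAt C S K a) {s : A} (hs : s ∈ Q K) {y : X} (h : PointAdj C S K a (π s • C a) y) :
    ∃ t ∈ Q K, Near π C S Q K a s t ∧ π t • C a = y := by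
  obtain ⟨hne, D, hD, D', hD', hDC, hDD', hDa, rfl⟩ := h
  obtain ⟨u, v, -, -, -, ev, hv, hn⟩ :=
    hc.exists_near_of_chambers hK hs hD hD' hDC hDD' hDa (by rwa [hDa])
  exact ⟨v, hv, hn, by rw [← ev, Pi.smul_apply]⟩

variable (hK : IsSimplyConnectedAt C S K a) (hinj : ∀ J ⊂ K, InjectiveOnSubgroup π (Q J))
include hK hinj

/-- Two points determine their line, so both lifted edges lie over one line. Injectivity on `Q (K \
{a})` identifies the two lifted lines through `s`, and injectivity on `Q (K \ {a + 1})` then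
identifies their points over the common end. -/
theorem near_unique {s t t' : A} (h : Near π C S Q K a s t) (h' : Near π C S Q K a s t')
    (e : π t • C a = π t' • C a) : t⁻¹ * t' ∈ Q (K \ {a}) := by
  obtain ⟨⟨hne, -⟩, u, v, h1, h2, h3⟩ := h
  obtain ⟨-, u', v', h1', h2', h3'⟩ := h'
  have haH : a ∉ K \ {a} := by simp
  have haL : a + 1 ∉ K \ {a + 1} := by simp
  have es : π s • C a = π u • C a := hc.smul_eq_of_mem h1 haH
  have es' : π s • C a = π u' • C a := hc.smul_eq_of_mem h1' haH
  have et : π v • C a = π t • C a := hc.smul_eq_of_mem h3 haH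
  have et' : π v' • C a = π t' • C a := hc.smul_eq_of_mem h3' haH
  have hl := hK.line_unique _ (hc.smul_mem_orbit u) _ (hc.smul_mem_orbit v)
    _ (hc.smul_mem_orbit u') _ (hc.smul_mem_orbit v')
    (hc.smul_eq_of_mem h2 haL) (hc.smul_eq_of_mem h2' haL) (es.symm.trans es')
    (et.trans (e.trans et'.symm)) (by
      simp only [Pi.smul_apply]
      rwa [← es, et])
  have huu' : u⁻¹ * u' ∈ Q (K \ {a}) := inv_mul_mem_trans (inv_mul_mem_symm h1) h1'
  have huu2 : u⁻¹ * u' ∈ Q (K \ {a + 1}) :=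
    hc.mem_of_agreeOff (InjectiveOnSubgroup.of_ssubset hinj hK.mem) huu'
      ((hc.agreeOff (hc.mono Set.sdiff_subset huu')).diff_singleton hl) Set.inter_subset_right
  have hvv' : v⁻¹ * v' ∈ Q (K \ {a + 1}) :=
    inv_mul_mem_trans (inv_mul_mem_trans (inv_mul_mem_symm h2) huu2) h2'
  have hvv2 : v⁻¹ * v' ∈ Q (K \ {a}) :=
    hc.mem_of_agreeOff (InjectiveOnSubgroup.of_ssubset hinj hK.succ_mem) hvv'
      ((hc.agreeOff (hc.mono Set.sdiff_subset hvv')).diff_singleton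
        (et.trans (e.trans et'.symm))) Set.inter_subset_right
  exact inv_mul_mem_trans (inv_mul_mem_trans (inv_mul_mem_symm h3) hvv2) h3'

/-- The three edges are realized by chambers through one plane, so their lifts stay in one coset of
`Q (K \ {a + 2})`. There `π` is injective, and the lifted triangle closes. -/
theorem near_of_isPlanar {s t r : A} (hs : s ∈ Q K) (h1 : Near π C S Q K a s t)
    (h2 : Near π C S Q K a s r)
    (hp : IsPlanar C S K a (π s • C a) (π t • C a) (π r • C a)) : Near π C S Q K a t r := by
  obtain ⟨τ, ⟨n1, D₁, hD₁, E₁, hE₁, hDC₁, hDE₁, ha₁, hb₁, hτ₁⟩,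
    ⟨n2, D₂, hD₂, E₂, hE₂, hDC₂, hDE₂, ha₂, hb₂, hτ₂⟩,
    ⟨n3, D₃, hD₃, E₃, hE₃, hDC₃, hDE₃, ha₃, hb₃, hτ₃⟩⟩ := hp
  have a2 : ({a} : Set ℕ) ⊆ K \ {a + 2} := by
    rintro _ rfl
    exact ⟨hK.mem, by simp⟩
  have aK : ({a} : Set ℕ) ⊆ K := Set.singleton_subset_iff.2 hK.mem
  have na : a + 2 ∉ ({a} : Set ℕ) := by simp
  obtain ⟨u, u', hu, hu', eu, eu', hu'K, hnu⟩ :=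
    hc.exists_near_of_chambers hK hs hD₁ hE₁ hDC₁ hDE₁ ha₁ (by rwa [ha₁, hb₁])
  obtain ⟨v, v', hv, hv', ev, ev', hv'K, hnv⟩ :=
    hc.exists_near_of_chambers hK hs hD₂ hE₂ hDC₂ hDE₂ ha₂ (by rwa [ha₂, hb₂])
  have eu'a : π u' • C a = π t • C a := by rw [← hb₁, ← eu', Pi.smul_apply]
  have ev'a : π v' • C a = π r • C a := by rw [← hb₂, ← ev', Pi.smul_apply]
  have hut : u'⁻¹ * t ∈ Q (K \ {a}) := hc.near_unique hK hinj hnu h1 eu'a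
  have hvr : v'⁻¹ * r ∈ Q (K \ {a}) := hc.near_unique hK hinj hnv h2 ev'a
  -- Both chambers lie over the point of `s` and contain the plane `τ`, so they differ by an element
  -- that also fixes the type `a + 2`.
  have huv : u⁻¹ * v ∈ Q (K \ {a + 2}) := by
    refine hc.mem_of_agreeOff (J' := K \ {a + 2}) (InjectiveOnSubgroup.of_ssubset hinj hK.mem)
      (inv_mul_mem_trans (inv_mul_mem_symm hu) hv) ?_ Set.inter_subset_right
    rw [eu, ev]
    exact (hDC₁.trans hDC₂.symm).diff_singleton (hτ₁.trans hτ₂.symm)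
  have huv' : u'⁻¹ * v' ∈ Q (K \ {a + 2}) :=
    inv_mul_mem_trans (inv_mul_mem_symm (hc.mono a2 hu'))
      (inv_mul_mem_trans huv (hc.mono a2 hv'))
  obtain ⟨w, w', hw, hw', ew, ew', hw'K, hnw⟩ :=
    hc.exists_near_of_chambers hK hu'K hD₃ hE₃ hDC₃ hDE₃ (ha₃.trans eu'a.symm)
      (by rwa [ha₃, hb₃])
  have hu'w : u'⁻¹ * w ∈ Q (K \ {a + 2}) := by
    refine hc.mem_of_agreeOff (J' := K \ {a + 2}) (InjectiveOnSubgroup.of_ssubset hinj hK.mem)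
      hw ?_ Set.inter_subset_right
    rw [eu', ew]
    refine ((hDE₁.symm.mono aK).trans (hDC₁.trans hDC₃.symm)).diff_singleton ?_
    rw [← hDE₁ _ na, hτ₁, hτ₃]
  -- The triangle closes: `w'` and `v'` lie in one coset of `Q (K \ {a + 2})` and over the same
  -- point.
  have hwv : w'⁻¹ * v' ∈ Q (K \ {a}) := by
    refine hc.mem_of_agreeOff (J' := K \ {a}) (InjectiveOnSubgroup.of_ssubset hinj hK.add_two_mem)
      (inv_mul_mem_trans (inv_mul_mem_symm (hc.mono a2 hw'))
        (inv_mul_mem_trans (inv_mul_mem_symm hu'w) huv')) ?_ Set.inter_subset_right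
    rw [ew', ev']
    refine ((hDE₃.symm.mono aK).trans ((hDC₃.trans hDC₂.symm).trans
      (hDE₂.mono aK))).diff_singleton ?_
    rw [hb₃, hb₂]
  have hn1 : Near π C S Q K a u' r := hnw.congr hc (inv_mul_mem_trans hwv hvr)
  exact ((hn1.symm hK.mem).congr hc hut).symm hK.mem

/-- In the non-planar case the apex `w` is lifted to `q` from `s`. The two planar triangles at `s`
join `q` to `t` and `r`, and the third one, seen from `q`, gives the remaining edge. -/
theorem near_triangle {s t r : A} (hs : s ∈ Q K) (h1 : Near π C S Q K a s t)
    (h2 : Near π C S Q K a s r) (h3 : PointAdj C S K a (π t • C a) (π r • C a)) :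
    Near π C S Q K a t r := by
  rcases hK.triangle _ _ _ h1.1 h2.1 h3 with hp | ⟨w, p1, p2, p3⟩
  · exact hc.near_of_isPlanar hK hinj hs h1 h2 hp
  · obtain ⟨_, -, hw, -⟩ := id p1
    obtain ⟨q, hq, hsq, rfl⟩ := hc.exists_near hK hs hw.pointAdj
    have e1 := hc.near_of_isPlanar hK hinj hs h1 hsq p1
    have e2 := hc.near_of_isPlanar hK hinj hs h2 hsq p2
    exact hc.near_of_isPlanar hK hinj hq (e1.symm hK.mem) (e2.symm hK.mem) (p3.rotate hK.mem)

/-- If opposite vertices coincide, unique lifting applies; if they are adjacent, the diagonal cuts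
the quadrangle into two triangles. Otherwise a common neighbour of all four vertices cuts it into
four. -/
theorem near_square {s t u t' : A} (hs : s ∈ Q K) (ht : t ∈ Q K)
    (h1 : Near π C S Q K a s t) (h2 : Near π C S Q K a s t') (h3 : Near π C S Q K a t u)
    (h4 : PointAdj C S K a (π u • C a) (π t' • C a)) : Near π C S Q K a t' u := by
  have ha := hK.mem
  have tri := fun {s t r : A} => hc.near_triangle (s := s) (t := t) (r := r) hK hinj
  by_cases c1 : π s • C a = π u • C a
  · have := hc.near_unique hK hinj (h1.symm ha) h3 c1
    exact (h2.symm ha).congr hc this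
  by_cases c2 : π t • C a = π t' • C a
  · have := hc.near_unique hK hinj h1 h2 c2
    exact ((h3.symm ha).congr hc this).symm ha
  by_cases c3 : PointAdj C S K a (π s • C a) (π u • C a)
  · exact tri hs h2 (tri ht (h1.symm ha) h3 c3) (h4.symm ha)
  by_cases c4 : PointAdj C S K a (π t • C a) (π t' • C a)
  · exact tri ht (tri hs h1 h2 c4) h3 (h4.symm ha)
  obtain ⟨w, w1, w2, w3, w4⟩ := hK.square _ _ _ _ h1.1 h2.1 (h3.1.symm ha) h4 c1 c2 c3 c4
  obtain ⟨q, hq, hsq, rfl⟩ := hc.exists_near hK hs w1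
  have htq := tri hs h1 hsq w3
  have hqu := tri ht htq h3 (w2.symm ha)
  have hqt := tri hs hsq h2 (w4.symm ha)
  exact tri hq hqt hqu (h4.symm ha)

/-- Paths of length three starting at the identity can be shortened to paths of length two. -/
theorem two_step {s t : A} (hs : s ∈ Q K) (ht : t ∈ Q K)
    (h : ∃ q ∈ Q K, Near π C S Q K a 1 q ∧ Near π C S Q K a q s)
    (hst : Near π C S Q K a s t) :
    ∃ q ∈ Q K, Near π C S Q K a 1 q ∧ Near π C S Q K a q t := by
  have ha := hK.mem
  obtain ⟨q, hq, h1, h2⟩ := h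
  have orb := fun {s : A} (hs : s ∈ Q K) => (hc.agreeOff (s := s) (t := 1) (J := K)
    (by simpa using hs)).trans (by rw [map_one, one_smul]; exact AgreeOff.refl K C)
  -- With `p` over a common neighbour of the points of `1`, `s` and `t`, the quadrangle `1, q, s, p`
  -- and the triangle `s, p, t` both close in the cover.
  obtain ⟨w, w1, w2, w3⟩ := hK.three _ (hc.smul_mem_orbit 1) _
    (hc.smul_mem_orbit s) _ (hc.smul_mem_orbit t) (orb (one_mem _)) (orb hs) (orb ht)
  obtain ⟨p, hp, h1p, rfl⟩ := hc.exists_near hK (one_mem _) w1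
  have hps : Near π C S Q K a p s := hc.near_square hK hinj (one_mem _) hq h1 h1p h2 w2
  exact ⟨p, hp, h1p, hc.near_triangle hK hinj hs (hps.symm ha) hst (w3.symm ha)⟩

/-- The elements reachable from `1` in two steps are stable under right multiplication by the
generators: `Q (K \ {a})` does not change the point, and `Q {a}` either fixes it or moves it along
an edge, after which `two_step` shortens the path. -/
theorem exists_two_path (hgen : Q K ≤ Q (K \ {a}) ⊔ Q {a}) {g : A} (hg : g ∈ Q K) :
    ∃ q ∈ Q K, Near π C S Q K a 1 q ∧ Near π C S Q K a q g := by
  have ha := hK.mem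
  have hH : Q (K \ {a}) ≤ Q K := hc.mono Set.sdiff_subset
  have hL : Q {a} ≤ Q K := hc.mono (Set.singleton_subset_iff.2 ha)
  let R : Bool → Subgroup A := fun b => bif b then Q (K \ {a}) else Q {a}
  have hR : Q K = ⨆ b, R b := by
    rw [iSup_bool_eq]
    exact le_antisymm hgen (sup_le hH hL)
  have aL : ({a} : Set ℕ) ⊆ K \ {a + 1} := by
    rintro _ rfl
    exact ⟨ha, by simp⟩
  have key : ∀ x ∈ Q K, ∀ s ∈ Q K,
      (∃ q ∈ Q K, Near π C S Q K a 1 q ∧ Near π C S Q K a q s) →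
      s * x ∈ Q K ∧ ∃ q ∈ Q K, Near π C S Q K a 1 q ∧ Near π C S Q K a q (s * x) := by
    intro x hx
    rw [hR] at hx
    refine Subgroup.iSup_induction R (C := fun x => ∀ s ∈ Q K,
      (∃ q ∈ Q K, Near π C S Q K a 1 q ∧ Near π C S Q K a q s) →
      s * x ∈ Q K ∧ ∃ q ∈ Q K, Near π C S Q K a 1 q ∧ Near π C S Q K a q (s * x)) hx ?_ ?_ ?_
    · rintro (_ | _) x hx s hs h
      · change x ∈ Q {a} at hx
        refine ⟨(Q K).mul_mem hs (hL hx), ?_⟩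
        by_cases e : π s • C a = π (s * x) • C a
        · obtain ⟨q, hq, h1, h2⟩ := h
          have hinja : InjectiveOnSubgroup π (Q {a}) := fun g hg =>
            InjectiveOnSubgroup.of_ssubset hinj hK.succ_mem g (hc.mono aL hg)
          refine ⟨q, hq, h1, h2.congr hc ?_⟩
          -- The image of an element of `Q {a}` that fixes the entry at `a` as well fixes every
          -- entry, which places the element in `Q ∅`.
          refine hc.mem_of_agreeOff (J := {a}) (J' := ∅) hinja (by simpa using hx) ?_ (by simp)
          intro i _
          by_cases hi : i = a
          · rw [hi]; exact e
          · exact hc.agreeOff (s := s) (t := s * x) (J := {a}) (by simpa using hx) i hi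
        · refine hc.two_step hK hinj hs ((Q K).mul_mem hs (hL hx)) h ⟨⟨e, ?_⟩, ?_⟩
          · refine ⟨π s • C, hc.smul_mem_orbit s, π (s * x) • C, hc.smul_mem_orbit _, ?_, ?_,
              rfl, rfl⟩
            · intro i hi
              exact hc.map_mem hs i hi
            · exact hc.agreeOff (by simpa using hx)
          · exact ⟨s, s * x, by simp, by simpa using hc.mono aL hx, by simp⟩
      · change x ∈ Q (K \ {a}) at hx
        obtain ⟨q, hq, h1, h2⟩ := h
        exact ⟨(Q K).mul_mem hs (hH hx), q, hq, h1, h2.congr hc (by simpa using hx)⟩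
    · intro s hs h
      rw [mul_one]
      exact ⟨hs, h⟩
    · intro x y hx hy s hs h
      rw [← mul_assoc]
      exact hy _ (hx s hs h).1 (hx s hs h).2
  -- The induction starts from a path out to some neighbour of the base point and back.
  have := key g hg 1 (one_mem _) (by
    obtain ⟨w, w1, -⟩ := hK.three C hc.base_mem C hc.base_mem C hc.base_mem
      (AgreeOff.refl K C) (AgreeOff.refl K C) (AgreeOff.refl K C)
    obtain ⟨q, hq, h1, -⟩ := hc.exists_near hK (s := 1) (one_mem _) (by simpa using w1)
    exact ⟨q, hq, h1, h1.symm ha⟩)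
  rw [one_mul] at this
  exact this.2

/-- A residue with simply connected graph of points has no proper covering. -/
theorem injectiveOnSubgroup (hgen : Q K ≤ Q (K \ {a}) ⊔ Q {a}) :
    InjectiveOnSubgroup π (Q K) := by
  intro g hg hg1
  obtain ⟨q, hq, h1, h2⟩ := hc.exists_two_path hK hinj hgen hg
  have := hc.near_unique hK hinj (h1.symm hK.mem) h2 (by rw [hg1, map_one])
  exact InjectiveOnSubgroup.of_ssubset hinj hK.mem g (by simpa using this) hg1

end IsFlagCover

end FlagCover

/-! ### Alternating forms -/

section Alternating

variable {F : Type u} {V : Type v} [Field F] [AddCommGroup V] [Module F V]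

/-- The restriction of `s` to the subspace `U` is nondegenerate. -/
def NondegOn (s : LinearMap.BilinForm F V) (U : Submodule F V) : Prop :=
  ∀ x ∈ U, (∀ y ∈ U, s x y = 0) → x = 0

/-- No nonzero vector of `U` is orthogonal to `M`. -/
def MeetsRadTrivially (s : LinearMap.BilinForm F V) (U M : Submodule F V) : Prop :=
  ∀ x ∈ U, (∀ y ∈ M, s x y = 0) → x = 0

variable {s : LinearMap.BilinForm F V}

theorem apply_eq_zero_comm (hs : s.IsAlt) {x y : V} : s x y = 0 ↔ s y x = 0 := by
  rw [← hs.neg_eq x y, neg_eq_zero]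

theorem mem_subspaceRadical (hs : s.IsAlt) {U : Submodule F V} {x : V} :
    x ∈ subspaceRadical s U ↔ x ∈ U ∧ ∀ y ∈ U, s x y = 0 := by
  rw [subspaceRadical, Submodule.mem_inf, LinearMap.BilinForm.mem_orthogonal_iff]
  refine and_congr_right fun _ => forall₂_congr fun y _ => ?_
  exact apply_eq_zero_comm hs

theorem nondegOn_iff (hs : s.IsAlt) {U : Submodule F V} :
    NondegOn s U ↔ subspaceRadical s U = ⊥ := by
  rw [Submodule.eq_bot_iff]
  simp only [mem_subspaceRadical hs, NondegOn, and_imp]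

theorem nondegOn_bot : NondegOn s ⊥ := fun _ hx _ => (Submodule.mem_bot F).1 hx

theorem NondegOn.meetsRadTrivially {U M : Submodule F V} (hU : NondegOn s U) (h : U ≤ M) :
    MeetsRadTrivially s U M :=
  fun x hx hy => hU x hx fun y hyU => hy y (h hyU)

theorem meetsRadTrivially_iff (hs : s.IsAlt) {U M : Submodule F V} (h : U ≤ M) :
    MeetsRadTrivially s U M ↔ U ⊓ subspaceRadical s M = ⊥ := by
  rw [Submodule.eq_bot_iff]
  simp only [Submodule.mem_inf, mem_subspaceRadical hs, MeetsRadTrivially, and_imp]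
  exact ⟨fun H x hx _ hy => H x hx hy, fun H x hx hy => H x hx (h hx) hy⟩

/-- Orthogonal projection to a nondegenerate subspace. -/
theorem NondegOn.exists_proj [FiniteDimensional F V] (hs : s.IsAlt) {U : Submodule F V}
    (hU : NondegOn s U) (v : V) : ∃ u ∈ U, ∀ y ∈ U, s y (v - u) = 0 := by
  have hc : IsCompl U (s.orthogonal U) := by
    refine LinearMap.BilinForm.isCompl_orthogonal_of_restrict_nondegenerate hs.isRefl ?_
    refine s.nondegenerate_restrict_of_disjoint_orthogonal hs.isRefl ?_
    rw [Submodule.disjoint_def]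
    exact fun x hx hx' => hU x hx fun y hy => (apply_eq_zero_comm hs).1 (hx' y hy)
  have hv : v ∈ U ⊔ s.orthogonal U := by
    rw [hc.sup_eq_top]
    trivial
  obtain ⟨u, hu, w, hw, rfl⟩ := Submodule.mem_sup.1 hv
  refine ⟨u, hu, fun y hy => ?_⟩
  rw [add_sub_cancel_left]
  exact hw y hy

theorem NondegOn.sup_pair (hs : s.IsAlt) {U : Submodule F V} (hU : NondegOn s U) {v w : V}
    (hv : ∀ u ∈ U, s u v = 0) (hw : ∀ u ∈ U, s u w = 0) (hvw : s v w ≠ 0) :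
    NondegOn s (U ⊔ Submodule.span F {v, w}) := by
  intro x hx h
  obtain ⟨u, hu, z, hz, rfl⟩ := Submodule.mem_sup.1 hx
  obtain ⟨α, β, rfl⟩ := Submodule.mem_span_pair.1 hz
  have hvm : v ∈ U ⊔ Submodule.span F {v, w} :=
    (le_sup_right : _ ≤ U ⊔ _) (Submodule.subset_span (by simp))
  have hwm : w ∈ U ⊔ Submodule.span F {v, w} :=
    (le_sup_right : _ ≤ U ⊔ _) (Submodule.subset_span (by simp))
  have hvu : ∀ u ∈ U, s v u = 0 := fun u hu => (apply_eq_zero_comm hs).1 (hv u hu)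
  have hwu : ∀ u ∈ U, s w u = 0 := fun u hu => (apply_eq_zero_comm hs).1 (hw u hu)
  have h1 := h w hwm
  have h2 := h v hvm
  simp only [map_add, map_smul, LinearMap.add_apply, LinearMap.smul_apply, hv u hu, hw u hu,
    hs v, hs w, smul_eq_mul, mul_zero, add_zero, zero_add, mul_eq_zero] at h1 h2
  have hα : α = 0 := h1.resolve_right hvw
  have hβ : β = 0 := h2.resolve_right fun h => hvw ((apply_eq_zero_comm hs).1 h)
  have hu0 : u = 0 := hU u hu fun y hy => by
    have := h y ((le_sup_left : U ≤ _) hy)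
    simpa [hα, hβ] using this
  simp [hα, hβ, hu0]

theorem finrank_sup_span_pair [FiniteDimensional F V] (hs : s.IsAlt) {U : Submodule F V} {v w : V}
    (hU : NondegOn s U) (hv : ∀ u ∈ U, s u v = 0) (hvw : s v w ≠ 0) :
    v ∉ U ∧ w ∉ U ⊔ Submodule.span F {v} ∧
    finrank F (U ⊔ Submodule.span F {v, w} : Submodule F V) = finrank F U + 2 := by
  have h1 : v ∉ U := by
    intro h
    have : v = 0 := hU v h fun y hy => (apply_eq_zero_comm hs).1 (hv y hy)
    simp [this] at hvw
  have h2 : w ∉ U ⊔ Submodule.span F {v} := by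
    intro h
    obtain ⟨u, hu, z, hz, e⟩ := Submodule.mem_sup.1 h
    obtain ⟨α, rfl⟩ := Submodule.mem_span_singleton.1 hz
    apply hvw
    rw [← e, map_add, map_smul, hs v, smul_zero, add_zero]
    exact (apply_eq_zero_comm hs).1 (hv u hu)
  refine ⟨h1, h2, ?_⟩
  have e : U ⊔ Submodule.span F {v, w} = U ⊔ Submodule.span F {v} ⊔ Submodule.span F {w} := by
    rw [sup_assoc, ← Submodule.span_union, Set.singleton_union]
  rw [e, Submodule.finrank_sup_span_singleton h2, Submodule.finrank_sup_span_singleton h1]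

/-- Splitting off a hyperbolic plane lowers the dimension by two and leaves the radical unchanged; a
totally isotropic subspace is its own radical. -/
theorem even_finrank_add_finrank_radical [FiniteDimensional F V] (hs : s.IsAlt) :
    ∀ (n : ℕ) (U : Submodule F V), finrank F U = n →
      Even (finrank F U + finrank F (subspaceRadical s U)) := by
  intro n
  induction n using Nat.strong_induction_on with
  | _ n ih =>
  intro U hn
  by_cases h0 : ∀ v ∈ U, ∀ w ∈ U, s v w = 0
  · have : subspaceRadical s U = U := by
      ext x
      rw [mem_subspaceRadical hs]
      exact ⟨fun h => h.1, fun h => ⟨h, h0 x h⟩⟩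
    rw [this]
    exact ⟨_, rfl⟩
  push Not at h0
  obtain ⟨v, hv, w, hw, hvw⟩ := h0
  have hb := finrank_sup_span_pair hs (nondegOn_bot (s := s)) (v := v) (w := w) (by simp) hvw
  have hnd := (nondegOn_bot (s := s)).sup_pair hs (v := v) (w := w) (by simp) (by simp) hvw
  rw [finrank_bot, zero_add, bot_sup_eq, bot_sup_eq] at hb
  rw [bot_sup_eq] at hnd
  set P := Submodule.span F {v, w}
  have hPU : P ≤ U := Submodule.span_le.2 (by rintro _ (rfl | rfl) <;> assumption)
  set W := U ⊓ s.orthogonal P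
  have hdec : ∀ x ∈ U, ∃ p ∈ P, x - p ∈ W := by
    intro x hx
    obtain ⟨p, hp, h⟩ := hnd.exists_proj hs x
    exact ⟨p, hp, U.sub_mem hx (hPU hp), h⟩
  have hsup : P ⊔ W = U := by
    refine le_antisymm (sup_le hPU inf_le_left) fun x hx => ?_
    obtain ⟨p, hp, h⟩ := hdec x hx
    exact Submodule.mem_sup.2 ⟨p, hp, _, h, by simp⟩
  have hinf : P ⊓ W = ⊥ := by
    rw [Submodule.eq_bot_iff]
    rintro x ⟨hx, -, hx'⟩
    exact hnd x hx fun y hy => (apply_eq_zero_comm hs).1 (hx' y hy)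
  have hdim := Submodule.finrank_sup_add_finrank_inf_eq P W
  rw [hsup, hinf, finrank_bot, add_zero, hb.2.2] at hdim
  have hrad : subspaceRadical s W = subspaceRadical s U := by
    ext x
    rw [mem_subspaceRadical hs, mem_subspaceRadical hs]
    constructor
    · rintro ⟨⟨hxU, hxP⟩, h⟩
      refine ⟨hxU, fun y hy => ?_⟩
      obtain ⟨p, hp, hq⟩ := hdec y hy
      have h1 : s x p = 0 := (apply_eq_zero_comm hs).1 (hxP p hp)
      have h2 := h _ hq
      rwa [map_sub, h1, sub_zero] at h2
    · rintro ⟨hxU, h⟩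
      exact ⟨⟨hxU, fun p hp => (apply_eq_zero_comm hs).1 (h p (hPU hp))⟩, fun y hy => h y hy.1⟩
  have := ih (finrank F W) (by omega) W rfl
  rw [hrad] at this
  rw [hdim, add_assoc]
  exact even_two.add this

/-- Parity excludes a radical of dimension exactly one. -/
theorem nondegOn_of_even [FiniteDimensional F V] (hs : s.IsAlt) {U : Submodule F V}
    (h : Even (finrank F U)) (h1 : finrank F (subspaceRadical s U) ≤ 1) : NondegOn s U := by
  rw [nondegOn_iff hs, ← Submodule.finrank_eq_zero]
  have := even_finrank_add_finrank_radical hs _ U rfl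
  rw [Nat.even_add] at this
  have h2 := this.1 h
  obtain ⟨k, hk⟩ := h2
  omega

theorem exists_mem_ne_zero_two {N : Submodule F V} {φ₁ φ₂ : V →ₗ[F] F} (h₁ : ∃ x ∈ N, φ₁ x ≠ 0)
    (h₂ : ∃ x ∈ N, φ₂ x ≠ 0) : ∃ x ∈ N, φ₁ x ≠ 0 ∧ φ₂ x ≠ 0 := by
  obtain ⟨x, hx, hx1⟩ := h₁
  obtain ⟨y, hy, hy2⟩ := h₂
  by_cases c1 : φ₂ x = 0
  · by_cases c2 : φ₁ y = 0
    · exact ⟨x + y, N.add_mem hx hy, by simp [c2, hx1], by simp [c1, hy2]⟩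
    · exact ⟨y, hy, c2, hy2⟩
  · exact ⟨x, hx, hx1, c1⟩

/-- Over a field with more than two elements, three proper hyperplanes do not cover. -/
theorem exists_mem_ne_zero_three (hF : ∃ t : F, t ≠ 0 ∧ t ≠ 1) {N : Submodule F V}
    {φ₁ φ₂ φ₃ : V →ₗ[F] F} (h₁ : ∃ x ∈ N, φ₁ x ≠ 0) (h₂ : ∃ x ∈ N, φ₂ x ≠ 0)
    (h₃ : ∃ x ∈ N, φ₃ x ≠ 0) : ∃ x ∈ N, φ₁ x ≠ 0 ∧ φ₂ x ≠ 0 ∧ φ₃ x ≠ 0 := by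
  by_contra hcon
  push Not at hcon
  obtain ⟨t, ht0, ht1⟩ := hF
  obtain ⟨w, hw, hw1, hw2⟩ := exists_mem_ne_zero_two h₁ h₂
  obtain ⟨x, hx, hx3⟩ := h₃
  have hw3 := hcon w hw hw1 hw2
  -- On the line `w + c • x` the functional `φ₃` vanishes only at `c = 0`, so for every other `c`
  -- one of `φ₁`, `φ₂` must vanish.
  have hc : ∀ c : F, c ≠ 0 → φ₁ w + c * φ₁ x = 0 ∨ φ₂ w + c * φ₂ x = 0 := by
    intro c hc
    by_contra! h
    have := hcon (w + c • x) (N.add_mem hw (N.smul_mem c hx)) (by simpa using h.1)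
      (by simpa using h.2)
    simp [hw3, hc, hx3] at this
  -- If one of the two is a nonzero constant along the line, the other vanishes at `c = 1` and at `c
  -- = t`, hence everywhere. This is where a third field element is needed.
  have aux : ∀ α β γ δ : F, α ≠ 0 → β ≠ 0 → γ = 0 → (∀ c : F, c ≠ 0 → α + c * γ = 0 ∨
      β + c * δ = 0) → False := by
    rintro α β γ δ hα hβ rfl h
    simp only [mul_zero, add_zero, hα, false_or] at h
    have e1 := h 1 one_ne_zero
    have e2 := h t ht0
    have e3 : (t - 1) * δ = 0 := by linear_combination e2 - e1
    have e4 : δ = 0 := (mul_eq_zero.1 e3).resolve_left (sub_ne_zero.2 ht1)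
    simp [e4, hβ] at e1
  by_cases c1 : φ₁ x = 0
  · exact aux _ _ _ _ hw1 hw2 c1 hc
  by_cases c2 : φ₂ x = 0
  · exact aux _ _ _ _ hw2 hw1 c2 fun c h => (hc c h).symm
  exact hx3 (hcon x hx c1 c2)

end Alternating

/-! ### Symplectic flags -/

section SymplecticFlag

variable {F : Type u} {V : Type v} [Field F] [AddCommGroup V] [Module F V]

/-- A complete flag of subspaces whose members of even dimension are nondegenerate, continued by
`⊤`. -/
structure IsSymplecticFlag (s : LinearMap.BilinForm F V) (D : ℕ → Submodule F V) : Prop where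
  mono : Monotone D
  finrank_eq : ∀ i ≤ finrank F V, finrank F (D i) = i
  eq_top : ∀ i, finrank F V ≤ i → D i = ⊤
  nondegOn : ∀ i ≤ finrank F V, Even i → NondegOn s (D i)

variable {s : LinearMap.BilinForm F V}

namespace IsSymplecticFlag

variable {C D : ℕ → Submodule F V}

theorem smul_eq_map (g : symplecticGroupOf s) (U : Submodule F V) :
    g • U = U.map (g.1 : V →ₗ[F] V) := rfl

variable [FiniteDimensional F V]

theorem eq_bot (hD : IsSymplecticFlag s D) : D 0 = ⊥ :=
  Submodule.finrank_eq_zero.1 (hD.finrank_eq 0 (Nat.zero_le _))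

theorem finrank_radical_le_one (hs : s.IsAlt) (hD : IsSymplecticFlag s D) {i : ℕ}
    (hi : i ≤ finrank F V) : finrank F (subspaceRadical s (D i)) ≤ 1 := by
  rcases Nat.even_or_odd' i with ⟨k, rfl | rfl⟩
  · rw [(nondegOn_iff hs).1 (hD.nondegOn _ hi (even_two_mul k)), finrank_bot]
    exact zero_le_one
  · have h1 : subspaceRadical s (D (2 * k + 1)) ⊓ D (2 * k) = ⊥ := by
      rw [inf_comm, ← meetsRadTrivially_iff hs (hD.mono (Nat.le_succ _))]
      exact (hD.nondegOn _ (by omega) (even_two_mul k)).meetsRadTrivially (hD.mono (Nat.le_succ _))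
    have h2 := Submodule.finrank_sup_add_finrank_inf_eq (subspaceRadical s (D (2 * k + 1)))
      (D (2 * k))
    have h3 : finrank F (subspaceRadical s (D (2 * k + 1)) ⊔ D (2 * k) : Submodule F V) ≤
        finrank F (D (2 * k + 1)) :=
      Submodule.finrank_mono (sup_le (fun x hx => ((mem_subspaceRadical hs).1 hx).1)
        (hD.mono (Nat.le_succ _)))
    rw [h1, finrank_bot, hD.finrank_eq _ (by omega)] at h2
    rw [hD.finrank_eq _ hi] at h3
    omega

theorem exists_orthogonal_of_lt (hs : s.IsAlt) (hD : IsSymplecticFlag s D) {i : ℕ}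
    (hi : i < finrank F V) (he : Even i) :
    ∃ e ∈ D (i + 1), (∀ u ∈ D i, s u e = 0) ∧ e ≠ 0 := by
  have h : ¬ D (i + 1) ≤ D i := fun h => by
    have := Submodule.finrank_mono h
    rw [hD.finrank_eq _ hi, hD.finrank_eq _ hi.le] at this
    omega
  obtain ⟨x, hx, hx'⟩ := SetLike.not_le_iff_exists.1 h
  obtain ⟨u, hu, hxu⟩ := (hD.nondegOn i hi.le he).exists_proj hs x
  exact ⟨x - u, (D (i + 1)).sub_mem hx (hD.mono (Nat.le_succ i) hu), hxu,
    fun h => hx' (by rwa [sub_eq_zero.1 h])⟩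

/-- The bounds sit inside the conclusion so that pairs can be chosen for all `i` at once; in odd
dimension the last block has `e` but no partner `f`. -/
theorem exists_hyperbolic (hs : s.IsAlt) (hD : IsSymplecticFlag s D) (i : ℕ) (he : Even i) :
    ∃ e f : V, (i < finrank F V → e ∈ D (i + 1) ∧ (∀ u ∈ D i, s u e = 0) ∧ e ≠ 0) ∧
      (i + 1 < finrank F V → f ∈ D (i + 2) ∧ (∀ u ∈ D i, s u f = 0) ∧ s e f = 1) := by
  by_cases h1 : i < finrank F V
  · obtain ⟨e, h⟩ := hD.exists_orthogonal_of_lt hs h1 he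
    by_cases h2 : i + 1 < finrank F V
    · have hnd := hD.nondegOn (i + 2) h2 (by simpa [Nat.even_add] using he)
      have : ∃ y ∈ D (i + 2), s e y ≠ 0 := by
        by_contra! hcon
        exact h.2.2 (hnd e (hD.mono (Nat.le_succ _) h.1) hcon)
      obtain ⟨y, hy, hey⟩ := this
      obtain ⟨u, hu, hyu⟩ := (hD.nondegOn i h1.le he).exists_proj hs y
      have hey' : s e (y - u) = s e y := by
        rw [map_sub, (apply_eq_zero_comm hs).1 (h.2.1 u hu), sub_zero]
      refine ⟨e, (s e y)⁻¹ • (y - u), fun _ => h, fun _ => ⟨?_, ?_, ?_⟩⟩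
      · exact (D (i + 2)).smul_mem _ ((D (i + 2)).sub_mem hy (hD.mono (Nat.le_add_right _ _) hu))
      · intro x hx
        rw [map_smul, hyu x hx, smul_zero]
      · rw [map_smul, hey', smul_eq_mul, inv_mul_cancel₀ hey]
    · exact ⟨e, 0, fun _ => h, fun h => absurd h h2⟩
  · exact ⟨0, 0, fun h => absurd h h1, fun h => absurd (by omega) h1⟩

/-- The Gram matrix of a symplectic basis. -/
def stdGram (F : Type u) [Field F] (i j : ℕ) : F :=
  if Even i ∧ j = i + 1 then 1 else if Even j ∧ i = j + 1 then -1 else 0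

/-- Gram–Schmidt in blocks of two: `d (2 * k)` and `d (2 * k + 1)` form a hyperbolic pair orthogonal
to the nondegenerate `D (2 * k)`, with a single vector left over in odd dimension. -/
theorem exists_adapted (hs : s.IsAlt) (hD : IsSymplecticFlag s D) :
    ∃ d : ℕ → V, (∀ i ≤ finrank F V, D i = Submodule.span F (d '' {j | j < i})) ∧
      ∀ i < finrank F V, ∀ j < finrank F V, s (d i) (d j) = stdGram F i j := by
  choose e f he hf using fun k => hD.exists_hyperbolic hs (2 * k) (even_two_mul k)
  set d : ℕ → V := fun i => if Even i then e (i / 2) else f (i / 2) with hd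
  have dE : ∀ k, d (2 * k) = e k := fun k => by simp [hd]
  have dO : ∀ k, d (2 * k + 1) = f k := fun k => by
    have h1 : ¬ Even (2 * k + 1) := by simp
    have h2 : (2 * k + 1) / 2 = k := by omega
    simp only [hd, h1, h2, if_false]
  have hmem : ∀ i < finrank F V, d i ∈ D (i + 1) := by
    intro i hi
    rcases Nat.even_or_odd' i with ⟨k, rfl | rfl⟩
    · rw [dE]; exact (he k hi).1
    · rw [dO]; exact (hf k hi).1
  have hperp : ∀ i < finrank F V, ∀ u ∈ D (2 * (i / 2)), s u (d i) = 0 := by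
    intro i hi
    rcases Nat.even_or_odd' i with ⟨k, rfl | rfl⟩
    · rw [dE, show 2 * k / 2 = k by omega]; exact (he k hi).2.1
    · rw [dO, show (2 * k + 1) / 2 = k by omega]; exact (hf k hi).2.1
  have hlt : ∀ i j, i < j → j < finrank F V → s (d i) (d j) = stdGram F i j := by
    intro i j hij hj
    -- In different blocks, `d j` is orthogonal to `D (2 * (j / 2))`, which already contains `d i`.
    by_cases hb : i / 2 < j / 2
    · rw [hperp j hj _ (hD.mono (show i + 1 ≤ 2 * (j / 2) by omega) (hmem i (by omega)))]
      rw [stdGram, if_neg, if_neg]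
      · omega
      · rintro ⟨⟨k, rfl⟩, rfl⟩
        omega
    · have hk : ∃ k, i = 2 * k ∧ j = 2 * k + 1 := ⟨i / 2, by omega, by omega⟩
      obtain ⟨k, rfl, rfl⟩ := hk
      rw [dE, dO, (hf _ hj).2.2, stdGram, if_pos ⟨even_two_mul _, rfl⟩]
  have hneg : ∀ i j, i < j → stdGram F j i = - stdGram F i j := by
    intro i j hij
    rw [stdGram, stdGram, if_neg (show ¬ (Even j ∧ i = j + 1) by omega),
      if_neg (show ¬ (Even j ∧ i = j + 1) by omega)]
    split_ifs <;> simp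
  refine ⟨d, fun i => ?_, fun i hi j hj => ?_⟩
  · induction i with
    | zero => simpa using hD.eq_bot
    | succ i ih =>
      intro hi
      have hnm : d i ∉ D i := by
        rcases Nat.even_or_odd' i with ⟨k, rfl | rfl⟩
        · intro h
          rw [dE] at h
          exact (he k hi).2.2 (hD.nondegOn _ (by omega) (even_two_mul k) _ h fun y hy =>
            (apply_eq_zero_comm hs).1 ((he k hi).2.1 y hy))
        · intro h
          rw [dO] at h
          have hek := he k (by omega)
          have hfk := hf k hi
          have h1 := finrank_sup_span_pair hs (hD.nondegOn (2 * k) (by omega) (even_two_mul k))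
            hek.2.1 (w := f k) (by rw [hfk.2.2]; exact one_ne_zero)
          have h2 : D (2 * k) ⊔ Submodule.span F {e k} = D (2 * k + 1) := by
            refine Submodule.eq_of_le_of_finrank_eq (sup_le (hD.mono (Nat.le_succ _)) ?_) ?_
            · rw [Submodule.span_singleton_le_iff_mem]
              exact hek.1
            · rw [Submodule.finrank_sup_span_singleton h1.1, hD.finrank_eq _ (by omega),
                hD.finrank_eq _ (by omega)]
          exact h1.2.1 (h2 ▸ h)
      have hset : {j | j < i + 1} = insert i {j | j < i} := by
        ext j
        simp only [Set.mem_ofPred_eq, Set.mem_insert_iff]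
        omega
      rw [hset, Set.image_insert_eq, Submodule.span_insert, ← ih (by omega), sup_comm]
      symm
      refine Submodule.eq_of_le_of_finrank_eq (sup_le (hD.mono (Nat.le_succ _)) ?_) ?_
      · rw [Submodule.span_singleton_le_iff_mem]
        exact hmem i hi
      · rw [Submodule.finrank_sup_span_singleton hnm, hD.finrank_eq _ (by omega),
          hD.finrank_eq _ (by omega)]
  · rcases lt_trichotomy i j with h | rfl | h
    · exact hlt i j h hj
    · rw [hs, stdGram, if_neg (by omega), if_neg (by omega)]
    · rw [← hs.neg_eq, hlt j i h hi, hneg j i h]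

/-- The symplectic group is transitive on symplectic flags. -/
theorem exists_smul_eq (hs : s.IsAlt) (hC : IsSymplecticFlag s C) (hD : IsSymplecticFlag s D) :
    ∃ g : symplecticGroupOf s, g • C = D := by
  obtain ⟨c, hc, hcc⟩ := hC.exists_adapted hs
  obtain ⟨d, hd, hdd⟩ := hD.exists_adapted hs
  have hbas : ∀ (E : ℕ → Submodule F V) (e : ℕ → V), IsSymplecticFlag s E →
      (∀ i ≤ finrank F V, E i = Submodule.span F (e '' {j | j < i})) →
      ∃ b : Basis (Fin (finrank F V)) F V, ∀ i, b i = e i := by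
    intro E e hE he
    have hr : Set.range (fun i : Fin (finrank F V) => e i) = e '' {j | j < finrank F V} := by
      ext x
      simp only [Set.mem_range, Set.mem_image, Set.mem_ofPred_eq]
      exact ⟨fun ⟨i, hi⟩ => ⟨i, i.2, hi⟩, fun ⟨i, h, hi⟩ => ⟨⟨i, h⟩, hi⟩⟩
    refine ⟨basisOfTopLeSpanOfCardEqFinrank (fun i : Fin (finrank F V) => e i) ?_ (by simp),
      fun i => congrFun (coe_basisOfTopLeSpanOfCardEqFinrank _ _ _) i⟩
    rw [hr, ← he _ le_rfl, hE.eq_top _ le_rfl]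
  obtain ⟨b, hb⟩ := hbas C c hC hc
  obtain ⟨b', hb'⟩ := hbas D d hD hd
  set g : V ≃ₗ[F] V := b.equiv b' (Equiv.refl _) with hg
  have hgc : ∀ i < finrank F V, g (c i) = d i := by
    intro i hi
    have := b.equiv_apply (b' := b') (e := Equiv.refl _) (i := ⟨i, hi⟩)
    rwa [hb, hb'] at this
  have hform : s.compl₁₂ (g : V →ₗ[F] V) (g : V →ₗ[F] V) = s := by
    refine LinearMap.BilinForm.ext_basis b fun i j => ?_
    rw [LinearMap.compl₁₂_apply, hb, hb, LinearEquiv.coe_coe, hgc _ i.2, hgc _ j.2,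
      hcc _ i.2 _ j.2, hdd _ i.2 _ j.2]
  refine ⟨⟨g, fun x y => LinearMap.congr_fun₂ hform x y⟩, funext fun i => ?_⟩
  rw [Pi.smul_apply, smul_eq_map]
  rcases le_total i (finrank F V) with hi | hi
  · rw [hc i hi, hd i hi, Submodule.map_span, ← Set.image_comp]
    congr 1
    refine Set.image_congr fun j hj => ?_
    exact hgc j (lt_of_lt_of_le hj hi)
  · rw [hC.eq_top i hi, hD.eq_top i hi]
    exact (LinearMap.range_eq_map _).symm.trans (LinearEquiv.range g)

omit [FiniteDimensional F V] in
theorem smul (hD : IsSymplecticFlag s D) (g : symplecticGroupOf s) : IsSymplecticFlag s (g • D) where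
  mono i j hij := by
    rw [Pi.smul_apply, Pi.smul_apply, smul_eq_map, smul_eq_map]
    exact Submodule.map_mono (hD.mono hij)
  finrank_eq i hi := by
    rw [Pi.smul_apply, smul_eq_map, LinearEquiv.finrank_map_eq, hD.finrank_eq i hi]
  eq_top i hi := by
    rw [Pi.smul_apply, smul_eq_map, hD.eq_top i hi]
    exact (LinearMap.range_eq_map _).symm.trans (LinearEquiv.range g.1)
  nondegOn i hi he := by
    rw [Pi.smul_apply, smul_eq_map]
    rintro _ ⟨x, hx, rfl⟩ h
    have : x = 0 := hD.nondegOn i hi he x hx fun y hy => by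
      have := h _ ⟨y, hy, rfl⟩
      exact (g.2 x y).symm.trans this
    rw [this, map_zero]

theorem isChamberOrbit (hs : s.IsAlt) (hC : IsSymplecticFlag s C) :
    IsChamberOrbit (symplecticGroupOf s) C {D | IsSymplecticFlag s D} where
  base_mem := hC
  smul_mem g _ hD := IsSymplecticFlag.smul hD g
  exists_smul_eq _ hD := hC.exists_smul_eq hs hD

/-- One step of the completion of a partial flag. -/
theorem exists_succ (hs : s.IsAlt) (hC : IsSymplecticFlag s C) {m j : ℕ} (hm : m ≤ finrank F V)
    (hjm : j < m) {E : ℕ → Submodule F V} (hmono : ∀ i < j, E i ≤ E (i + 1))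
    (hfr : ∀ i ≤ j, finrank F (E i) = i) (hnd : ∀ i ≤ j, Even i → NondegOn s (E i))
    (hle : E j ≤ C m) (hrad : MeetsRadTrivially s (E j) (C m)) :
    ∃ U, E j ≤ U ∧ U ≤ C m ∧ finrank F U = j + 1 ∧ (Even (j + 1) → NondegOn s U) ∧
      (j + 1 = m ∨ MeetsRadTrivially s U (C m)) := by
  rcases Nat.even_or_odd' j with ⟨k, rfl | rfl⟩
  · rcases Nat.lt_or_ge (2 * k + 1) m with h | h
    · have hU := hnd _ le_rfl (even_two_mul k)
      have hr := hC.finrank_radical_le_one hs hm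
      -- For even `j` any vector outside `E j + Rad (C m)` will do; this sum has dimension at most
      -- `j + 1 < m`.
      have hnle : ¬ C m ≤ E (2 * k) ⊔ subspaceRadical s (C m) := by
        intro hcon
        have h1 := Submodule.finrank_mono hcon
        have h2 := Submodule.finrank_add_le_finrank_add_finrank (E (2 * k)) (subspaceRadical s (C m))
        rw [hC.finrank_eq m hm] at h1
        rw [hfr _ le_rfl] at h2
        omega
      obtain ⟨x, hx, hx'⟩ := SetLike.not_le_iff_exists.1 hnle
      have hxE : x ∉ E (2 * k) := fun h => hx' ((le_sup_left : _ ≤ E (2 * k) ⊔ _) h)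
      refine ⟨E (2 * k) ⊔ Submodule.span F {x}, le_sup_left, sup_le hle ?_, ?_, ?_, Or.inr ?_⟩
      · rwa [Submodule.span_singleton_le_iff_mem]
      · rw [Submodule.finrank_sup_span_singleton hxE, hfr _ le_rfl]
      · intro h
        simp at h
      · intro y hy hyC
        obtain ⟨u, hu, z, hz, rfl⟩ := Submodule.mem_sup.1 hy
        obtain ⟨α, rfl⟩ := Submodule.mem_span_singleton.1 hz
        by_cases hα : α = 0
        · subst hα
          rw [zero_smul, add_zero] at hyC ⊢
          exact hrad u hu hyC
        · exfalso
          apply hx'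
          have hr : u + α • x ∈ subspaceRadical s (C m) := (mem_subspaceRadical hs).2
            ⟨(C m).add_mem (hle hu) ((C m).smul_mem _ hx), hyC⟩
          have : x = -(α⁻¹ • u) + α⁻¹ • (u + α • x) := by
            rw [smul_add, smul_smul, inv_mul_cancel₀ hα, one_smul, neg_add_cancel_left]
          rw [this]
          exact Submodule.add_mem_sup ((E (2 * k)).neg_mem ((E (2 * k)).smul_mem _ hu))
            (Submodule.smul_mem _ _ hr)
    · obtain rfl : m = 2 * k + 1 := by omega
      refine ⟨C (2 * k + 1), hle, le_rfl, hC.finrank_eq _ hm, ?_, Or.inl rfl⟩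
      intro h
      simp at h
  · have hU := hnd (2 * k) (by omega) (even_two_mul k)
    have hUE := hmono (2 * k) (by omega)
    have hnle : ¬ E (2 * k + 1) ≤ E (2 * k) := fun hcon => by
      have h1 := Submodule.finrank_mono hcon
      rw [hfr _ le_rfl, hfr _ (by omega)] at h1
      omega
    obtain ⟨x, hx, hx'⟩ := SetLike.not_le_iff_exists.1 hnle
    obtain ⟨u, hu, hperp⟩ := hU.exists_proj hs x
    -- For odd `j`, `E j` is `E (j - 1)` plus a vector `v` orthogonal to it. Since `v` is not in
    -- `Rad (C m)`, it has a partner in `C m`, and the hyperbolic pair extends `E (j - 1)` to a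
    -- nondegenerate subspace.
    set v := x - u with hv
    have hvE : v ∈ E (2 * k + 1) := Submodule.sub_mem _ hx (hUE hu)
    have hv0 : v ≠ 0 := fun h => hx' (by rwa [sub_eq_zero.1 h])
    have : ∃ y ∈ C m, s v y ≠ 0 := by
      by_contra! hcon
      exact hv0 (hrad v hvE hcon)
    obtain ⟨y, hy, hvy⟩ := this
    obtain ⟨u', hu', hperp'⟩ := hU.exists_proj hs y
    have hvw : s v (y - u') ≠ 0 := by
      rwa [map_sub, (apply_eq_zero_comm hs).1 (hperp u' hu'), sub_zero]
    have hnd' := hU.sup_pair hs hperp hperp' hvw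
    have hfin := finrank_sup_span_pair hs hU hperp hvw
    have hle' : E (2 * k) ⊔ Submodule.span F {v, y - u'} ≤ C m := by
      refine sup_le (hUE.trans hle) (Submodule.span_le.2 ?_)
      rintro _ (rfl | rfl)
      · exact hle hvE
      · exact Submodule.sub_mem _ hy (hle (hUE hu'))
    refine ⟨E (2 * k) ⊔ Submodule.span F {v, y - u'}, ?_, hle', ?_, fun _ => hnd',
      Or.inr (hnd'.meetsRadTrivially hle')⟩
    · have : E (2 * k) ⊔ Submodule.span F {v} = E (2 * k + 1) := by
        refine Submodule.eq_of_le_of_finrank_eq (sup_le hUE ?_) ?_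
        · rwa [Submodule.span_singleton_le_iff_mem]
        · rw [Submodule.finrank_sup_span_singleton hfin.1, hfr _ le_rfl, hfr _ (by omega)]
      rw [← this]
      exact sup_le_sup_left (Submodule.span_mono (by simp)) _
    · rw [hfin.2.2, hfr _ (by omega)]

/-- A partial flag in `C m` can be completed to a flag that agrees with `C` from `m` on. -/
theorem exists_extension (hs : s.IsAlt) (hC : IsSymplecticFlag s C) {m : ℕ}
    (hm : m ≤ finrank F V) : ∀ {j : ℕ}, j ≤ m → ∀ {E : ℕ → Submodule F V},
    (∀ i < j, E i ≤ E (i + 1)) → (∀ i ≤ j, finrank F (E i) = i) →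
    (∀ i ≤ j, Even i → NondegOn s (E i)) → E j ≤ C m →
    (j = m ∨ MeetsRadTrivially s (E j) (C m)) →
    ∃ D, IsSymplecticFlag s D ∧ (∀ i ≤ j, D i = E i) ∧ ∀ i, m ≤ i → D i = C i := by
  intro j hj
  induction hj using Nat.decreasingInduction with
  | self =>
    intro E hmono hfr hnd hle _
    have hEC : E m = C m := Submodule.eq_of_le_of_finrank_eq hle (by
      rw [hfr m le_rfl, hC.finrank_eq m hm])
    have hD2 : ∀ i, m ≤ i → (if i ≤ m then E i else C i) = C i := by
      intro i hi
      split_ifs with h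
      · rw [le_antisymm h hi, hEC]
      · rfl
    refine ⟨fun i => if i ≤ m then E i else C i, ⟨?_, ?_, ?_, ?_⟩, ?_, hD2⟩
    · refine monotone_nat_of_le_succ fun i => ?_
      rcases Nat.lt_or_ge i m with h | h
      · rw [if_pos h.le, if_pos (Nat.succ_le_of_lt h)]
        exact hmono i h
      · rw [hD2 i h, hD2 (i + 1) (by omega)]
        exact hC.mono (Nat.le_succ i)
    · intro i hi
      by_cases h : i ≤ m
      · exact (congrArg (fun U : Submodule F V => finrank F U) (if_pos h)).trans (hfr i h)
      · exact (congrArg (fun U : Submodule F V => finrank F U) (if_neg h)).trans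
          (hC.finrank_eq i hi)
    · intro i hi
      rw [hD2 i (hm.trans hi), hC.eq_top i hi]
    · intro i hi he
      split_ifs with h
      · exact hnd i h he
      · exact hC.nondegOn i hi he
    · intro i hi
      exact if_pos hi
  | of_succ j hj ih =>
    intro E hmono hfr hnd hle hrad
    obtain ⟨U, h1, h2, h3, h4, h5⟩ := hC.exists_succ hs hm hj hmono hfr hnd hle
      (hrad.resolve_left (by omega))
    have hne : ∀ i ≤ j, Function.update E (j + 1) U i = E i := fun i hi =>
      Function.update_of_ne (by omega) _ _
    have heq : Function.update E (j + 1) U (j + 1) = U := Function.update_self _ _ _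
    have g1 : ∀ i < j + 1, Function.update E (j + 1) U i ≤ Function.update E (j + 1) U (i + 1) := by
      intro i hi
      rcases Nat.lt_or_ge i j with h | h
      · rw [hne i h.le, hne (i + 1) h]
        exact hmono i h
      · obtain rfl : i = j := by omega
        rw [heq, hne i le_rfl]
        exact h1
    have g2 : ∀ i ≤ j + 1, finrank F (Function.update E (j + 1) U i) = i := by
      intro i hi
      rcases Nat.lt_or_ge j i with h | h
      · obtain rfl : i = j + 1 := by omega
        rw [heq, h3]
      · rw [hne i h, hfr i h]
    have g3 : ∀ i ≤ j + 1, Even i → NondegOn s (Function.update E (j + 1) U i) := by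
      intro i hi he
      rcases Nat.lt_or_ge j i with h | h
      · obtain rfl : i = j + 1 := by omega
        rw [heq]
        exact h4 he
      · rw [hne i h]
        exact hnd i h he
    obtain ⟨D, hD, hD1, hD2⟩ := ih g1 g2 g3 (by rwa [heq]) (by rwa [heq])
    exact ⟨D, hD, fun i hi => (hD1 i (by omega)).trans (hne i hi), hD2⟩

end IsSymplecticFlag

end SymplecticFlag

/-! ### The graph of points of a residue -/

section PointGraph

variable {F : Type u} {V : Type v} [Field F] [AddCommGroup V] [Module F V]
  [FiniteDimensional F V] {s : LinearMap.BilinForm F V} {C D : ℕ → Submodule F V}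

namespace IsSymplecticFlag

omit [FiniteDimensional F V] in
theorem update (hD : IsSymplecticFlag s D) {a : ℕ} (ha : a < finrank F V) (ha1 : 1 ≤ a)
    {y : Submodule F V} (h1 : D (a - 1) ≤ y) (h2 : y ≤ D (a + 1)) (h3 : finrank F y = a)
    (h4 : Even a → NondegOn s y) : IsSymplecticFlag s (Function.update D a y) where
  mono := by
    refine monotone_nat_of_le_succ fun i => ?_
    rcases eq_or_ne i a with rfl | hia
    · rw [Function.update_self, Function.update_of_ne (by omega)]
      exact h2
    rw [Function.update_of_ne hia]
    rcases eq_or_ne (i + 1) a with rfl | hia'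
    · rw [Function.update_self]
      exact h1
    · rw [Function.update_of_ne hia']
      exact hD.mono (Nat.le_succ i)
  finrank_eq i hi := by
    rcases eq_or_ne i a with rfl | hia
    · rw [Function.update_self, h3]
    · rw [Function.update_of_ne hia, hD.finrank_eq i hi]
  eq_top i hi := by
    rw [Function.update_of_ne (by omega), hD.eq_top i hi]
  nondegOn i hi he := by
    rcases eq_or_ne i a with rfl | hia
    · rw [Function.update_self]
      exact h4 he
    · rw [Function.update_of_ne hia]
      exact hD.nondegOn i hi he

/-- The sum strictly contains `C a` and lies in a space of dimension `a + 1`, so a line is the sum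
of any two of its points. -/
theorem sup_eq (hC : IsSymplecticFlag s C) (hD : IsSymplecticFlag s D) {a : ℕ}
    (ha : a < finrank F V) (h : C (a + 1) = D (a + 1)) (hne : C a ≠ D a) :
    C a ⊔ D a = C (a + 1) := by
  have hle : C a ⊔ D a ≤ C (a + 1) :=
    sup_le (hC.mono (Nat.le_succ a)) (h ▸ hD.mono (Nat.le_succ a))
  have hlt : C a < C a ⊔ D a := by
    rw [left_lt_sup]
    intro hcon
    exact hne (Submodule.eq_of_le_of_finrank_eq hcon (by
      rw [hC.finrank_eq a ha.le, hD.finrank_eq a ha.le])).symm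
  have h1 := Submodule.finrank_lt_finrank_of_lt hlt
  refine Submodule.eq_of_le_of_finrank_le hle ?_
  rw [hC.finrank_eq a ha.le] at h1
  rw [hC.finrank_eq _ ha]
  omega

theorem line_unique {D₁ E₁ D₂ E₂ : ℕ → Submodule F V} (hD₁ : IsSymplecticFlag s D₁)
    (hE₁ : IsSymplecticFlag s E₁) (hD₂ : IsSymplecticFlag s D₂) (hE₂ : IsSymplecticFlag s E₂)
    {a : ℕ} (ha : a < finrank F V) (h1 : D₁ (a + 1) = E₁ (a + 1)) (h2 : D₂ (a + 1) = E₂ (a + 1))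
    (h3 : D₁ a = D₂ a) (h4 : E₁ a = E₂ a) (h5 : D₁ a ≠ E₁ a) : D₁ (a + 1) = D₂ (a + 1) := by
  rw [← hD₁.sup_eq hE₁ ha h1 h5, h3, h4]
  rw [h3, h4] at h5
  exact hD₂.sup_eq hE₂ ha h2 h5

/-- Two subspaces between `C (a - 1)` and `l` are adjacent if `l` is part of a partial flag that
can be completed below `C (b + 1)`. -/
theorem exists_adjacent (hs : s.IsAlt) (hC : IsSymplecticFlag s C) {a b j : ℕ} (ha : 1 ≤ a)
    (hb : b < finrank F V) (hj : a + 1 ≤ j) (hjb : j ≤ b + 1) {E : ℕ → Submodule F V}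
    (hEC : ∀ i < a, E i = C i) (hmono : ∀ i < j, a ≤ i + 1 → E i ≤ E (i + 1))
    (hfr : ∀ i ≤ j, a ≤ i → finrank F (E i) = i)
    (hnd : ∀ i ≤ j, a ≤ i → Even i → NondegOn s (E i)) (hle : E j ≤ C (b + 1))
    (hrad : j = b + 1 ∨ MeetsRadTrivially s (E j) (C (b + 1)))
    {y : Submodule F V} (h1 : C (a - 1) ≤ y) (h2 : y ≤ E (a + 1)) (h3 : finrank F y = a)
    (h4 : Even a → NondegOn s y) :
    ∃ D, IsSymplecticFlag s D ∧ ∃ D', IsSymplecticFlag s D' ∧ AgreeOff (Set.Icc a b) D C ∧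
      AgreeOff {a} D D' ∧ D a = E a ∧ D' a = y ∧ ∀ i ≤ j, D i = E i := by
  have g1 : ∀ i < j, E i ≤ E (i + 1) := by
    intro i hi
    rcases Nat.lt_or_ge (i + 1) a with h | h
    · rw [hEC i (by omega), hEC _ h]
      exact hC.mono (Nat.le_succ i)
    · exact hmono i hi h
  have g2 : ∀ i ≤ j, finrank F (E i) = i := by
    intro i hi
    rcases Nat.lt_or_ge i a with h | h
    · rw [hEC i h, hC.finrank_eq i (by omega)]
    · exact hfr i hi h
  have g3 : ∀ i ≤ j, Even i → NondegOn s (E i) := by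
    intro i hi he
    rcases Nat.lt_or_ge i a with h | h
    · rw [hEC i h]
      exact hC.nondegOn i (by omega) he
    · exact hnd i hi h he
  obtain ⟨D, hD, hD1, hD2⟩ := hC.exists_extension hs (m := b + 1) hb hjb g1 g2 g3 hle hrad
  refine ⟨D, hD, Function.update D a y, hD.update (by omega) ha ?_ ?_ h3 h4, ?_, ?_,
    hD1 a (by omega), Function.update_self .., hD1⟩
  · rwa [hD1 _ (by omega), hEC _ (by omega)]
  · rwa [hD1 _ hj]
  · intro i hi
    rcases Nat.lt_or_ge i a with h | h
    · rw [hD1 i (by omega), hEC i h]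
    · exact hD2 i (by
        by_contra hcon
        exact hi ⟨h, by omega⟩)
  · intro i hi
    exact (Function.update_of_ne hi _ _).symm

theorem pointAdj_of_line (hs : s.IsAlt) (hC : IsSymplecticFlag s C) {a b : ℕ} (ha : 1 ≤ a)
    (hab : a ≤ b) (hb : b < finrank F V) {x y l : Submodule F V} (hne : x ≠ y)
    (hx : C (a - 1) ≤ x) (hy : C (a - 1) ≤ y) (hxl : x ≤ l) (hyl : y ≤ l) (hl : l ≤ C (b + 1))
    (hxf : finrank F x = a) (hyf : finrank F y = a) (hlf : finrank F l = a + 1)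
    (hxn : Even a → NondegOn s x) (hyn : Even a → NondegOn s y)
    (hln : Even (a + 1) → NondegOn s l) (hlr : MeetsRadTrivially s l (C (b + 1))) :
    PointAdj C {D | IsSymplecticFlag s D} (Set.Icc a b) a x y := by
  -- The partial flag `C 0 ≤ … ≤ C (a - 1) ≤ x ≤ l` is completed below `C (b + 1)`; the second
  -- chamber replaces `x` by `y`.
  set E : ℕ → Submodule F V := fun i => if i < a then C i else if i = a then x else l with hE
  have e1 : ∀ i < a, E i = C i := fun i hi => if_pos hi
  have e2 : E a = x := by simp [hE]
  have e3 : E (a + 1) = l := by simp [hE]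
  obtain ⟨D, hD, D', hD', h1, h2, h3, h4, -⟩ := hC.exists_adjacent hs ha hb (j := a + 1) le_rfl
    (by omega) e1 (by
      intro i hi hai
      obtain h | rfl : i + 1 = a ∨ i = a := by omega
      · rw [e1 i (by omega), h, e2, show i = a - 1 by omega]
        exact hx
      · rwa [e2, e3]) (by
      intro i hi hai
      obtain rfl | rfl : i = a ∨ i = a + 1 := by omega
      · rwa [e2]
      · rwa [e3]) (by
      intro i hi hai
      obtain rfl | rfl : i = a ∨ i = a + 1 := by omega
      · rwa [e2]
      · rwa [e3]) (by rwa [e3]) (by rw [e3]; exact Or.inr hlr) hy (by rwa [e3]) hyf hyn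
  exact ⟨hne, D, hD, D', hD', h1, h2, h3.trans e2, h4⟩

theorem pointAdjIn_of_plane (hs : s.IsAlt) (hC : IsSymplecticFlag s C) {a b : ℕ} (ha : 1 ≤ a)
    (hab : a + 1 ≤ b) (hb : b < finrank F V) {x y l t : Submodule F V} (hne : x ≠ y)
    (hx : C (a - 1) ≤ x) (hy : C (a - 1) ≤ y) (hxl : x ≤ l) (hyl : y ≤ l) (hlt : l ≤ t)
    (ht : t ≤ C (b + 1))
    (hxf : finrank F x = a) (hyf : finrank F y = a) (hlf : finrank F l = a + 1)
    (htf : finrank F t = a + 2)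
    (hxn : Even a → NondegOn s x) (hyn : Even a → NondegOn s y)
    (hln : Even (a + 1) → NondegOn s l) (htn : Even a → NondegOn s t)
    (htr : MeetsRadTrivially s t (C (b + 1))) :
    PointAdjIn C {D | IsSymplecticFlag s D} (Set.Icc a b) a t x y := by
  set E : ℕ → Submodule F V :=
    fun i => if i < a then C i else if i = a then x else if i = a + 1 then l else t with hE
  have e1 : ∀ i < a, E i = C i := fun i hi => if_pos hi
  have e2 : E a = x := by simp [hE]
  have e3 : E (a + 1) = l := by simp [hE]
  have e4 : E (a + 2) = t := by simp [hE]
  obtain ⟨D, hD, D', hD', h1, h2, h3, h4, h5⟩ := hC.exists_adjacent hs ha hb (j := a + 2)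
    (by omega) (by omega) e1 (by
      intro i hi hai
      obtain h | rfl | rfl : i + 1 = a ∨ i = a ∨ i = a + 1 := by omega
      · rw [e1 i (by omega), h, e2, show i = a - 1 by omega]
        exact hx
      · rwa [e2, e3]
      · rwa [e3, e4]) (by
      intro i hi hai
      obtain rfl | rfl | rfl : i = a ∨ i = a + 1 ∨ i = a + 2 := by omega
      · rwa [e2]
      · rwa [e3]
      · rwa [e4]) (by
      intro i hi hai
      obtain rfl | rfl | rfl : i = a ∨ i = a + 1 ∨ i = a + 2 := by omega
      · rwa [e2]
      · rwa [e3]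
      · rw [e4, Nat.even_add]
        simpa using htn) (by rwa [e4]) (by rw [e4]; exact Or.inr htr) hy (by rwa [e3]) hyf hyn
  exact ⟨hne, D, hD, D', hD', h1, h2, h3.trans e2, h4, (h5 _ le_rfl).trans e4⟩

end IsSymplecticFlag

theorem PointAdj.exists_mem {X : Type*} {C : ℕ → X} {S : Set (ℕ → X)} {K : Set ℕ} {a : ℕ}
    (ha : a ∈ K) {x y : X} (h : PointAdj C S K a x y) :
    (∃ D ∈ S, AgreeOff K D C ∧ D a = x) ∧ ∃ D ∈ S, AgreeOff K D C ∧ D a = y := by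
  obtain ⟨-, D, hD, D', hD', h1, h2, h3, h4⟩ := h
  exact ⟨⟨D, hD, h1, h3⟩, ⟨D', hD', (h2.symm.mono (Set.singleton_subset_iff.2 ha)).trans h1, h4⟩⟩

end PointGraph

/-! ### Points of odd dimension: nonorthogonality of vectors -/

section OddPoints

variable {F : Type u} {V : Type v} [Field F] [AddCommGroup V] [Module F V]
  [FiniteDimensional F V] {s : LinearMap.BilinForm F V} {C D : ℕ → Submodule F V}
  {k b : ℕ}

namespace IsSymplecticFlag

/-- Projection off the nondegenerate `C (2 * k)` reduces a point to one vector `v`. The vector `y`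
records that `v` is not radical, in the form required by `exists_mem_ne_zero_three`. -/
theorem odd_exists_vector (hs : s.IsAlt) (hC : IsSymplecticFlag s C) (hkb : 2 * k + 2 ≤ b)
    (hb : b < finrank F V) (hD : IsSymplecticFlag s D)
    (hDC : AgreeOff (Set.Icc (2 * k + 1) b) D C) :
    ∃ v ∈ C (b + 1), (∀ u ∈ C (2 * k), s u v = 0) ∧
      (∃ y ∈ C (b + 1) ⊓ s.orthogonal (C (2 * k)), s v y ≠ 0) ∧
      D (2 * k + 1) = C (2 * k) ⊔ Submodule.span F {v} := by
  have e0 : D (2 * k) = C (2 * k) := hDC _ (by simp)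
  have e1 : D (b + 1) = C (b + 1) := hDC _ (by simp)
  obtain ⟨v, hv, hperp, hv0⟩ := hD.exists_orthogonal_of_lt hs (i := 2 * k) (by omega)
    (even_two_mul k)
  have hle : D (2 * k + 2) ≤ C (b + 1) := e1 ▸ hD.mono (by omega)
  have hvy : ∃ y ∈ D (2 * k + 2), s v y ≠ 0 := by
    by_contra! hcon
    exact hv0 (hD.nondegOn (2 * k + 2) (by omega) (by simp [Nat.even_add]) v
      (hD.mono (Nat.le_succ _) hv) hcon)
  obtain ⟨y, hy, hvy⟩ := hvy
  obtain ⟨u, hu, hyu⟩ := (hD.nondegOn (2 * k) (by omega) (even_two_mul k)).exists_proj hs y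
  rw [e0] at hperp
  refine ⟨v, hle (hD.mono (Nat.le_succ _) hv), hperp,
    ⟨y - u, ⟨hle ((D _).sub_mem hy (hD.mono (by omega) hu)), e0 ▸ hyu⟩, ?_⟩, ?_⟩
  · rwa [map_sub, (apply_eq_zero_comm hs).1 (hperp u (e0 ▸ hu)), sub_zero]
  · have hvD : v ∉ C (2 * k) := fun h => hv0 (hC.nondegOn _ (by omega) (even_two_mul k) v h
      fun y hy => (apply_eq_zero_comm hs).1 (hperp y hy))
    symm
    refine Submodule.eq_of_le_of_finrank_eq (sup_le ?_ ?_) ?_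
    · rw [← e0]
      exact hD.mono (Nat.le_succ _)
    · rwa [Submodule.span_singleton_le_iff_mem]
    · rw [Submodule.finrank_sup_span_singleton hvD, hC.finrank_eq _ (by omega),
        hD.finrank_eq _ (by omega)]

theorem odd_line (hs : s.IsAlt) (hC : IsSymplecticFlag s C) (hk : 2 * k ≤ finrank F V)
    {v w : V} (hv : ∀ u ∈ C (2 * k), s u v = 0) (hw : ∀ u ∈ C (2 * k), s u w = 0)
    (hvw : s v w ≠ 0) :
    finrank F (C (2 * k) ⊔ Submodule.span F {v} : Submodule F V) = 2 * k + 1 ∧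
    finrank F (C (2 * k) ⊔ Submodule.span F {v, w} : Submodule F V) = 2 * k + 2 ∧
    NondegOn s (C (2 * k) ⊔ Submodule.span F {v, w}) ∧
    C (2 * k) ⊔ Submodule.span F {v} ≠ C (2 * k) ⊔ Submodule.span F {w} := by
  have hU := hC.nondegOn (2 * k) hk (even_two_mul k)
  obtain ⟨h1, h2, h3⟩ := finrank_sup_span_pair hs hU hv hvw
  refine ⟨?_, ?_, hU.sup_pair hs hv hw hvw, fun h => h2 ?_⟩
  · rw [Submodule.finrank_sup_span_singleton h1, hC.finrank_eq _ hk]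
  · rw [h3, hC.finrank_eq _ hk]
  · rw [h]
    exact (le_sup_right : _ ≤ C (2 * k) ⊔ _) (Submodule.mem_span_singleton_self w)

/-- The joining line has even dimension `2 * k + 2` and must be nondegenerate; if `s v w = 0`, then
`v` would lie in its radical. -/
theorem odd_pointAdj_iff (hs : s.IsAlt) (hC : IsSymplecticFlag s C) (hkb : 2 * k + 2 ≤ b)
    (hb : b < finrank F V) {v w : V} (hvM : v ∈ C (b + 1)) (hwM : w ∈ C (b + 1))
    (hv : ∀ u ∈ C (2 * k), s u v = 0) (hw : ∀ u ∈ C (2 * k), s u w = 0) :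
    PointAdj C {D | IsSymplecticFlag s D} (Set.Icc (2 * k + 1) b) (2 * k + 1)
      (C (2 * k) ⊔ Submodule.span F {v}) (C (2 * k) ⊔ Submodule.span F {w}) ↔ s v w ≠ 0 := by
  constructor
  · rintro ⟨hne, D, hD, D', hD', hDC, hDD', hDa, hDa'⟩ hvw
    have hsup := IsSymplecticFlag.sup_eq (C := D) (D := D') hD hD' (a := 2 * k + 1) (by omega)
      (hDD' _ (by simp)) (by rwa [hDa, hDa'])
    rw [hDa, hDa'] at hsup
    have hvD : v ∈ D (2 * k + 2) := by
      rw [← hsup]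
      exact (le_sup_left : _ ≤ _ ⊔ (C (2 * k) ⊔ Submodule.span F {w}))
        ((le_sup_right : _ ≤ C (2 * k) ⊔ _) (Submodule.mem_span_singleton_self v))
    have hv0 : v = 0 := by
      refine IsSymplecticFlag.nondegOn hD (2 * k + 2) (by omega) (by simp [Nat.even_add]) v hvD ?_
      change ∀ y ∈ D (2 * k + 1 + 1), s v y = 0
      rw [← hsup]
      intro y hy
      obtain ⟨y₁, hy₁, y₂, hy₂, rfl⟩ := Submodule.mem_sup.1 hy
      obtain ⟨u₁, hu₁, z₁, hz₁, rfl⟩ := Submodule.mem_sup.1 hy₁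
      obtain ⟨u₂, hu₂, z₂, hz₂, rfl⟩ := Submodule.mem_sup.1 hy₂
      obtain ⟨α, rfl⟩ := Submodule.mem_span_singleton.1 hz₁
      obtain ⟨β, rfl⟩ := Submodule.mem_span_singleton.1 hz₂
      simp [hvw, hs v, (apply_eq_zero_comm hs).1 (hv u₁ hu₁), (apply_eq_zero_comm hs).1 (hv u₂ hu₂)]
    have h1 := IsSymplecticFlag.finrank_eq hD (2 * k + 1) (by omega)
    rw [hDa, hv0, Submodule.span_zero_singleton, sup_bot_eq, hC.finrank_eq _ (by omega)] at h1
    omega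
  · intro hvw
    have h1 := hC.odd_line hs (k := k) (by omega) hv hw hvw
    have h2 := hC.odd_line hs (k := k) (by omega) hw hv
      (fun h => hvw ((apply_eq_zero_comm hs).1 h))
    have hl : C (2 * k) ⊔ Submodule.span F {v, w} ≤ C (b + 1) := by
      refine sup_le (hC.mono (by omega)) (Submodule.span_le.2 ?_)
      rintro _ (rfl | rfl) <;> assumption
    exact hC.pointAdj_of_line hs (by omega) (by omega) hb h1.2.2.2 le_sup_left le_sup_left
      (sup_le_sup_left (Submodule.span_mono (by simp)) _)
      (sup_le_sup_left (Submodule.span_mono (by simp)) _) hl h1.1 h2.1 h1.2.1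
      (fun h => by simp at h) (fun h => by simp at h) (fun _ => h1.2.2.1)
      (h1.2.2.1.meetsRadTrivially hl)

/-- The plane has odd dimension `2 * k + 3`, so it need not be nondegenerate: it only has to meet
`Rad (C (b + 1))` trivially, which `hind` ensures. -/
theorem odd_isPlanar (hs : s.IsAlt) (hC : IsSymplecticFlag s C) (hkb : 2 * k + 2 ≤ b)
    (hb : b < finrank F V) {v w z : V} (hvM : v ∈ C (b + 1)) (hwM : w ∈ C (b + 1))
    (hzM : z ∈ C (b + 1)) (hv : ∀ u ∈ C (2 * k), s u v = 0) (hw : ∀ u ∈ C (2 * k), s u w = 0)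
    (hz : ∀ u ∈ C (2 * k), s u z = 0) (hvw : s v w ≠ 0) (hvz : s v z ≠ 0) (hwz : s w z ≠ 0)
    (hind : z ∉ Submodule.span F {v, w} ⊔ subspaceRadical s (C (b + 1))) :
    IsPlanar C {D | IsSymplecticFlag s D} (Set.Icc (2 * k + 1) b) (2 * k + 1)
      (C (2 * k) ⊔ Submodule.span F {v}) (C (2 * k) ⊔ Submodule.span F {w})
      (C (2 * k) ⊔ Submodule.span F {z}) := by
  have hU := hC.nondegOn (2 * k) (by omega) (even_two_mul k)
  have hUM : C (2 * k) ≤ C (b + 1) := hC.mono (by omega)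
  set t := C (2 * k) ⊔ Submodule.span F {v, w} ⊔ Submodule.span F {z} with ht
  have hUt : C (2 * k) ≤ t := le_sup_left.trans le_sup_left
  have hzt : z ∈ t := (le_sup_right : _ ≤ _ ⊔ Submodule.span F {z})
    (Submodule.mem_span_singleton_self z)
  have hPt : Submodule.span F {v, w} ≤ t := le_sup_right.trans le_sup_left
  have hvt : v ∈ t := hPt (Submodule.subset_span (by simp))
  have hwt : w ∈ t := hPt (Submodule.subset_span (by simp))
  have hzn : z ∉ C (2 * k) ⊔ Submodule.span F {v, w} := by
    intro h
    obtain ⟨u, hu, p, hp, e⟩ := Submodule.mem_sup.1 h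
    have hu0 : u = 0 := by
      refine hU u hu fun y hy => ?_
      obtain ⟨α, β, rfl⟩ := Submodule.mem_span_pair.1 hp
      have h1 := hz y hy
      rw [← e] at h1
      simp only [map_add, map_smul, hv y hy, hw y hy, smul_zero, add_zero] at h1
      exact (apply_eq_zero_comm hs).1 h1
    rw [hu0, zero_add] at e
    exact hind (e ▸ (le_sup_left : _ ≤ _ ⊔ subspaceRadical s (C (b + 1))) hp)
  have h1 := hC.odd_line hs (k := k) (by omega) hv hw hvw
  have h2 := hC.odd_line hs (k := k) (by omega) hv hz hvz
  have h3 := hC.odd_line hs (k := k) (by omega) hw hz hwz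
  have h4 := hC.odd_line hs (k := k) (by omega) hz hv
    (fun h => hvz ((apply_eq_zero_comm hs).1 h))
  have htM : t ≤ C (b + 1) := by
    refine sup_le (sup_le hUM (Submodule.span_le.2 ?_)) ?_
    · rintro _ (rfl | rfl) <;> assumption
    · rwa [Submodule.span_singleton_le_iff_mem]
  have htf : finrank F t = 2 * k + 1 + 2 := by
    rw [ht, Submodule.finrank_sup_span_singleton hzn, h1.2.1]
  have htr : MeetsRadTrivially s t (C (b + 1)) := by
    intro x hx hxM
    have hxr : x ∈ subspaceRadical s (C (b + 1)) := (mem_subspaceRadical hs).2 ⟨htM hx, hxM⟩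
    obtain ⟨q, hq, z', hz', rfl⟩ := Submodule.mem_sup.1 hx
    obtain ⟨u, hu, p, hp, rfl⟩ := Submodule.mem_sup.1 hq
    obtain ⟨γ, rfl⟩ := Submodule.mem_span_singleton.1 hz'
    -- The vector `x` and its components `p`, `γ • z` are orthogonal to `C (2 * k)`, so the
    -- component `u` is too.
    have hu0 : u = 0 := by
      refine hU u hu fun y hy => ?_
      obtain ⟨α, β, rfl⟩ := Submodule.mem_span_pair.1 hp
      have h1 := (apply_eq_zero_comm hs).1 (hxM y (hUM hy))
      simp only [map_add, map_smul, hv y hy, hw y hy, hz y hy, smul_zero, add_zero] at h1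
      exact (apply_eq_zero_comm hs).1 h1
    subst hu0
    rw [zero_add] at hxM hxr ⊢
    by_cases hγ : γ = 0
    · subst hγ
      rw [zero_smul, add_zero] at hxM ⊢
      exact h1.2.2.1 p ((le_sup_right : _ ≤ C (2 * k) ⊔ _) hp) fun y hy =>
        hxM y (htM ((le_sup_left : _ ≤ t) hy))
    · exfalso
      apply hind
      have : z = -(γ⁻¹ • p) + γ⁻¹ • (p + γ • z) := by
        rw [smul_add, smul_smul, inv_mul_cancel₀ hγ, one_smul, neg_add_cancel_left]
      rw [this]
      exact Submodule.add_mem_sup (Submodule.neg_mem _ (Submodule.smul_mem _ _ hp))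
        (Submodule.smul_mem _ _ hxr)
  have key : ∀ {x y : V}, x ∈ t → y ∈ t →
      finrank F (C (2 * k) ⊔ Submodule.span F {x} : Submodule F V) = 2 * k + 1 →
      finrank F (C (2 * k) ⊔ Submodule.span F {y} : Submodule F V) = 2 * k + 1 →
      finrank F (C (2 * k) ⊔ Submodule.span F {x, y} : Submodule F V) = 2 * k + 2 →
      NondegOn s (C (2 * k) ⊔ Submodule.span F {x, y}) →
      C (2 * k) ⊔ Submodule.span F {x} ≠ C (2 * k) ⊔ Submodule.span F {y} →
      PointAdjIn C {D | IsSymplecticFlag s D} (Set.Icc (2 * k + 1) b) (2 * k + 1) t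
        (C (2 * k) ⊔ Submodule.span F {x}) (C (2 * k) ⊔ Submodule.span F {y}) := by
    intro x y hx hy f1 f2 f3 f4 f5
    refine hC.pointAdjIn_of_plane hs (by omega) (by omega) hb f5 le_sup_left le_sup_left
      (sup_le_sup_left (Submodule.span_mono (by simp)) _)
      (sup_le_sup_left (Submodule.span_mono (by simp)) _) (sup_le hUt (Submodule.span_le.2 ?_)) htM
      f1 f2 f3 htf (fun h => by simp at h) (fun h => by simp at h) (fun _ => f4)
      (fun h => by simp at h) htr
    rintro _ (rfl | rfl) <;> assumption
  exact ⟨t, key hvt hwt h1.1 h3.1 h1.2.1 h1.2.2.1 h1.2.2.2,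
    key hvt hzt h2.1 h4.1 h2.2.1 h2.2.2.1 h2.2.2.2,
    key hwt hzt h3.1 h4.1 h3.2.1 h3.2.2.1 h3.2.2.2⟩

theorem odd_three (hs : s.IsAlt) (hF : ∃ t : F, t ≠ 0 ∧ t ≠ 1) (hC : IsSymplecticFlag s C)
    (hkb : 2 * k + 2 ≤ b) (hb : b < finrank F V) {D₁ D₂ D₃ : ℕ → Submodule F V}
    (hD₁ : IsSymplecticFlag s D₁) (hD₂ : IsSymplecticFlag s D₂) (hD₃ : IsSymplecticFlag s D₃)
    (h₁ : AgreeOff (Set.Icc (2 * k + 1) b) D₁ C) (h₂ : AgreeOff (Set.Icc (2 * k + 1) b) D₂ C)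
    (h₃ : AgreeOff (Set.Icc (2 * k + 1) b) D₃ C) :
    ∃ w, PointAdj C {D | IsSymplecticFlag s D} (Set.Icc (2 * k + 1) b) (2 * k + 1)
        (D₁ (2 * k + 1)) w ∧
      PointAdj C {D | IsSymplecticFlag s D} (Set.Icc (2 * k + 1) b) (2 * k + 1)
        (D₂ (2 * k + 1)) w ∧
      PointAdj C {D | IsSymplecticFlag s D} (Set.Icc (2 * k + 1) b) (2 * k + 1)
        (D₃ (2 * k + 1)) w := by
  obtain ⟨v₁, m₁, o₁, y₁, e₁⟩ := hC.odd_exists_vector hs hkb hb hD₁ h₁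
  obtain ⟨v₂, m₂, o₂, y₂, e₂⟩ := hC.odd_exists_vector hs hkb hb hD₂ h₂
  obtain ⟨v₃, m₃, o₃, y₃, e₃⟩ := hC.odd_exists_vector hs hkb hb hD₃ h₃
  obtain ⟨w, ⟨hwM, hw⟩, n₁, n₂, n₃⟩ := exists_mem_ne_zero_three hF y₁ y₂ y₃
  refine ⟨C (2 * k) ⊔ Submodule.span F {w}, ?_, ?_, ?_⟩
  · rwa [e₁, hC.odd_pointAdj_iff hs hkb hb m₁ hwM o₁ hw]
  · rwa [e₂, hC.odd_pointAdj_iff hs hkb hb m₂ hwM o₂ hw]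
  · rwa [e₃, hC.odd_pointAdj_iff hs hkb hb m₃ hwM o₃ hw]

/-- Some `x` is nonorthogonal to all three vectors. If it falls into the span to be avoided, adding
a vector outside it that is orthogonal to `v`, `w`, and hence to `z`, preserves the three products.
-/
theorem odd_triangle (hs : s.IsAlt) (hF : ∃ t : F, t ≠ 0 ∧ t ≠ 1) (hC : IsSymplecticFlag s C)
    (hkb : 2 * k + 3 ≤ b) (hb : b < finrank F V) {v w z : V} (hvM : v ∈ C (b + 1))
    (hwM : w ∈ C (b + 1)) (hzM : z ∈ C (b + 1)) (hv : ∀ u ∈ C (2 * k), s u v = 0)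
    (hw : ∀ u ∈ C (2 * k), s u w = 0) (hz : ∀ u ∈ C (2 * k), s u z = 0) (hvw : s v w ≠ 0)
    (hvz : s v z ≠ 0) (hwz : s w z ≠ 0)
    (hzP : z ∈ Submodule.span F {v, w} ⊔ subspaceRadical s (C (b + 1))) :
    ∃ x ∈ C (b + 1), (∀ u ∈ C (2 * k), s u x = 0) ∧ s v x ≠ 0 ∧ s w x ≠ 0 ∧ s z x ≠ 0 ∧
      x ∉ Submodule.span F {v, w} ⊔ subspaceRadical s (C (b + 1)) := by
  have hnz : ∀ {p q : V}, q ∈ C (b + 1) → (∀ u ∈ C (2 * k), s u q = 0) → s p q ≠ 0 →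
      ∃ y ∈ C (b + 1) ⊓ s.orthogonal (C (2 * k)), s p y ≠ 0 :=
    fun {p q} h1 h2 h3 => ⟨q, ⟨h1, h2⟩, h3⟩
  obtain ⟨x, ⟨hxM, hx⟩, n₁, n₂, n₃⟩ := exists_mem_ne_zero_three hF (hnz hwM hw hvw)
    (hnz hzM hz hwz) (hnz hvM hv fun h => hvz ((apply_eq_zero_comm hs).1 h))
  by_cases hxP : x ∈ Submodule.span F {v, w} ⊔ subspaceRadical s (C (b + 1))
  swap
  · exact ⟨x, hxM, hx, n₁, n₂, n₃, hxP⟩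
  have h1 := hC.odd_line hs (k := k) (by omega) hv hw hvw
  set Q := C (2 * k) ⊔ Submodule.span F {v, w} with hQ
  have hQM : Q ≤ C (b + 1) := by
    refine sup_le (hC.mono (by omega)) (Submodule.span_le.2 ?_)
    rintro _ (rfl | rfl) <;> assumption
  -- The right side has dimension at most `2 * k + 3`, while `b + 1 ≥ 2 * k + 4`.
  have hnle : ¬ C (b + 1) ≤ Q ⊔ subspaceRadical s (C (b + 1)) := by
    intro hcon
    have h2 := Submodule.finrank_mono hcon
    have h3 := Submodule.finrank_add_le_finrank_add_finrank Q (subspaceRadical s (C (b + 1)))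
    have h4 := hC.finrank_radical_le_one hs (i := b + 1) hb
    rw [hC.finrank_eq _ hb] at h2
    rw [h1.2.1] at h3
    omega
  obtain ⟨y, hy, hyn⟩ := SetLike.not_le_iff_exists.1 hnle
  obtain ⟨q, hq, hperp⟩ := h1.2.2.1.exists_proj hs y
  set y' := y - q with hy'
  have hy'M : y' ∈ C (b + 1) := (C (b + 1)).sub_mem hy (hQM hq)
  have hPQ : Submodule.span F {v, w} ≤ Q := le_sup_right
  have hy'n : y' ∉ Q ⊔ subspaceRadical s (C (b + 1)) := fun h => hyn (by
    rw [← sub_add_cancel y q]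
    exact Submodule.add_mem _ h ((le_sup_left : Q ≤ _) hq))
  have e1 : s v y' = 0 := hperp v (hPQ (Submodule.subset_span (by simp)))
  have e2 : s w y' = 0 := hperp w (hPQ (Submodule.subset_span (by simp)))
  have e3 : s z y' = 0 := by
    obtain ⟨p, hp, r, hr, rfl⟩ := Submodule.mem_sup.1 hzP
    rw [map_add, LinearMap.add_apply, hperp p (hPQ hp),
      ((mem_subspaceRadical hs).1 hr).2 _ hy'M, add_zero]
  refine ⟨x + y', (C (b + 1)).add_mem hxM hy'M, ?_, ?_, ?_, ?_, ?_⟩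
  · intro u hu
    rw [map_add, hx u hu, hperp u ((le_sup_left : _ ≤ Q) hu), add_zero]
  · rwa [map_add, e1, add_zero]
  · rwa [map_add, e2, add_zero]
  · rwa [map_add, e3, add_zero]
  · intro h
    have := Submodule.sub_mem _ h hxP
    rw [add_sub_cancel_left] at this
    exact hy'n (sup_le_sup_right hPQ _ this)

theorem odd_isSimplyConnectedAt (hs : s.IsAlt) (hF : ∃ t : F, t ≠ 0 ∧ t ≠ 1)
    (hC : IsSymplecticFlag s C) (hkb : 2 * k + 3 ≤ b) (hb : b < finrank F V) :
    IsSimplyConnectedAt C {D | IsSymplecticFlag s D} (Set.Icc (2 * k + 1) b) (2 * k + 1) where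
  mem := ⟨le_rfl, by omega⟩
  succ_mem := ⟨by omega, by omega⟩
  add_two_mem := ⟨by omega, by omega⟩
  line_unique D₁ hD₁ E₁ hE₁ D₂ hD₂ E₂ hE₂ h1 h2 h3 h4 h5 :=
    line_unique hD₁ hE₁ hD₂ hE₂ (by omega) h1 h2 h3 h4 h5
  triangle x y z hxy hxz hyz := by
    have hmem : 2 * k + 1 ∈ Set.Icc (2 * k + 1) b := ⟨le_rfl, by omega⟩
    obtain ⟨⟨D₁, hD₁, h₁, rfl⟩, D₂, hD₂, h₂, rfl⟩ := hxy.exists_mem hmem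
    obtain ⟨-, D₃, hD₃, h₃, rfl⟩ := hxz.exists_mem hmem
    obtain ⟨v, m₁, o₁, -, e₁⟩ := hC.odd_exists_vector hs (by omega) hb hD₁ h₁
    obtain ⟨w, m₂, o₂, -, e₂⟩ := hC.odd_exists_vector hs (by omega) hb hD₂ h₂
    obtain ⟨z, m₃, o₃, -, e₃⟩ := hC.odd_exists_vector hs (by omega) hb hD₃ h₃
    rw [e₁, e₂, hC.odd_pointAdj_iff hs (by omega) hb m₁ m₂ o₁ o₂] at hxy
    rw [e₁, e₃, hC.odd_pointAdj_iff hs (by omega) hb m₁ m₃ o₁ o₃] at hxz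
    rw [e₂, e₃, hC.odd_pointAdj_iff hs (by omega) hb m₂ m₃ o₂ o₃] at hyz
    rw [e₁, e₂, e₃]
    by_cases hzP : z ∈ Submodule.span F {v, w} ⊔ subspaceRadical s (C (b + 1))
    · right
      obtain ⟨x, hxM, hx, n₁, n₂, n₃, hxP⟩ := hC.odd_triangle hs hF hkb hb m₁ m₂ m₃ o₁ o₂ o₃
        hxy hxz hyz hzP
      have hvP : v ∈ Submodule.span F {v, w} ⊔ subspaceRadical s (C (b + 1)) :=
        (le_sup_left : _ ≤ _ ⊔ subspaceRadical s (C (b + 1))) (Submodule.subset_span (by simp))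
      have hwP : w ∈ Submodule.span F {v, w} ⊔ subspaceRadical s (C (b + 1)) :=
        (le_sup_left : _ ≤ _ ⊔ subspaceRadical s (C (b + 1))) (Submodule.subset_span (by simp))
      refine ⟨C (2 * k) ⊔ Submodule.span F {x}, ?_, ?_, ?_⟩
      · exact hC.odd_isPlanar hs (by omega) hb m₁ m₂ hxM o₁ o₂ hx hxy n₁ n₂ hxP
      -- Since `z` lies in the span of `v`, `w` and the radical, so does the span formed from `v`,
      -- `z` and the radical; `x` avoids both.
      · refine hC.odd_isPlanar hs (by omega) hb m₁ m₃ hxM o₁ o₃ hx hxz n₁ n₃ fun h => hxP ?_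
        refine (sup_le (Submodule.span_le.2 ?_) le_sup_right :
          _ ≤ Submodule.span F {v, w} ⊔ subspaceRadical s (C (b + 1))) h
        rintro _ (rfl | rfl) <;> assumption
      · refine hC.odd_isPlanar hs (by omega) hb m₂ m₃ hxM o₂ o₃ hx hyz n₂ n₃ fun h => hxP ?_
        refine (sup_le (Submodule.span_le.2 ?_) le_sup_right :
          _ ≤ Submodule.span F {v, w} ⊔ subspaceRadical s (C (b + 1))) h
        rintro _ (rfl | rfl) <;> assumption
    · left
      exact hC.odd_isPlanar hs (by omega) hb m₁ m₂ m₃ o₁ o₂ o₃ hxy hxz hyz hzP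
  square x y z z' hxz hxz' hyz hyz' _ _ hnxy hnzz' := by
    have hmem : 2 * k + 1 ∈ Set.Icc (2 * k + 1) b := ⟨le_rfl, by omega⟩
    obtain ⟨⟨D₁, hD₁, h₁, rfl⟩, D₃, hD₃, h₃, rfl⟩ := hxz.exists_mem hmem
    obtain ⟨⟨D₂, hD₂, h₂, rfl⟩, D₄, hD₄, h₄, rfl⟩ := hyz'.exists_mem hmem
    obtain ⟨v, m₁, o₁, -, e₁⟩ := hC.odd_exists_vector hs (by omega) hb hD₁ h₁
    obtain ⟨w, m₂, o₂, -, e₂⟩ := hC.odd_exists_vector hs (by omega) hb hD₂ h₂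
    obtain ⟨p, m₃, o₃, -, e₃⟩ := hC.odd_exists_vector hs (by omega) hb hD₃ h₃
    obtain ⟨q, m₄, o₄, -, e₄⟩ := hC.odd_exists_vector hs (by omega) hb hD₄ h₄
    have iff := fun {v w : V} => hC.odd_pointAdj_iff hs (k := k) (by omega) hb (v := v) (w := w)
    rw [e₁, e₃, iff m₁ m₃ o₁ o₃] at hxz
    rw [e₁, e₄, iff m₁ m₄ o₁ o₄] at hxz'
    rw [e₂, e₃, iff m₂ m₃ o₂ o₃] at hyz
    rw [e₁, e₂, iff m₁ m₂ o₁ o₂, not_not] at hnxy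
    rw [e₃, e₄, iff m₃ m₄ o₃ o₄, not_not] at hnzz'
    -- With `v ⟂ w` and `p ⟂ q`, the vector `v + p` pairs with each of the four through a single
    -- nonzero product.
    have m : v + p ∈ C (b + 1) := (C (b + 1)).add_mem m₁ m₃
    have o : ∀ u ∈ C (2 * k), s u (v + p) = 0 := fun u hu => by
      rw [map_add, o₁ u hu, o₃ u hu, add_zero]
    refine ⟨C (2 * k) ⊔ Submodule.span F {v + p}, ?_, ?_, ?_, ?_⟩
    · rwa [e₁, iff m₁ m o₁ o, map_add, hs v, zero_add]
    · rwa [e₂, iff m₂ m o₂ o, map_add, (apply_eq_zero_comm hs).1 hnxy, zero_add]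
    · rw [e₃, iff m₃ m o₃ o, map_add, hs p, add_zero]
      exact fun h => hxz ((apply_eq_zero_comm hs).1 h)
    · rw [e₄, iff m₄ m o₄ o, map_add, (apply_eq_zero_comm hs).1 hnzz', add_zero]
      exact fun h => hxz' ((apply_eq_zero_comm hs).1 h)
  three D₁ hD₁ D₂ hD₂ D₃ hD₃ h₁ h₂ h₃ := hC.odd_three hs hF (by omega) hb hD₁ hD₂ hD₃ h₁ h₂ h₃

end IsSymplecticFlag

end OddPoints

/-! ### Points of even dimension: an affine space of partners -/

section EvenPoints

variable {F : Type u} {V : Type v} [Field F] [AddCommGroup V] [Module F V]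
  {s : LinearMap.BilinForm F V} {C D : ℕ → Submodule F V} {k b : ℕ} {e : V}

/-- `e` spans the radical of `C (2 * k + 1)`. -/
structure SpansRadical (s : LinearMap.BilinForm F V) (C : ℕ → Submodule F V) (k : ℕ) (e : V) :
    Prop where
  mem : e ∈ C (2 * k + 1)
  orthogonal : ∀ u ∈ C (2 * k), s u e = 0
  ne_zero : e ≠ 0

/-- `f` is a vector of `C (b + 1)`, orthogonal to `C (2 * k)`, that forms a hyperbolic pair with
`e`. -/
structure IsPartner (s : LinearMap.BilinForm F V) (C : ℕ → Submodule F V) (k b : ℕ) (e f : V) :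
    Prop where
  mem : f ∈ C (b + 1)
  orthogonal : ∀ u ∈ C (2 * k), s u f = 0
  apply_eq_one : s e f = 1

/-- `d` is not orthogonal to all vectors of `C (b + 1)` orthogonal to `C (2 * k + 1)`. -/
def IsSeparating (s : LinearMap.BilinForm F V) (C : ℕ → Submodule F V) (k b : ℕ) (d : V) : Prop :=
  ∃ c ∈ C (b + 1) ⊓ s.orthogonal (C (2 * k + 1)), s d c ≠ 0

/-- The vectors that are not separating form a subspace; this makes non-adjacency of points an
equivalence relation. -/
theorem IsSeparating.or_of_sub {x y : V} (h : IsSeparating s C k b (x - y)) :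
    IsSeparating s C k b x ∨ IsSeparating s C k b y := by
  obtain ⟨c, hc, hne⟩ := h
  by_cases h1 : s x c = 0
  · right
    refine ⟨c, hc, fun h2 => hne ?_⟩
    rw [map_sub, LinearMap.sub_apply, h1, h2, sub_zero]
  · exact Or.inl ⟨c, hc, h1⟩

theorem IsSeparating.neg {x : V} (h : IsSeparating s C k b x) : IsSeparating s C k b (-x) := by
  obtain ⟨c, hc, hne⟩ := h
  exact ⟨c, hc, by rwa [map_neg, LinearMap.neg_apply, neg_ne_zero]⟩

namespace IsSymplecticFlag

variable [FiniteDimensional F V]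

theorem eq_sup_span (hs : s.IsAlt) (hC : IsSymplecticFlag s C) (hk : 2 * k + 1 ≤ finrank F V)
    (he : SpansRadical s C k e) : C (2 * k + 1) = C (2 * k) ⊔ Submodule.span F {e} := by
  have h : e ∉ C (2 * k) := fun h => he.ne_zero
    (hC.nondegOn _ (by omega) (even_two_mul k) e h fun y hy =>
      (apply_eq_zero_comm hs).1 (he.orthogonal y hy))
  symm
  refine Submodule.eq_of_le_of_finrank_eq (sup_le (hC.mono (Nat.le_succ _)) ?_) ?_
  · rw [Submodule.span_singleton_le_iff_mem]
    exact he.mem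
  · rw [Submodule.finrank_sup_span_singleton h, hC.finrank_eq _ (by omega), hC.finrank_eq _ hk]

theorem apply_eq_zero_of_transverse (hs : s.IsAlt) (hC : IsSymplecticFlag s C)
    (hk : 2 * k + 1 ≤ finrank F V) (he : SpansRadical s C k e) {c : V}
    (h1 : ∀ u ∈ C (2 * k), s u c = 0) (h2 : s e c = 0) : ∀ u ∈ C (2 * k + 1), s u c = 0 := by
  rw [hC.eq_sup_span hs hk he]
  intro x hx
  obtain ⟨u, hu, z, hz, rfl⟩ := Submodule.mem_sup.1 hx
  obtain ⟨α, rfl⟩ := Submodule.mem_span_singleton.1 hz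
  simp [h1 u hu, h2]

theorem apply_radical_eq_zero (hs : s.IsAlt) (hC : IsSymplecticFlag s C)
    (hk : 2 * k + 1 ≤ finrank F V) (he : SpansRadical s C k e) :
    ∀ u ∈ C (2 * k + 1), s u e = 0 :=
  hC.apply_eq_zero_of_transverse hs hk he he.orthogonal (hs e)

/-- Partners of `e` thus form an affine space over the translations in `C (b + 1)` orthogonal to `C
(2 * k + 1)`. -/
theorem even_sub_mem (hs : s.IsAlt) (hC : IsSymplecticFlag s C)
    (hk : 2 * k + 1 ≤ finrank F V) (he : SpansRadical s C k e) {f g : V}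
    (hf : IsPartner s C k b e f) (hg : IsPartner s C k b e g) :
    g - f ∈ C (b + 1) ⊓ s.orthogonal (C (2 * k + 1)) := by
  refine ⟨(C (b + 1)).sub_mem hg.mem hf.mem,
    hC.apply_eq_zero_of_transverse hs hk he (fun u hu => ?_) ?_⟩
  · rw [map_sub, hf.orthogonal u hu, hg.orthogonal u hu, sub_zero]
  · rw [map_sub, hf.apply_eq_one, hg.apply_eq_one, sub_self]

theorem even_point (hs : s.IsAlt) (hC : IsSymplecticFlag s C) (hk : 2 * k + 1 ≤ finrank F V)
    (he : SpansRadical s C k e) {f : V} (hf : IsPartner s C k b e f) :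
    finrank F (C (2 * k + 1) ⊔ Submodule.span F {f} : Submodule F V) = 2 * k + 2 ∧
    NondegOn s (C (2 * k + 1) ⊔ Submodule.span F {f}) := by
  have hU := hC.nondegOn (2 * k) (by omega) (even_two_mul k)
  have h1 : s e f ≠ 0 := by rw [hf.apply_eq_one]; exact one_ne_zero
  have h2 : C (2 * k + 1) ⊔ Submodule.span F {f} = C (2 * k) ⊔ Submodule.span F {e, f} := by
    rw [hC.eq_sup_span hs hk he, sup_assoc, ← Submodule.span_union, Set.singleton_union]
  rw [h2, (finrank_sup_span_pair hs hU he.orthogonal h1).2.2, hC.finrank_eq _ (by omega)]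
  exact ⟨rfl, hU.sup_pair hs he.orthogonal hf.orthogonal h1⟩

theorem even_exists_vector (hs : s.IsAlt) (hC : IsSymplecticFlag s C) (hkb : 2 * k + 2 ≤ b)
    (hb : b < finrank F V) (he : SpansRadical s C k e) (hD : IsSymplecticFlag s D)
    (hDC : AgreeOff (Set.Icc (2 * k + 2) b) D C) :
    ∃ f, IsPartner s C k b e f ∧ D (2 * k + 2) = C (2 * k + 1) ⊔ Submodule.span F {f} := by
  have e0 : D (2 * k) = C (2 * k) := hDC _ (by simp)
  have e1 : D (2 * k + 1) = C (2 * k + 1) := hDC _ (by simp)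
  have e2 : D (b + 1) = C (b + 1) := hDC _ (by simp)
  have hle : D (2 * k + 2) ≤ C (b + 1) := e2 ▸ hD.mono (by omega)
  have hle' : C (2 * k + 1) ≤ D (2 * k + 2) := e1 ▸ hD.mono (by omega)
  have hey : ∃ y ∈ D (2 * k + 2), s e y ≠ 0 := by
    by_contra! hcon
    exact he.ne_zero (hD.nondegOn (2 * k + 2) (by omega) (by simp [Nat.even_add]) e
      (hle' he.mem) hcon)
  obtain ⟨y, hy, hey⟩ := hey
  obtain ⟨u, hu, hyu⟩ := (hC.nondegOn (2 * k) (by omega) (even_two_mul k)).exists_proj hs y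
  have hey' : s e (y - u) = s e y := by
    rw [map_sub, (apply_eq_zero_comm hs).1 (he.orthogonal u hu), sub_zero]
  have hfD : (s e y)⁻¹ • (y - u) ∈ D (2 * k + 2) :=
    (D _).smul_mem _ ((D _).sub_mem hy (hle' (hC.mono (Nat.le_succ _) hu)))
  have hf : IsPartner s C k b e ((s e y)⁻¹ • (y - u)) := by
    refine ⟨hle hfD, fun x hx => ?_, ?_⟩
    · rw [map_smul, hyu x hx, smul_zero]
    · rw [map_smul, hey', smul_eq_mul, inv_mul_cancel₀ hey]
  refine ⟨_, hf, ?_⟩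
  symm
  refine Submodule.eq_of_le_of_finrank_eq (sup_le hle' ?_) ?_
  · rwa [Submodule.span_singleton_le_iff_mem]
  · rw [(hC.even_point hs (by omega) he hf).1, hD.finrank_eq _ (by omega)]

theorem even_notMem (hs : s.IsAlt) (hC : IsSymplecticFlag s C)
    (hk : 2 * k + 1 ≤ finrank F V) (he : SpansRadical s C k e) {f g : V}
    (hf : IsPartner s C k b e f) (hg : IsPartner s C k b e g)
    (hfg : IsSeparating s C k b (g - f)) : g ∉ C (2 * k + 1) ⊔ Submodule.span F {f} := by
  intro h
  obtain ⟨c, ⟨-, hc⟩, hne⟩ := hfg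
  obtain ⟨u, hu, z, hz, rfl⟩ := Submodule.mem_sup.1 h
  obtain ⟨α, rfl⟩ := Submodule.mem_span_singleton.1 hz
  have h1 := hg.apply_eq_one
  rw [map_add, (apply_eq_zero_comm hs).1 (hC.apply_radical_eq_zero hs hk he u hu), zero_add,
    map_smul, hf.apply_eq_one, smul_eq_mul, mul_one] at h1
  rw [h1, one_smul, add_sub_cancel_right] at hne
  exact hne (hc u hu)

theorem even_ne (hs : s.IsAlt) (hC : IsSymplecticFlag s C)
    (hk : 2 * k + 1 ≤ finrank F V) (he : SpansRadical s C k e) {f g : V}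
    (hf : IsPartner s C k b e f) (hg : IsPartner s C k b e g)
    (hfg : IsSeparating s C k b (g - f)) :
    C (2 * k + 1) ⊔ Submodule.span F {f} ≠ C (2 * k + 1) ⊔ Submodule.span F {g} := by
  intro h
  refine hC.even_notMem hs hk he hf hg hfg ?_
  rw [h]
  exact (le_sup_right : _ ≤ C (2 * k + 1) ⊔ _) (Submodule.mem_span_singleton_self g)

/-- The line has odd dimension `2 * k + 3`, so the condition is only that it meet `Rad (C (b + 1))`
trivially. Conversely, a flag realizing the edge has a nondegenerate member `D (2 * k + 4)`; there
the part of `g` orthogonal to the point of `f` pairs with a suitable vector, whose projection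
separates. -/
theorem even_pointAdj_iff (hs : s.IsAlt) (hC : IsSymplecticFlag s C) (hkb : 2 * k + 3 ≤ b)
    (hb : b < finrank F V) (he : SpansRadical s C k e) {f g : V}
    (hf : IsPartner s C k b e f) (hg : IsPartner s C k b e g) :
    PointAdj C {D | IsSymplecticFlag s D} (Set.Icc (2 * k + 2) b) (2 * k + 2)
      (C (2 * k + 1) ⊔ Submodule.span F {f}) (C (2 * k + 1) ⊔ Submodule.span F {g}) ↔
      IsSeparating s C k b (g - f) := by
  have hpf := hC.even_point hs (by omega) he hf
  have hpg := hC.even_point hs (by omega) he hg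
  have hCM : C (2 * k + 1) ≤ C (b + 1) := hC.mono (by omega)
  have hfp : f ∈ C (2 * k + 1) ⊔ Submodule.span F {f} :=
    (le_sup_right : _ ≤ C (2 * k + 1) ⊔ _) (Submodule.mem_span_singleton_self f)
  have hpM : C (2 * k + 1) ⊔ Submodule.span F {f} ≤ C (b + 1) := by
    refine sup_le hCM ?_
    rw [Submodule.span_singleton_le_iff_mem]
    exact hf.mem
  constructor
  · rintro ⟨hne, D, hD, D', hD', hDC, hDD', hDa, hDa'⟩
    have hfD : C (2 * k + 1) ⊔ Submodule.span F {f} ≤ D (2 * k + 4) := by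
      rw [← hDa]
      exact IsSymplecticFlag.mono hD (by omega)
    have hgD : g ∈ D (2 * k + 4) := by
      have h1 : D' (2 * k + 2) ≤ D (2 * k + 4) := by
        rw [hDD' (2 * k + 4) (by simp)]
        exact IsSymplecticFlag.mono hD' (by omega)
      rw [hDa'] at h1
      exact h1 ((le_sup_right : _ ≤ C (2 * k + 1) ⊔ _) (Submodule.mem_span_singleton_self g))
    have hDM : D (2 * k + 4) ≤ C (b + 1) := by
      rw [← hDC (b + 1) (by simp)]
      exact IsSymplecticFlag.mono hD (by omega)
    have hgn : g ∉ C (2 * k + 1) ⊔ Submodule.span F {f} := fun h => by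
      refine hne (Submodule.eq_of_le_of_finrank_eq (sup_le le_sup_left ?_) ?_).symm
      · rwa [Submodule.span_singleton_le_iff_mem]
      · rw [hpf.1, hpg.1]
    obtain ⟨p, hp, hperp⟩ := hpf.2.exists_proj hs g
    have hne0 : g - p ≠ 0 := fun h => hgn (by rwa [sub_eq_zero.1 h])
    have hy : ∃ y ∈ D (2 * k + 4), s (g - p) y ≠ 0 := by
      by_contra! hcon
      exact hne0 (IsSymplecticFlag.nondegOn hD (2 * k + 4) (by omega) ⟨k + 2, by omega⟩ _
        ((D _).sub_mem hgD (hfD hp)) hcon)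
    obtain ⟨y, hy, hne1⟩ := hy
    obtain ⟨q, hq, hyq⟩ := hpf.2.exists_proj hs y
    have hne2 : s (g - p) (y - q) ≠ 0 := by
      rwa [map_sub, (apply_eq_zero_comm hs).1 (hperp q hq), sub_zero]
    have hpq : s p (y - q) = 0 := hyq p hp
    have hfq : s f (y - q) = 0 := hyq f hfp
    refine ⟨y - q, ⟨(C (b + 1)).sub_mem (hDM hy) (hpM hq), fun u hu => ?_⟩, ?_⟩
    · exact hyq u ((le_sup_left : _ ≤ _ ⊔ Submodule.span F {f}) hu)
    · rw [LinearMap.map_sub₂, hpq, sub_zero] at hne2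
      rwa [LinearMap.map_sub₂, hfq, sub_zero]
  · intro hfg
    have hgn := hC.even_notMem hs (by omega) he hf hg hfg
    have hne := hC.even_ne hs (by omega) he hf hg hfg
    obtain ⟨c, ⟨hcM, hc⟩, hcne⟩ := hfg
    have hlM : C (2 * k + 1) ⊔ Submodule.span F {f} ⊔ Submodule.span F {g} ≤ C (b + 1) := by
      refine sup_le hpM ?_
      rw [Submodule.span_singleton_le_iff_mem]
      exact hg.mem
    refine hC.pointAdj_of_line hs (by omega) (by omega) hb hne le_sup_left le_sup_left
      (l := C (2 * k + 1) ⊔ Submodule.span F {f} ⊔ Submodule.span F {g}) le_sup_left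
      (sup_le (le_sup_left.trans le_sup_left) le_sup_right) hlM hpf.1 hpg.1
      (by rw [Submodule.finrank_sup_span_singleton hgn, hpf.1])
      (fun _ => hpf.2) (fun _ => hpg.2) (fun h => by simp [Nat.even_add] at h) ?_
    intro x hx hxM
    obtain ⟨x₁, hx₁, z, hz, rfl⟩ := Submodule.mem_sup.1 hx
    obtain ⟨u, hu, z', hz', rfl⟩ := Submodule.mem_sup.1 hx₁
    obtain ⟨β, rfl⟩ := Submodule.mem_span_singleton.1 hz
    obtain ⟨α, rfl⟩ := Submodule.mem_span_singleton.1 hz'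
    -- For a radical vector `u + α f + β g`, pairing with `e` gives `α + β = 0`, and pairing with
    -- `c` then gives `β * s (g - f) c = 0`.
    have h1 := (apply_eq_zero_comm hs).1 (hxM e (hCM he.mem))
    have hue := (apply_eq_zero_comm hs).1 (hC.apply_radical_eq_zero hs (by omega) he u hu)
    have huc : s u c = 0 := hc u hu
    simp only [map_add, map_smul, hue, hf.apply_eq_one, hg.apply_eq_one, smul_eq_mul, mul_one,
      zero_add] at h1
    have h2 := hxM c hcM
    simp only [map_add, map_smul, LinearMap.add_apply, LinearMap.smul_apply, huc, smul_eq_mul,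
      zero_add] at h2
    rw [map_sub, LinearMap.sub_apply] at hcne
    have hβ : β = 0 := by
      have : β * (s g c - s f c) = 0 := by linear_combination h2 - s f c * h1
      exact (mul_eq_zero.1 this).resolve_right hcne
    subst hβ
    rw [zero_smul, add_zero] at hxM ⊢
    exact hpf.2 _ hx₁ fun y hy => hxM y (hpM hy)

/-- Corrected by multiples of `e`, the differences `g - f` and `h - f` become orthogonal to the
point of `f` without changing their product. They therefore extend that point to a nondegenerate
plane, of dimension `2 * k + 4`. -/
theorem even_isPlanar (hs : s.IsAlt) (hC : IsSymplecticFlag s C) (hkb : 2 * k + 4 ≤ b)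
    (hb : b < finrank F V) (he : SpansRadical s C k e) {f g h : V}
    (hf : IsPartner s C k b e f) (hg : IsPartner s C k b e g) (hh : IsPartner s C k b e h)
    (hne : s (g - f) (h - f) ≠ 0) :
    IsPlanar C {D | IsSymplecticFlag s D} (Set.Icc (2 * k + 2) b) (2 * k + 2)
      (C (2 * k + 1) ⊔ Submodule.span F {f}) (C (2 * k + 1) ⊔ Submodule.span F {g})
      (C (2 * k + 1) ⊔ Submodule.span F {h}) := by
  have hk : 2 * k + 1 ≤ finrank F V := by omega
  have hpf := hC.even_point hs hk he hf
  have hgf := hC.even_sub_mem hs hk he hf hg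
  have hhf := hC.even_sub_mem hs hk he hf hh
  have hCM : C (2 * k + 1) ≤ C (b + 1) := hC.mono (by omega)
  have s1 : IsSeparating s C k b (g - f) := ⟨_, hhf, hne⟩
  have s2 : IsSeparating s C k b (h - f) := ⟨_, hgf, fun h => hne ((apply_eq_zero_comm hs).1 h)⟩
  have s3 : IsSeparating s C k b (h - g) := by
    refine ⟨_, hgf, fun h0 => hne ((apply_eq_zero_comm hs).1 ?_)⟩
    rw [← sub_add_sub_cancel h g f, map_add, LinearMap.add_apply, h0, hs, add_zero]
  set p := C (2 * k + 1) ⊔ Submodule.span F {f} with hp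
  have hCp : C (2 * k + 1) ≤ p := le_sup_left
  have hfp : f ∈ p := (le_sup_right : _ ≤ C (2 * k + 1) ⊔ _) (Submodule.mem_span_singleton_self f)
  -- Since `s f e = -1`, the correction cancels `s f d`, and `e` is orthogonal to `C (2 * k + 1)`
  -- anyway.
  have hperp : ∀ {d : V}, d ∈ C (b + 1) ⊓ s.orthogonal (C (2 * k + 1)) →
      ∀ u ∈ p, s u (d + s f d • e) = 0 := by
    rintro d ⟨-, hd⟩ x hx
    obtain ⟨u, hu, z, hz, rfl⟩ := Submodule.mem_sup.1 hx
    obtain ⟨α, rfl⟩ := Submodule.mem_span_singleton.1 hz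
    have h1 : s u d = 0 := hd u hu
    have h2 : s f e = -1 := by rw [← hs.neg_eq, hf.apply_eq_one]
    simp [h1, h2, hC.apply_radical_eq_zero hs hk he u hu]
  set ρ := (g - f) + s f (g - f) • e with hρ
  set σ := (h - f) + s f (h - f) • e with hσ
  have hρσ : s ρ σ ≠ 0 := by
    have h1 : s e (h - f) = 0 := hhf.2 e he.mem
    have h2 : s (g - f) e = 0 := (apply_eq_zero_comm hs).1 (hgf.2 e he.mem)
    rw [hρ, hσ, map_add, map_add, map_smul, map_smul, LinearMap.add_apply, LinearMap.add_apply,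
      LinearMap.smul_apply, LinearMap.smul_apply, h1, h2, hs e]
    simpa using hne
  set t := p ⊔ Submodule.span F {ρ, σ} with ht
  have hpt : p ≤ t := le_sup_left
  have htn : NondegOn s t := hpf.2.sup_pair hs (hperp hgf) (hperp hhf) hρσ
  have htf : finrank F t = 2 * k + 2 + 2 := by
    rw [ht, (finrank_sup_span_pair hs hpf.2 (hperp hgf) hρσ).2.2, hpf.1]
  have hpM : p ≤ C (b + 1) := by
    refine sup_le hCM ?_
    rw [Submodule.span_singleton_le_iff_mem]
    exact hf.mem
  have htM : t ≤ C (b + 1) := by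
    refine sup_le hpM (Submodule.span_le.2 ?_)
    rintro _ (rfl | rfl)
    · exact Submodule.add_mem _ hgf.1 (Submodule.smul_mem _ _ (hCM he.mem))
    · exact Submodule.add_mem _ hhf.1 (Submodule.smul_mem _ _ (hCM he.mem))
  have het : e ∈ t := hpt (hCp he.mem)
  have hft : f ∈ t := hpt hfp
  have hρt : ρ ∈ t := (le_sup_right : _ ≤ p ⊔ _) (Submodule.subset_span (by simp))
  have hσt : σ ∈ t := (le_sup_right : _ ≤ p ⊔ _) (Submodule.subset_span (by simp))
  have hgt : g ∈ t := by
    have : g = ρ - s f (g - f) • e + f := by rw [hρ]; abel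
    rw [this]
    exact t.add_mem (t.sub_mem hρt (t.smul_mem _ het)) hft
  have hht : h ∈ t := by
    have : h = σ - s f (h - f) • e + f := by rw [hσ]; abel
    rw [this]
    exact t.add_mem (t.sub_mem hσt (t.smul_mem _ het)) hft
  have key : ∀ {x y : V}, x ∈ t → y ∈ t → IsPartner s C k b e x → IsPartner s C k b e y →
      IsSeparating s C k b (y - x) →
      PointAdjIn C {D | IsSymplecticFlag s D} (Set.Icc (2 * k + 2) b) (2 * k + 2) t
        (C (2 * k + 1) ⊔ Submodule.span F {x}) (C (2 * k + 1) ⊔ Submodule.span F {y}) := by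
    intro x y hxt hyt hx hy hxy
    have hpx := hC.even_point hs hk he hx
    have hpy := hC.even_point hs hk he hy
    refine hC.pointAdjIn_of_plane hs (by omega) (by omega) hb (hC.even_ne hs hk he hx hy hxy)
      le_sup_left le_sup_left
      (l := C (2 * k + 1) ⊔ Submodule.span F {x} ⊔ Submodule.span F {y}) le_sup_left
      (sup_le (le_sup_left.trans le_sup_left) le_sup_right) ?_ htM hpx.1 hpy.1
      (by rw [Submodule.finrank_sup_span_singleton (hC.even_notMem hs hk he hx hy hxy), hpx.1])
      htf (fun _ => hpx.2) (fun _ => hpy.2) (fun h => by simp [Nat.even_add] at h) (fun _ => htn)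
      (htn.meetsRadTrivially htM)
    refine sup_le (sup_le (hCp.trans hpt) ?_) ?_
    · rwa [Submodule.span_singleton_le_iff_mem]
    · rwa [Submodule.span_singleton_le_iff_mem]
  exact ⟨t, key hft hgt hf hg s1, key hft hht hf hh s2, key hgt hht hg hh s3⟩

/-- For a hyperbolic pair `p`, `q` of translations, the vectors `p`, `q`, `p + q` are nonzero and
pairwise distinct modulo the non-separating vectors. Each of `g - f` and `h - f` excludes at most
one of them, so one survives, over any field. -/
theorem even_three_vectors (hs : s.IsAlt) (hC : IsSymplecticFlag s C) (hkb : 2 * k + 3 ≤ b)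
    (hb : b < finrank F V) (he : SpansRadical s C k e) {f g h : V}
    (hf : IsPartner s C k b e f) :
    ∃ w, IsPartner s C k b e w ∧ IsSeparating s C k b (w - f) ∧ IsSeparating s C k b (w - g) ∧
      IsSeparating s C k b (w - h) := by
  obtain ⟨p, q, hp, hq⟩ := hC.exists_hyperbolic hs (2 * k + 2) (by simp [Nat.even_add])
  replace hp := hp (by omega)
  replace hq := hq (by omega)
  have hpM : p ∈ C (b + 1) := hC.mono (by omega) hp.1
  have hqM : q ∈ C (b + 1) := hC.mono (by omega) hq.1
  have hpo : ∀ u ∈ C (2 * k + 1), s u p = 0 := fun u hu => hp.2.1 u (hC.mono (by omega) hu)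
  have hqo : ∀ u ∈ C (2 * k + 1), s u q = 0 := fun u hu => hq.2.1 u (hC.mono (by omega) hu)
  have hpt : p ∈ C (b + 1) ⊓ s.orthogonal (C (2 * k + 1)) := ⟨hpM, hpo⟩
  have hqt : q ∈ C (b + 1) ⊓ s.orthogonal (C (2 * k + 1)) := ⟨hqM, hqo⟩
  have hqp : s q p = -1 := by rw [← hs.neg_eq, hq.2.2]
  have t1 : IsSeparating s C k b p := ⟨q, hqt, by rw [hq.2.2]; exact one_ne_zero⟩
  have t2 : IsSeparating s C k b q := ⟨p, hpt, by rw [hqp]; exact neg_ne_zero.2 one_ne_zero⟩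
  have t3 : IsSeparating s C k b (p + q) :=
    ⟨q, hqt, by rw [map_add, LinearMap.add_apply, hq.2.2, hs q, add_zero]; exact one_ne_zero⟩
  have t4 : IsSeparating s C k b (p - q) :=
    ⟨q, hqt, by rw [map_sub, LinearMap.sub_apply, hq.2.2, hs q, sub_zero]; exact one_ne_zero⟩
  have hd : ∀ d, (IsSeparating s C k b (p - d) ∨ IsSeparating s C k b (q - d)) ∧
      (IsSeparating s C k b (p - d) ∨ IsSeparating s C k b (p + q - d)) ∧
      (IsSeparating s C k b (q - d) ∨ IsSeparating s C k b (p + q - d)) := by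
    intro d
    refine ⟨IsSeparating.or_of_sub ?_, (IsSeparating.or_of_sub ?_).symm,
      (IsSeparating.or_of_sub ?_).symm⟩
    · rwa [sub_sub_sub_cancel_right]
    · rwa [sub_sub_sub_cancel_right, add_sub_cancel_left]
    · rwa [sub_sub_sub_cancel_right, add_sub_cancel_right]
  have hc : ∃ c ∈ C (b + 1) ⊓ s.orthogonal (C (2 * k + 1)), IsSeparating s C k b c ∧
      IsSeparating s C k b (c - (g - f)) ∧ IsSeparating s C k b (c - (h - f)) := by
    obtain ⟨a1, a2, a3⟩ := hd (g - f)
    obtain ⟨b1, b2, b3⟩ := hd (h - f)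
    by_cases c1 : IsSeparating s C k b (p - (g - f)) ∧ IsSeparating s C k b (p - (h - f))
    · exact ⟨p, hpt, t1, c1⟩
    by_cases c2 : IsSeparating s C k b (q - (g - f)) ∧ IsSeparating s C k b (q - (h - f))
    · exact ⟨q, hqt, t2, c2⟩
    refine ⟨p + q, Submodule.add_mem _ hpt hqt, t3, ?_⟩
    tauto
  obtain ⟨c, ⟨hcM, hco⟩, h1, h2, h3⟩ := hc
  refine ⟨f + c, ⟨(C (b + 1)).add_mem hf.mem hcM, fun u hu => ?_, ?_⟩, ?_, ?_, ?_⟩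
  · have h0 : s u c = 0 := hco u (hC.mono (Nat.le_succ _) hu)
    rw [map_add, hf.orthogonal u hu, h0, add_zero]
  · have h0 : s e c = 0 := hco e he.mem
    rw [map_add, hf.apply_eq_one, h0, add_zero]
  · rwa [add_sub_cancel_left]
  · rwa [show f + c - g = c - (g - f) by abel]
  · rwa [show f + c - h = c - (h - f) by abel]

theorem exists_spansRadical (hs : s.IsAlt) (hC : IsSymplecticFlag s C)
    (hk : 2 * k < finrank F V) : ∃ e, SpansRadical s C k e := by
  obtain ⟨e, h1, h2, h3⟩ := hC.exists_orthogonal_of_lt hs hk (even_two_mul k)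
  exact ⟨e, h1, h2, h3⟩

theorem even_three (hs : s.IsAlt) (hC : IsSymplecticFlag s C)
    (hkb : 2 * k + 3 ≤ b) (hb : b < finrank F V) {D₁ D₂ D₃ : ℕ → Submodule F V}
    (hD₁ : IsSymplecticFlag s D₁) (hD₂ : IsSymplecticFlag s D₂) (hD₃ : IsSymplecticFlag s D₃)
    (h₁ : AgreeOff (Set.Icc (2 * k + 2) b) D₁ C) (h₂ : AgreeOff (Set.Icc (2 * k + 2) b) D₂ C)
    (h₃ : AgreeOff (Set.Icc (2 * k + 2) b) D₃ C) :
    ∃ w, PointAdj C {D | IsSymplecticFlag s D} (Set.Icc (2 * k + 2) b) (2 * k + 2)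
        (D₁ (2 * k + 2)) w ∧
      PointAdj C {D | IsSymplecticFlag s D} (Set.Icc (2 * k + 2) b) (2 * k + 2)
        (D₂ (2 * k + 2)) w ∧
      PointAdj C {D | IsSymplecticFlag s D} (Set.Icc (2 * k + 2) b) (2 * k + 2)
        (D₃ (2 * k + 2)) w := by
  obtain ⟨e, he⟩ := hC.exists_spansRadical hs (k := k) (by omega)
  obtain ⟨f, hf, e₁⟩ := hC.even_exists_vector hs (by omega) hb he hD₁ h₁
  obtain ⟨g, hg, e₂⟩ := hC.even_exists_vector hs (by omega) hb he hD₂ h₂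
  obtain ⟨h, hh, e₃⟩ := hC.even_exists_vector hs (by omega) hb he hD₃ h₃
  obtain ⟨w, hw, n₁, n₂, n₃⟩ := hC.even_three_vectors hs hkb hb he (g := g) (h := h) hf
  refine ⟨C (2 * k + 1) ⊔ Submodule.span F {w}, ?_, ?_, ?_⟩
  · rwa [e₁, hC.even_pointAdj_iff hs hkb hb he hf hw]
  · rwa [e₂, hC.even_pointAdj_iff hs hkb hb he hg hw]
  · rwa [e₃, hC.even_pointAdj_iff hs hkb hb he hh hw]

-- The three differences define nonzero functionals on the translations; `w` is `f + c` with `c` off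
-- their kernels. As `s (h - g) (g - f) = 0` by `h0`, the third product also reduces to one with
-- `c`.
omit [FiniteDimensional F V] in
theorem even_triangle (hs : s.IsAlt) (hF : ∃ t : F, t ≠ 0 ∧ t ≠ 1) (hC : IsSymplecticFlag s C)
    (he : SpansRadical s C k e) {f g h : V} (hf : IsPartner s C k b e f)
    (hfg : IsSeparating s C k b (g - f)) (hfh : IsSeparating s C k b (h - f))
    (hgh : IsSeparating s C k b (h - g)) (h0 : s (g - f) (h - f) = 0) :
    ∃ w, IsPartner s C k b e w ∧ s (g - f) (w - f) ≠ 0 ∧ s (h - f) (w - f) ≠ 0 ∧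
      s (h - g) (w - g) ≠ 0 := by
  obtain ⟨c, ⟨hcM, hco⟩, n₁, n₂, n₃⟩ := exists_mem_ne_zero_three hF hfg hfh hgh
  refine ⟨f + c, ⟨(C (b + 1)).add_mem hf.mem hcM, fun u hu => ?_, ?_⟩, ?_, ?_, ?_⟩
  · have h0 : s u c = 0 := hco u (hC.mono (Nat.le_succ _) hu)
    rw [map_add, hf.orthogonal u hu, h0, add_zero]
  · have h0 : s e c = 0 := hco e he.mem
    rw [map_add, hf.apply_eq_one, h0, add_zero]
  · rwa [add_sub_cancel_left]
  · rwa [add_sub_cancel_left]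
  · have h1 : s (h - g) (g - f) = 0 := by
      rw [← sub_sub_sub_cancel_right h g f, LinearMap.map_sub₂, hs (g - f), sub_zero]
      exact (apply_eq_zero_comm hs).1 h0
    rwa [show f + c - g = c - (g - f) by abel, map_sub, h1, sub_zero]

theorem even_isSimplyConnectedAt (hs : s.IsAlt) (hF : ∃ t : F, t ≠ 0 ∧ t ≠ 1)
    (hC : IsSymplecticFlag s C) (hkb : 2 * k + 4 ≤ b) (hb : b < finrank F V) :
    IsSimplyConnectedAt C {D | IsSymplecticFlag s D} (Set.Icc (2 * k + 2) b) (2 * k + 2) where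
  mem := ⟨le_rfl, by omega⟩
  succ_mem := ⟨by omega, by omega⟩
  add_two_mem := ⟨by omega, by omega⟩
  line_unique D₁ hD₁ E₁ hE₁ D₂ hD₂ E₂ hE₂ h1 h2 h3 h4 h5 :=
    line_unique hD₁ hE₁ hD₂ hE₂ (by omega) h1 h2 h3 h4 h5
  triangle x y z hxy hxz hyz := by
    have hmem : 2 * k + 2 ∈ Set.Icc (2 * k + 2) b := ⟨le_rfl, by omega⟩
    obtain ⟨e, he⟩ := hC.exists_spansRadical hs (k := k) (by omega)
    obtain ⟨⟨D₁, hD₁, h₁, rfl⟩, D₂, hD₂, h₂, rfl⟩ := hxy.exists_mem hmem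
    obtain ⟨-, D₃, hD₃, h₃, rfl⟩ := hxz.exists_mem hmem
    obtain ⟨f, hf, e₁⟩ := hC.even_exists_vector hs (by omega) hb he hD₁ h₁
    obtain ⟨g, hg, e₂⟩ := hC.even_exists_vector hs (by omega) hb he hD₂ h₂
    obtain ⟨h, hh, e₃⟩ := hC.even_exists_vector hs (by omega) hb he hD₃ h₃
    rw [e₁, e₂, hC.even_pointAdj_iff hs (by omega) hb he hf hg] at hxy
    rw [e₁, e₃, hC.even_pointAdj_iff hs (by omega) hb he hf hh] at hxz
    rw [e₂, e₃, hC.even_pointAdj_iff hs (by omega) hb he hg hh] at hyz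
    rw [e₁, e₂, e₃]
    by_cases h0 : s (g - f) (h - f) = 0
    · right
      obtain ⟨w, hw, n₁, n₂, n₃⟩ := hC.even_triangle hs hF he hf hxy hxz hyz h0
      exact ⟨C (2 * k + 1) ⊔ Submodule.span F {w}, hC.even_isPlanar hs hkb hb he hf hg hw n₁,
        hC.even_isPlanar hs hkb hb he hf hh hw n₂, hC.even_isPlanar hs hkb hb he hg hh hw n₃⟩
    · left
      exact hC.even_isPlanar hs hkb hb he hf hg hh h0
  square x y z z' hxz hxz' hyz hyz' _ _ hnxy hnzz' := by
    have hmem : 2 * k + 2 ∈ Set.Icc (2 * k + 2) b := ⟨le_rfl, by omega⟩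
    obtain ⟨e, he⟩ := hC.exists_spansRadical hs (k := k) (by omega)
    obtain ⟨⟨D₁, hD₁, h₁, rfl⟩, D₃, hD₃, h₃, rfl⟩ := hxz.exists_mem hmem
    obtain ⟨⟨D₂, hD₂, h₂, rfl⟩, D₄, hD₄, h₄, rfl⟩ := hyz'.exists_mem hmem
    obtain ⟨f, hf, e₁⟩ := hC.even_exists_vector hs (by omega) hb he hD₁ h₁
    obtain ⟨g, hg, e₂⟩ := hC.even_exists_vector hs (by omega) hb he hD₂ h₂
    obtain ⟨p, hp, e₃⟩ := hC.even_exists_vector hs (by omega) hb he hD₃ h₃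
    obtain ⟨q, hq, e₄⟩ := hC.even_exists_vector hs (by omega) hb he hD₄ h₄
    have iff := fun {f g : V} => hC.even_pointAdj_iff hs (k := k) (by omega) hb he (f := f) (g := g)
    rw [e₁, e₂, iff hf hg] at hnxy
    rw [e₃, e₄, iff hp hq] at hnzz'
    -- By non-adjacency `g` is in the class of `f` and `q` in that of `p`, so a point adjacent to
    -- `f` and `p` is adjacent to all four.
    obtain ⟨w, hw, n₁, n₂, -⟩ := hC.even_three_vectors hs (by omega) hb he (g := p) (h := p) hf
    refine ⟨C (2 * k + 1) ⊔ Submodule.span F {w}, ?_, ?_, ?_, ?_⟩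
    · rwa [e₁, iff hf hw]
    · rw [e₂, iff hg hw]
      have h1 : IsSeparating s C k b (w - g - (f - g)) := by rwa [sub_sub_sub_cancel_right]
      refine h1.or_of_sub.resolve_right fun h => hnxy ?_
      rw [← neg_sub]
      exact h.neg
    · rwa [e₃, iff hp hw]
    · rw [e₄, iff hq hw]
      have h1 : IsSeparating s C k b (w - q - (p - q)) := by rwa [sub_sub_sub_cancel_right]
      refine h1.or_of_sub.resolve_right fun h => hnzz' ?_
      rw [← neg_sub]
      exact h.neg
  three D₁ hD₁ D₂ hD₂ D₃ hD₃ h₁ h₂ h₃ := hC.even_three hs (by omega) hb hD₁ hD₂ hD₃ h₁ h₂ h₃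

/-- Any three points of a residue of connected type and rank at least two have a common
neighbour. -/
theorem exists_common_neighbour (hs : s.IsAlt) (hF : ∃ t : F, t ≠ 0 ∧ t ≠ 1)
    (hC : IsSymplecticFlag s C) {a : ℕ} (ha : 1 ≤ a) (hab : a + 1 ≤ b) (hb : b < finrank F V)
    {D₁ D₂ D₃ : ℕ → Submodule F V}
    (hD₁ : IsSymplecticFlag s D₁) (hD₂ : IsSymplecticFlag s D₂) (hD₃ : IsSymplecticFlag s D₃)
    (h₁ : AgreeOff (Set.Icc a b) D₁ C) (h₂ : AgreeOff (Set.Icc a b) D₂ C)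
    (h₃ : AgreeOff (Set.Icc a b) D₃ C) :
    ∃ w, PointAdj C {D | IsSymplecticFlag s D} (Set.Icc a b) a (D₁ a) w ∧
      PointAdj C {D | IsSymplecticFlag s D} (Set.Icc a b) a (D₂ a) w ∧
      PointAdj C {D | IsSymplecticFlag s D} (Set.Icc a b) a (D₃ a) w := by
  rcases Nat.even_or_odd' a with ⟨k, rfl | rfl⟩
  -- A positive even index is rewritten as `2 * k + 2`, the form used for even points.
  · obtain ⟨k, rfl⟩ : ∃ l, k = l + 1 := ⟨k - 1, by omega⟩
    exact hC.even_three hs (by omega) hb hD₁ hD₂ hD₃ h₁ h₂ h₃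
  · exact hC.odd_three hs hF (by omega) hb hD₁ hD₂ hD₃ h₁ h₂ h₃

theorem isSimplyConnectedAt (hs : s.IsAlt) (hF : ∃ t : F, t ≠ 0 ∧ t ≠ 1)
    (hC : IsSymplecticFlag s C) {a : ℕ} (ha : 1 ≤ a) (hab : a + 2 ≤ b) (hb : b < finrank F V) :
    IsSimplyConnectedAt C {D | IsSymplecticFlag s D} (Set.Icc a b) a := by
  rcases Nat.even_or_odd' a with ⟨k, rfl | rfl⟩
  · obtain ⟨k, rfl⟩ : ∃ l, k = l + 1 := ⟨k - 1, by omega⟩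
    exact hC.even_isSimplyConnectedAt hs hF (by omega) hb
  · exact hC.odd_isSimplyConnectedAt hs hF (by omega) hb

end IsSymplecticFlag

end EvenPoints

/-! ### Induction on the type of a residue -/

/-- The case split of both inductions on types: an interval is a connected type, and a gap separates
a type into two commuting parts. -/
theorem finset_nat_cases (K : Finset ℕ) :
    K = ∅ ∨ (∃ a b, a ≤ b ∧ K = Finset.Icc a b) ∨
      ∃ c ∉ K, (∃ i ∈ K, i < c) ∧ ∃ j ∈ K, c < j := by
  rcases K.eq_empty_or_nonempty with h | h
  · exact Or.inl h
  right
  by_cases hc : ∀ c, K.min' h ≤ c → c ≤ K.max' h → c ∈ K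
  · left
    refine ⟨K.min' h, K.max' h, K.min'_le _ (K.max'_mem h), ?_⟩
    ext c
    rw [Finset.mem_Icc]
    exact ⟨fun hcK => ⟨K.min'_le _ hcK, K.le_max' _ hcK⟩, fun hcK => hc c hcK.1 hcK.2⟩
  · right
    push Not at hc
    obtain ⟨c, h1, h2, h3⟩ := hc
    refine ⟨c, h3, ⟨_, K.min'_mem h, h1.lt_of_ne ?_⟩, _, K.max'_mem h, h2.lt_of_ne ?_⟩
    · rintro rfl
      exact h3 (K.min'_mem h)
    · rintro rfl
      exact h3 (K.max'_mem h)

/-- The conditions on a cover of a system of flags under which injectivity of the projection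
passes from types of rank two to all types. -/
structure IsRankTwoCover {A G X : Type*} [Group A] [Group G] [MulAction G X] (π : A →* G)
    (C : ℕ → X) (S : Set (ℕ → X)) (Q : Set ℕ → Subgroup A) : Prop
    extends IsFlagCover π C S Q where
  generated : ∀ K : Set ℕ, K.Nonempty → Q K ≤ ⨆ i : K, Q {i.1}
  injective_pair : ∀ i j, InjectiveOnSubgroup π (Q {i, j})

/-- Stabilizers decompose as products along indices that do not occur in the type. -/
def HasProductDecomposition (G : Type*) {X : Type*} [Group G] [MulAction G X] (C : ℕ → X) : Prop :=
  ∀ (K J₁ J₂ : Set ℕ) (c : ℕ), c ∉ K → (∀ i ∈ K, i < c → i ∈ J₁) → (∀ i ∈ K, c < i → i ∈ J₂) →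
    ∀ g ∈ flagStabilizer G C K, ∃ g₁ ∈ flagStabilizer G C J₁, ∃ g₂ ∈ flagStabilizer G C J₂,
      g = g₁ * g₂

namespace IsRankTwoCover

variable {A G X : Type*} [Group A] [Group G] [MulAction G X] {π : A →* G} {C : ℕ → X}
  {S : Set (ℕ → X)} {Q : Set ℕ → Subgroup A}

theorem iSup_eq (hc : IsRankTwoCover π C S Q) {K : Set ℕ} (hK : K.Nonempty) :
    Q K = ⨆ i : K, Q {i.1} :=
  le_antisymm (hc.generated K hK)
    (iSup_le fun i => hc.mono (Set.singleton_subset_iff.2 i.2))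

/-- The product decomposition of `(p * q)⁻¹` downstairs lifts to `Q {i, j}`, where `π` is injective;
inverting it reverses the order of the factors. -/
theorem exists_swap_singleton (hc : IsRankTwoCover π C S Q) (hp : HasProductDecomposition G C)
    {i j c : ℕ} (hic : i < c) (hcj : c < j) {p q : A} (hpi : p ∈ Q {i}) (hqj : q ∈ Q {j}) :
    ∃ p' ∈ Q {i}, ∃ q' ∈ Q {j}, p * q = q' * p' := by
  have hi : Q {i} ≤ Q {i, j} := hc.mono (by simp)
  have hj : Q {j} ≤ Q {i, j} := hc.mono (by simp)
  have hpq := (Q {i, j}).mul_mem (hi hpi) (hj hqj)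
  obtain ⟨g₁, h₁, g₂, h₂, e⟩ := hp {i, j} {i} {j} c (by
      rintro (rfl | h)
      · omega
      · have : c = j := h
        omega) (by
      rintro l (rfl | h) hl
      · rfl
      · have : l = j := h
        omega) (by
      rintro l (rfl | h) hl
      · omega
      · exact h) (π (p * q))⁻¹ (inv_mem (hc.map_mem hpq))
  rw [← hc.map_eq] at h₁ h₂
  obtain ⟨p₁, hp₁, rfl⟩ := h₁
  obtain ⟨q₁, hq₁, rfl⟩ := h₂
  refine ⟨p₁⁻¹, inv_mem hp₁, q₁⁻¹, inv_mem hq₁, ?_⟩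
  have h1 := hc.injective_pair i j (p * q * (p₁ * q₁))
    (mul_mem hpq (mul_mem (hi hp₁) (hj hq₁)))
    (by rw [map_mul, map_mul π p₁, ← e, mul_inv_cancel])
  rw [← mul_inv_rev]
  exact eq_inv_of_mul_eq_one_left h1

/-- Two nested inductions over the rank one generators of `Q J₂` and `Q J₁`. -/
theorem exists_swap (hc : IsRankTwoCover π C S Q) (hp : HasProductDecomposition G C)
    {c : ℕ} {J₁ J₂ : Set ℕ} (h₁ : ∀ i ∈ J₁, i < c) (h₂ : ∀ j ∈ J₂, c < j) (n₁ : J₁.Nonempty)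
    (n₂ : J₂.Nonempty) : ∀ p ∈ Q J₁, ∀ q ∈ Q J₂, ∃ p' ∈ Q J₁, ∃ q' ∈ Q J₂, p * q = q' * p' := by
  have key : ∀ i : J₁, ∀ q ∈ Q J₂, ∀ p ∈ Q {i.1}, ∃ p' ∈ Q {i.1}, ∃ q' ∈ Q J₂,
      p * q = q' * p' := by
    intro i q hq
    rw [hc.iSup_eq n₂] at hq ⊢
    refine Subgroup.iSup_induction (fun j : J₂ => Q {j.1})
      (C := fun q => ∀ p ∈ Q {i.1}, ∃ p' ∈ Q {i.1}, ∃ q' ∈ ⨆ j : J₂, Q {j.1}, p * q = q' * p')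
      hq ?_ ?_ ?_
    · intro j q hq p hpi
      obtain ⟨p', hp', q', hq', e⟩ :=
        hc.exists_swap_singleton hp (h₁ i i.2) (h₂ j j.2) hpi hq
      exact ⟨p', hp', q', Subgroup.mem_iSup_of_mem j hq', e⟩
    · intro p hpi
      exact ⟨p, hpi, 1, one_mem _, by simp⟩
    · intro q₁ q₂ ih₁ ih₂ p hpi
      obtain ⟨p₁, hp₁, r₁, hr₁, e₁⟩ := ih₁ p hpi
      obtain ⟨p₂, hp₂, r₂, hr₂, e₂⟩ := ih₂ p₁ hp₁
      exact ⟨p₂, hp₂, r₁ * r₂, mul_mem hr₁ hr₂, by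
        rw [← mul_assoc, e₁, mul_assoc, e₂, mul_assoc]⟩
  intro p hpJ
  rw [hc.iSup_eq n₁] at hpJ ⊢
  refine Subgroup.iSup_induction (fun i : J₁ => Q {i.1})
    (C := fun p => ∀ q ∈ Q J₂, ∃ p' ∈ ⨆ i : J₁, Q {i.1}, ∃ q' ∈ Q J₂, p * q = q' * p') hpJ
    ?_ ?_ ?_
  · intro i p hpi q hq
    obtain ⟨p', hp', q', hq', e⟩ := key i q hq p hpi
    exact ⟨p', Subgroup.mem_iSup_of_mem i hp', q', hq', e⟩
  · intro q hq
    exact ⟨1, one_mem _, q, hq, by simp⟩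
  · intro p₁ p₂ ih₁ ih₂ q hq
    obtain ⟨r₂, hr₂, q₂, hq₂, e₂⟩ := ih₂ q hq
    obtain ⟨r₁, hr₁, q₁, hq₁, e₁⟩ := ih₁ q₂ hq₂
    exact ⟨r₁ * r₂, mul_mem hr₁ hr₂, q₁, hq₁, by
      rw [mul_assoc, e₂, ← mul_assoc, e₁, mul_assoc]⟩

/-- Swapping factors gives `Q K = Q J₂ * Q J₁`. If `q * p` maps to `1`, then `π q` lies in both
stabilizers, so injectivity on `Q J₂` moves `q` into `Q J₁`, and injectivity there finishes. -/
theorem injective_of_product (hc : IsRankTwoCover π C S Q) (hp : HasProductDecomposition G C)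
    {c : ℕ} {K J₁ J₂ : Set ℕ} (h₁ : ∀ i ∈ J₁, i < c) (h₂ : ∀ j ∈ J₂, c < j) (n₁ : J₁.Nonempty)
    (n₂ : J₂.Nonempty) (hK : K = J₁ ∪ J₂) (i₁ : InjectiveOnSubgroup π (Q J₁))
    (i₂ : InjectiveOnSubgroup π (Q J₂)) : InjectiveOnSubgroup π (Q K) := by
  have key : ∀ g ∈ Q K, ∃ q ∈ Q J₂, ∃ p ∈ Q J₁, g = q * p := by
    intro g hg
    rw [hc.iSup_eq (by rw [hK]; exact n₁.inl)] at hg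
    refine Subgroup.iSup_induction (fun i : K => Q {i.1})
      (C := fun g => ∃ q ∈ Q J₂, ∃ p ∈ Q J₁, g = q * p) hg ?_ ?_ ?_
    · rintro ⟨i, hi⟩ g hg
      rw [hK] at hi
      rcases hi with hi | hi
      · exact ⟨1, one_mem _, g, hc.mono (Set.singleton_subset_iff.2 hi) hg, by simp⟩
      · exact ⟨g, hc.mono (Set.singleton_subset_iff.2 hi) hg, 1, one_mem _, by simp⟩
    · exact ⟨1, one_mem _, 1, one_mem _, by simp⟩
    · rintro _ _ ⟨q₁, hq₁, p₁, hp₁, rfl⟩ ⟨q₂, hq₂, p₂, hp₂, rfl⟩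
      obtain ⟨p', hp', q', hq', e⟩ := hc.exists_swap hp h₁ h₂ n₁ n₂ p₁ hp₁ q₂ hq₂
      refine ⟨q₁ * q', mul_mem hq₁ hq', p' * p₂, mul_mem hp' hp₂, ?_⟩
      rw [mul_assoc, ← mul_assoc p₁, e]
      simp only [mul_assoc]
  intro g hg hg1
  obtain ⟨q, hq, p, hpJ, rfl⟩ := key g hg
  have hq1 : π q ∈ flagStabilizer G C J₁ := by
    rw [map_mul, mul_eq_one_iff_eq_inv] at hg1
    rw [hg1]
    exact inv_mem (hc.map_mem hpJ)
  have hqJ : q ∈ Q J₁ := by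
    have := hc.mem_of_agreeOff (J := J₂) (J' := J₁) (M := J₁) i₂ (s := 1) (t := q)
      (by simpa using hq) (by
        rw [← inv_mul_mem_flagStabilizer]
        simpa using hq1) Set.inter_subset_right
    simpa using this
  exact i₁ _ (mul_mem hqJ hpJ) hg1

/-- Injectivity of the projection in all types, given that connected types of rank at least three
are simply connected. -/
theorem injectiveOnSubgroup_finset (hc : IsRankTwoCover π C S Q) (hp : HasProductDecomposition G C)
    {n : ℕ} (hsc : ∀ a b, 1 ≤ a → a + 2 ≤ b → b < n → IsSimplyConnectedAt C S (Set.Icc a b) a) :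
    ∀ (m : ℕ) (K : Finset ℕ), K.card = m → (∀ i ∈ K, 1 ≤ i ∧ i < n) →
      InjectiveOnSubgroup π (Q K) := by
  intro m
  induction m using Nat.strong_induction_on with
  | _ m ih =>
  intro K hKm hKn
  rcases finset_nat_cases K with rfl | ⟨a, b, hab, rfl⟩ | ⟨c, hcK, ⟨i, hi, hic⟩, j, hj, hcj⟩
  · exact fun g hg => hc.injective_pair 0 0 g (hc.mono (by simp) hg)
  · rcases Nat.lt_or_ge b (a + 2) with hb | hb
    · refine fun g hg => hc.injective_pair a b g (hc.mono ?_ hg)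
      intro l hl
      rw [Finset.coe_Icc, Set.mem_Icc] at hl
      simp only [Set.mem_insert_iff, Set.mem_singleton_iff]
      omega
    · have hs := hsc a b (hKn a (by simpa)).1 hb (hKn b (by simpa)).2
      rw [← Finset.coe_Icc] at hs
      -- The induction hypothesis covers every proper subset of the interval, as the covering
      -- argument requires.
      refine hc.toIsFlagCover.injectiveOnSubgroup hs (fun J hJ => ?_) ?_
      · have hfin : J.Finite := (Finset.finite_toSet _).subset hJ.subset
        lift J to Finset ℕ using hfin
        have hJ' : J ⊂ Finset.Icc a b := Finset.coe_ssubset.1 hJ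
        exact ih _ (hKm ▸ Finset.card_lt_card hJ') J rfl fun i hi => hKn i (hJ'.subset hi)
      · rw [hc.iSup_eq (K := (Finset.Icc a b : Finset ℕ)) ⟨a, by simpa⟩]
        refine iSup_le fun l => ?_
        by_cases hl : l.1 = a
        · rw [hl]
          exact le_sup_right
        · have hsub : {l.1} ⊆ ((Finset.Icc a b : Finset ℕ) : Set ℕ) \ {a} :=
            Set.singleton_subset_iff.2 ⟨l.2, hl⟩
          exact (hc.mono hsub).trans le_sup_left
  · have hlt : ∀ (P : ℕ → Prop) [DecidablePred P] (x : ℕ), x ∈ K → ¬ P x →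
        (K.filter P).card < m := by
      intro P _ x hx hPx
      rw [← hKm]
      exact Finset.card_lt_card (Finset.filter_ssubset.2 ⟨x, hx, hPx⟩)
    refine hc.injective_of_product hp (c := c) (J₁ := K.filter (· < c)) (J₂ := K.filter (c < ·))
      (by simp) (by simp) ⟨i, by simp [hi, hic]⟩ ⟨j, by simp [hj, hcj]⟩ ?_ ?_ ?_
    · ext l
      simp only [Finset.coe_filter, Set.mem_union, Set.mem_ofPred_eq, Finset.mem_coe]
      constructor
      · intro hl
        rcases lt_trichotomy l c with h | rfl | h
        · exact Or.inl ⟨hl, h⟩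
        · exact absurd hl hcK
        · exact Or.inr ⟨hl, h⟩
      · rintro (h | h) <;> exact h.1
    · exact ih _ (hlt _ j hj (by omega)) _ rfl fun l hl => hKn l (Finset.mem_filter.1 hl).1
    · exact ih _ (hlt _ i hi (by omega)) _ rfl fun l hl => hKn l (Finset.mem_filter.1 hl).1

end IsRankTwoCover

/-! ### Product decomposition and generation of stabilizers -/

section Generation

variable {F : Type u} {V : Type v} [Field F] [AddCommGroup V] [Module F V]
  [FiniteDimensional F V] {s : LinearMap.BilinForm F V} {C D : ℕ → Submodule F V}

namespace IsSymplecticFlag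

omit [FiniteDimensional F V] in
theorem glue (hC : IsSymplecticFlag s C) (hD : IsSymplecticFlag s D) {c : ℕ} (h : D c = C c) :
    IsSymplecticFlag s (fun i => if i < c then D i else C i) where
  mono := by
    refine monotone_nat_of_le_succ fun i => ?_
    rcases lt_trichotomy (i + 1) c with h1 | h1 | h1
    · rw [if_pos (by omega), if_pos h1]
      exact hD.mono (Nat.le_succ i)
    · rw [if_pos (by omega), if_neg (by omega), h1, ← h]
      exact hD.mono (by omega)
    · rw [if_neg (by omega), if_neg (by omega)]
      exact hC.mono (Nat.le_succ i)
  finrank_eq i hi := by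
    by_cases h : i < c
    · exact (congrArg (fun U : Submodule F V => finrank F U) (if_pos h)).trans (hD.finrank_eq i hi)
    · exact (congrArg (fun U : Submodule F V => finrank F U) (if_neg h)).trans (hC.finrank_eq i hi)
  eq_top i hi := by
    rw [hC.eq_top i hi, hD.eq_top i hi, ite_self]
  nondegOn i hi he := by
    split_ifs
    · exact hD.nondegOn i hi he
    · exact hC.nondegOn i hi he

/-- Because `g` fixes `C c`, the flag equal to `g • C` below `c` and to `C` from `c` on is again
symplectic. An element `p` carrying `C` to it lies in the stabilizer of type `J₁`, and `p⁻¹ * g` in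
that of type `J₂`. -/
theorem hasProductDecomposition (hs : s.IsAlt) (hC : IsSymplecticFlag s C) :
    HasProductDecomposition (symplecticGroupOf s) C := by
  intro K J₁ J₂ c hc h₁ h₂ g hg
  have ho := hC.isChamberOrbit hs
  have hD := hC.glue (IsSymplecticFlag.smul hC g) (c := c) (hg c hc)
  obtain ⟨p, hp, e⟩ := ho.exists_mul (g := 1) (J := J₁) hD (by
    intro i hi
    rw [one_smul]
    dsimp only
    split_ifs with hic
    · exact (hg i fun hiK => hi (h₁ i hiK hic)).symm
    · rfl)
  rw [one_mul] at e
  refine ⟨p, hp, p⁻¹ * g, ?_, by simp⟩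
  rw [inv_mul_mem_flagStabilizer, e]
  intro i hi
  dsimp only
  split_ifs with hic
  · rfl
  · refine (hg i fun hiK => ?_).symm
    rcases (not_lt.1 hic).eq_or_lt with rfl | h
    · exact hc hiK
    · exact hi (h₂ i hiK h)

/-- Stabilizers are generated by those of rank at most one. -/
theorem flagStabilizer_le (hs : s.IsAlt) (hF : ∃ t : F, t ≠ 0 ∧ t ≠ 1)
    (hC : IsSymplecticFlag s C) : ∀ (m : ℕ) (K : Finset ℕ), K.card = m →
      (∀ i ∈ K, 1 ≤ i ∧ i < finrank F V) → ∀ R : Subgroup (symplecticGroupOf s),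
      flagStabilizer (symplecticGroupOf s) C ∅ ≤ R →
      (∀ i ∈ K, flagStabilizer (symplecticGroupOf s) C {i} ≤ R) →
      flagStabilizer (symplecticGroupOf s) C K ≤ R := by
  intro m
  induction m using Nat.strong_induction_on with
  | _ m ih =>
  intro K hKm hKn R hR0 hR
  rcases finset_nat_cases K with rfl | ⟨a, b, hab, rfl⟩ | ⟨c, hcK, ⟨i, hi, hic⟩, j, hj, hcj⟩
  · simpa using hR0
  · have haK : a ∈ Finset.Icc a b := by simpa
    rcases hab.eq_or_lt with rfl | hb
    · simpa using hR a haK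
    · intro g hg
      rw [Finset.coe_Icc] at hg
      have hgC : AgreeOff (Set.Icc a b) (g • C) C := hg
      -- Only a common neighbour of `C a` and `g • C a` is needed; the third point is a filler.
      obtain ⟨w, w1, w2, -⟩ := hC.exists_common_neighbour hs hF (hKn a haK).1 hb
        (hKn b (by simpa)).2 hC (IsSymplecticFlag.smul hC g) hC (AgreeOff.refl _ C) hgC
        (AgreeOff.refl _ C)
      refine (hC.isChamberOrbit hs).mem_of_commonNeighbour (by simpa using hab) ?_ (hR a haK) hg
        w1 w2
      have h1 : Set.Icc a b \ {a} = ((Finset.Icc a b).erase a : Finset ℕ) := by simp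
      rw [h1]
      refine ih _ ?_ _ rfl (fun i hi => hKn i (Finset.mem_of_mem_erase hi)) R hR0
        fun i hi => hR i (Finset.mem_of_mem_erase hi)
      rw [← hKm]
      exact Finset.card_erase_lt_of_mem haK
  · have hlt : ∀ (P : ℕ → Prop) [DecidablePred P] (x : ℕ), x ∈ K → ¬ P x →
        (K.filter P).card < m := by
      intro P _ x hx hPx
      rw [← hKm]
      exact Finset.card_lt_card (Finset.filter_ssubset.2 ⟨x, hx, hPx⟩)
    intro g hg
    obtain ⟨g₁, h₁, g₂, h₂, rfl⟩ := hC.hasProductDecomposition hs K (K.filter (· < c))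
      (K.filter (c < ·)) c (by simpa using hcK) (fun l hl h => by
        rw [Finset.mem_coe, Finset.mem_filter]
        exact ⟨hl, h⟩) (fun l hl h => by
        rw [Finset.mem_coe, Finset.mem_filter]
        exact ⟨hl, h⟩) g hg
    refine mul_mem ?_ ?_
    · exact ih _ (hlt _ j hj (by omega)) _ rfl (fun l hl => hKn l (Finset.mem_filter.1 hl).1) R hR0
        (fun l hl => hR l (Finset.mem_filter.1 hl).1) h₁
    · exact ih _ (hlt _ i hi (by omega)) _ rfl (fun l hl => hKn l (Finset.mem_filter.1 hl).1) R hR0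
        (fun l hl => hR l (Finset.mem_filter.1 hl).1) h₂

end IsSymplecticFlag

end Generation

/-! ### The amalgam of parabolic subgroups -/

namespace GroupAmalgam

variable {B : Type u} [PartialOrder B] (A : GroupAmalgam.{u, v} B)

theorem toCompletion_hom {b c : B} (h : b < c) (a : A.grp b) :
    A.toCompletion c (A.hom h a) = A.toCompletion b a := by
  rw [← mul_inv_eq_one]
  change QuotientGroup.mk' (Subgroup.normalClosure A.identifications) _ *
    (QuotientGroup.mk' (Subgroup.normalClosure A.identifications) _)⁻¹ = 1
  rw [← map_inv, ← map_mul, ← MonoidHom.mem_ker, QuotientGroup.ker_mk']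
  exact Subgroup.subset_normalClosure ⟨b, c, h, a, rfl⟩

theorem iSup_range_toCompletion : ⨆ b, (A.toCompletion b).range = ⊤ := by
  rw [eq_top_iff]
  rintro x -
  obtain ⟨x, rfl⟩ := QuotientGroup.mk'_surjective _ x
  induction x using Monoid.CoprodI.induction_on with
  | one => rw [map_one]; exact one_mem _
  | of b a => exact Subgroup.mem_iSup_of_mem b ⟨a, rfl⟩
  | mul x y hx hy => rw [map_mul]; exact mul_mem hx hy

end GroupAmalgam

/-! ### Chambers as symplectic flags, and the cover defined by the completion -/

section Chamber

variable {F : Type u} {V : Type v} [Field F] [AddCommGroup V] [Module F V]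
  [FiniteDimensional F V] {s : LinearMap.BilinForm F V} (C : (quasiPhanGeometry s).Chamber)

namespace PreGeometry.Chamber

theorem exists_mem_typ (i : QuasiPhanTypes F V) :
    ∃ X ∈ C.carrier, (quasiPhanGeometry s).typ X = i := by
  have : i ∈ (quasiPhanGeometry s).typ '' C.carrier := by rw [C.typ_eq]; trivial
  exact this

/-- The object of type `i` in a chamber. -/
noncomputable def obj (i : QuasiPhanTypes F V) : (quasiPhanGeometry s).Obj :=
  (C.exists_mem_typ i).choose

theorem obj_mem (i : QuasiPhanTypes F V) : C.obj i ∈ C.carrier :=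
  (C.exists_mem_typ i).choose_spec.1

theorem typ_obj (i : QuasiPhanTypes F V) : (quasiPhanGeometry s).typ (C.obj i) = i :=
  (C.exists_mem_typ i).choose_spec.2

theorem eq_obj {X : (quasiPhanGeometry s).Obj} (hX : X ∈ C.carrier) {i : QuasiPhanTypes F V}
    (h : (quasiPhanGeometry s).typ X = i) : X = C.obj i := by
  refine ((quasiPhanGeometry s).eq_or_typ_ne _ _ (C.isFlag _ hX _ (C.obj_mem i))).resolve_right ?_
  rw [h, C.typ_obj i]
  exact fun h => h rfl

open Classical in
/-- The complete flag of subspaces defined by a chamber. -/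
noncomputable def toFlag (i : ℕ) : Submodule F V :=
  if h : 1 ≤ i ∧ i < finrank F V then (C.obj ⟨i, h⟩).1 else if i = 0 then ⊥ else ⊤

theorem toFlag_coe (i : QuasiPhanTypes F V) : C.toFlag i.1 = (C.obj i).1 := dif_pos i.2

theorem toFlag_zero : C.toFlag 0 = ⊥ := by
  rw [toFlag, dif_neg (by omega), if_pos rfl]

theorem toFlag_of_le {i : ℕ} (h0 : 1 ≤ i) (h : finrank F V ≤ i) : C.toFlag i = ⊤ := by
  rw [toFlag, dif_neg (by omega), if_neg (by omega)]

theorem finrank_obj (i : QuasiPhanTypes F V) : finrank F (C.obj i).1 = i.1 :=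
  congrArg Subtype.val (C.typ_obj i)

/-- Even-dimensional members are nondegenerate by parity of the radical; for `V` itself, in even
dimension, the bound on its radical is used. -/
theorem isSymplecticFlag (hs : s.IsAlt) (hrank : finrank F (subspaceRadical s ⊤) ≤ 1)
    (hV : 1 ≤ finrank F V) : IsSymplecticFlag s C.toFlag where
  mono := by
    refine monotone_nat_of_le_succ fun i => ?_
    rcases Nat.eq_zero_or_pos i with rfl | h0
    · rw [C.toFlag_zero]
      exact bot_le
    rcases Nat.lt_or_ge (i + 1) (finrank F V) with h | h
    · rw [C.toFlag_coe ⟨i, h0, by omega⟩, C.toFlag_coe ⟨i + 1, by omega, h⟩]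
      have h1 : finrank F (C.obj ⟨i, h0, by omega⟩).1 = i := C.finrank_obj _
      have h2 : finrank F (C.obj ⟨i + 1, by omega, h⟩).1 = i + 1 := C.finrank_obj _
      rcases C.isFlag _ (C.obj_mem ⟨i, h0, by omega⟩) _ (C.obj_mem ⟨i + 1, by omega, h⟩) with
        e | e | e
      · rw [e, h2] at h1
        omega
      · exact e.1
      · have h3 := Submodule.finrank_mono e.1
        rw [h1, h2] at h3
        omega
    · rw [C.toFlag_of_le (by omega) h]
      exact le_top
  finrank_eq i hi := by
    rcases Nat.eq_zero_or_pos i with rfl | h0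
    · rw [C.toFlag_zero, finrank_bot]
    rcases hi.lt_or_eq with h | h
    · rw [C.toFlag_coe ⟨i, h0, h⟩, C.finrank_obj]
    · rw [C.toFlag_of_le h0 h.ge, finrank_top, h]
  eq_top i hi := C.toFlag_of_le (hV.trans hi) hi
  nondegOn i hi he := by
    rcases Nat.eq_zero_or_pos i with rfl | h0
    · rw [C.toFlag_zero]
      exact nondegOn_bot
    rcases hi.lt_or_eq with h | h
    · rw [C.toFlag_coe ⟨i, h0, h⟩]
      refine nondegOn_of_even hs ?_ (C.obj ⟨i, h0, h⟩).2.2.2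
      rwa [C.finrank_obj]
    · rw [C.toFlag_of_le h0 h.ge]
      refine nondegOn_of_even hs ?_ hrank
      rwa [finrank_top, ← h]

/-- The action preserves types and a chamber has one object of each type, so stabilizing a subflag
as a set fixes each of its members. -/
theorem mem_parabolic_iff {J : Finset (QuasiPhanTypes F V)} {g : symplecticGroupOf s} :
    g ∈ PreGeometry.parabolic (symplecticGroupOf s) C J ↔ ∀ i ∉ J, g • C.obj i = C.obj i := by
  have hty : ∀ X, (quasiPhanGeometry s).typ (g • X) = (quasiPhanGeometry s).typ X :=
    fun X => PreGeometry.IsAutomorphismAction.typ_smul (Γ := quasiPhanGeometry s) g X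
  constructor
  · intro h i hi
    have h' : g • C.subflag J = C.subflag J := h
    have h1 : g • C.obj i ∈ C.subflag J := by
      rw [← h']
      exact Set.smul_mem_smul_set ⟨C.obj_mem i, by rwa [C.typ_obj]⟩
    exact C.eq_obj h1.1 ((hty _).trans (C.typ_obj i))
  · intro h
    have key : ∀ X ∈ C.subflag J, g • X = X := by
      intro X hX
      have e := C.eq_obj hX.1 rfl
      rw [e]
      exact h _ hX.2
    change g • C.subflag J = C.subflag J
    ext X
    constructor
    · rintro ⟨Y, hY, rfl⟩
      change g • Y ∈ _
      rwa [key Y hY]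
    · intro hX
      exact ⟨X, hX, key X hX⟩

theorem parabolic_eq (J : Finset (QuasiPhanTypes F V)) :
    PreGeometry.parabolic (symplecticGroupOf s) C J =
      flagStabilizer (symplecticGroupOf s) C.toFlag (Subtype.val '' (J : Set (QuasiPhanTypes F V))) := by
  ext g
  rw [mem_parabolic_iff, mem_flagStabilizer]
  constructor
  · intro h i hi
    by_cases hi' : 1 ≤ i ∧ i < finrank F V
    · rw [C.toFlag_coe ⟨i, hi'⟩]
      have := h ⟨i, hi'⟩ fun hJ => hi ⟨_, hJ, rfl⟩
      exact congrArg Subtype.val this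
    · rcases Nat.eq_zero_or_pos i with rfl | h0
      · rw [C.toFlag_zero]
        exact Submodule.map_bot _
      · rw [C.toFlag_of_le h0 (by omega)]
        exact (LinearMap.range_eq_map _).symm.trans (LinearEquiv.range g.1)
  · intro h i hi
    have := h i.1 (by
      rintro ⟨j, hj, e⟩
      exact hi (Subtype.ext e ▸ hj))
    rw [C.toFlag_coe i] at this
    exact Subtype.ext this

/-- Outside the type set the flag is `⊥` or `⊤`, which every element fixes. -/
theorem flagStabilizer_preimage (J : Set ℕ) :
    flagStabilizer (symplecticGroupOf s) C.toFlag J =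
      flagStabilizer (symplecticGroupOf s) C.toFlag {i ∈ J | 1 ≤ i ∧ i < finrank F V} := by
  refine le_antisymm (fun g hg i hi => ?_) (flagStabilizer_mono _ fun i hi => hi.1)
  by_cases hi' : 1 ≤ i ∧ i < finrank F V
  · exact hg i fun hJ => hi ⟨hJ, hi'⟩
  · rcases Nat.eq_zero_or_pos i with rfl | h0
    · rw [C.toFlag_zero]
      exact Submodule.map_bot _
    · rw [C.toFlag_of_le h0 (by omega)]
      exact (LinearMap.range_eq_map _).symm.trans (LinearEquiv.range g.1)

/-- The subgroup of the universal completion generated by the parabolic subgroups of rank at most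
one and type contained in `J`. -/
noncomputable def lift (J : Set ℕ) :
    Subgroup (PreGeometry.parabolicAmalgam (symplecticGroupOf s) C 2).UniversalCompletion :=
  ⨆ (M : {M : Finset (QuasiPhanTypes F V) // M.card ≤ 2})
    (_ : M.1.card ≤ 1 ∧ ∀ i ∈ M.1, i.1 ∈ J),
    ((PreGeometry.parabolicAmalgam (symplecticGroupOf s) C 2).toCompletion M).range

/-- The inclusion of a group of the amalgam of parabolic subgroups. -/
noncomputable def amalgamSubtype (M : {M : Finset (QuasiPhanTypes F V) // M.card ≤ 2}) :
    (PreGeometry.parabolicAmalgam (symplecticGroupOf s) C 2).grp M →* symplecticGroupOf s :=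
  (PreGeometry.parabolic (symplecticGroupOf s) C M.1).subtype

theorem amalgamSubtype_mem (M : {M : Finset (QuasiPhanTypes F V) // M.card ≤ 2})
    (a : (PreGeometry.parabolicAmalgam (symplecticGroupOf s) C 2).grp M) :
    C.amalgamSubtype M a ∈ PreGeometry.parabolic (symplecticGroupOf s) C M.1 :=
  Subtype.prop (p := (· ∈ PreGeometry.parabolic (symplecticGroupOf s) C M.1)) a

theorem amalgamSubtype_injective (M : {M : Finset (QuasiPhanTypes F V) // M.card ≤ 2}) :
    Function.Injective (C.amalgamSubtype M) :=
  Subgroup.subtype_injective (PreGeometry.parabolic (symplecticGroupOf s) C M.1)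

theorem parabolicCompletionHom_toCompletion (M : {M : Finset (QuasiPhanTypes F V) // M.card ≤ 2})
    (a : (PreGeometry.parabolicAmalgam (symplecticGroupOf s) C 2).grp M) :
    PreGeometry.parabolicCompletionHom (symplecticGroupOf s) C 2
      ((PreGeometry.parabolicAmalgam (symplecticGroupOf s) C 2).toCompletion M a) =
        C.amalgamSubtype M a :=
  GroupAmalgam.completionLift_toCompletion (PreGeometry.parabolicAmalgam (symplecticGroupOf s) C 2)
    (fun J => C.amalgamSubtype J) (fun _ _ => rfl) M a

theorem range_toCompletion_mono {M N : {M : Finset (QuasiPhanTypes F V) // M.card ≤ 2}}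
    (h : M ≤ N) : ((PreGeometry.parabolicAmalgam (symplecticGroupOf s) C 2).toCompletion M).range ≤
      ((PreGeometry.parabolicAmalgam (symplecticGroupOf s) C 2).toCompletion N).range := by
  rcases h.eq_or_lt with rfl | h
  · exact le_rfl
  · rintro _ ⟨a, rfl⟩
    exact ⟨_, GroupAmalgam.toCompletion_hom _ h a⟩

theorem injectiveOnSubgroup_range (M : {M : Finset (QuasiPhanTypes F V) // M.card ≤ 2}) :
    InjectiveOnSubgroup (PreGeometry.parabolicCompletionHom (symplecticGroupOf s) C 2)
      ((PreGeometry.parabolicAmalgam (symplecticGroupOf s) C 2).toCompletion M).range := by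
  rintro _ ⟨a, rfl⟩ h
  rw [parabolicCompletionHom_toCompletion] at h
  rw [(map_eq_one_iff _ (C.amalgamSubtype_injective M)).1 h, map_one]

theorem lift_le_range {J : Set ℕ} {M : {M : Finset (QuasiPhanTypes F V) // M.card ≤ 2}}
    (h : ∀ i : QuasiPhanTypes F V, i.1 ∈ J → i ∈ M.1) : C.lift J ≤
      ((PreGeometry.parabolicAmalgam (symplecticGroupOf s) C 2).toCompletion M).range :=
  iSup₂_le fun _ hN => C.range_toCompletion_mono fun i hi => h i (hN.2 i hi)

theorem range_le_lift {J : Set ℕ} {M : {M : Finset (QuasiPhanTypes F V) // M.card ≤ 2}}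
    (h1 : M.1.card ≤ 1) (h2 : ∀ i ∈ M.1, i.1 ∈ J) :
    ((PreGeometry.parabolicAmalgam (symplecticGroupOf s) C 2).toCompletion M).range ≤ C.lift J :=
  le_iSup₂_of_le (f := fun (M : {M : Finset (QuasiPhanTypes F V) // M.card ≤ 2})
    (_ : M.1.card ≤ 1 ∧ ∀ i ∈ M.1, i.1 ∈ J) =>
    ((PreGeometry.parabolicAmalgam (symplecticGroupOf s) C 2).toCompletion M).range)
    M ⟨h1, h2⟩ le_rfl

theorem lift_mono : Monotone C.lift := fun _ _ hJ =>
  iSup₂_le fun _ hM => C.range_le_lift hM.1 fun i hi => hJ (hM.2 i hi)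

theorem flagStabilizer_le_map_lift {J : Set ℕ}
    {M : {M : Finset (QuasiPhanTypes F V) // M.card ≤ 2}} (h1 : M.1.card ≤ 1)
    (h2 : ∀ i ∈ M.1, i.1 ∈ J) :
    flagStabilizer (symplecticGroupOf s) C.toFlag
      (Subtype.val '' (M.1 : Set (QuasiPhanTypes F V))) ≤
      (C.lift J).map (PreGeometry.parabolicCompletionHom (symplecticGroupOf s) C 2) := by
  rw [← parabolic_eq]
  intro g hg
  refine ⟨_, C.range_le_lift h1 h2 ⟨⟨g, hg⟩, rfl⟩, ?_⟩
  exact C.parabolicCompletionHom_toCompletion M ⟨g, hg⟩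

theorem map_lift (hs : s.IsAlt) (hF : ∃ t : F, t ≠ 0 ∧ t ≠ 1)
    (hC : IsSymplecticFlag s C.toFlag) (J : Set ℕ) :
    (C.lift J).map (PreGeometry.parabolicCompletionHom (symplecticGroupOf s) C 2) =
      flagStabilizer (symplecticGroupOf s) C.toFlag J := by
  classical
  apply le_antisymm
  · rw [Subgroup.map_le_iff_le_comap]
    refine iSup₂_le fun M hM => ?_
    rintro _ ⟨a, rfl⟩
    rw [Subgroup.mem_comap, parabolicCompletionHom_toCompletion]
    have h := C.amalgamSubtype_mem M a
    rw [parabolic_eq] at h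
    refine flagStabilizer_mono _ ?_ h
    rintro _ ⟨i, hi, rfl⟩
    exact hM.2 i hi
  · rw [flagStabilizer_preimage]
    have hset : {i ∈ J | 1 ≤ i ∧ i < finrank F V} =
        ((Finset.range (finrank F V)).filter fun i => i ∈ J ∧ 1 ≤ i : Finset ℕ) := by
      ext i
      simp only [Finset.coe_filter, Finset.mem_range, Set.mem_ofPred_eq]
      tauto
    rw [hset]
    refine hC.flagStabilizer_le hs hF _ _ rfl (fun i hi => ?_) _ ?_ fun i hi => ?_
    · rw [Finset.mem_filter, Finset.mem_range] at hi
      exact ⟨hi.2.2, hi.1⟩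
    · simpa using C.flagStabilizer_le_map_lift (J := J) (M := ⟨∅, by simp⟩) (by simp) (by simp)
    · rw [Finset.mem_filter, Finset.mem_range] at hi
      simpa using C.flagStabilizer_le_map_lift (J := J) (M := ⟨{⟨i, hi.2.2, hi.1⟩}, by simp⟩)
        (by simp) (by simpa using hi.2.1)

/-- Generation is immediate since `lift` uses only rank at most one. The rank two parabolics enter
through injectivity: the lift of `{i, j}` lies in the image of one of them, and this image embeds in
the symplectic group. -/
theorem isRankTwoCover (hs : s.IsAlt) (hF : ∃ t : F, t ≠ 0 ∧ t ≠ 1)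
    (hC : IsSymplecticFlag s C.toFlag) :
    IsRankTwoCover (PreGeometry.parabolicCompletionHom (symplecticGroupOf s) C 2) C.toFlag
      {D | IsSymplecticFlag s D} C.lift where
  toIsChamberOrbit := hC.isChamberOrbit hs
  mono := C.lift_mono
  map_eq := C.map_lift hs hF hC
  generated K hK := by
    refine iSup₂_le fun M hM => ?_
    rcases M.1.eq_empty_or_nonempty with h | ⟨x, hx⟩
    · obtain ⟨i, hi⟩ := hK
      refine le_iSup_of_le ⟨i, hi⟩ (C.range_le_lift hM.1 ?_)
      simp [h]
    · refine le_iSup_of_le ⟨x.1, hM.2 x hx⟩ (C.range_le_lift hM.1 fun i hi => ?_)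
      rw [Finset.card_le_one.1 hM.1 i hi x hx]
      rfl
  injective_pair i j := by
    classical
    -- The indices `i`, `j` may coincide or lie outside the type set, so the parabolic is taken for
    -- the set of types with value `i` or `j`.
    have hcard : ((Finset.Ico 1 (finrank F V)).attach.image
        (fun l => (⟨l.1, Finset.mem_Ico.1 l.2⟩ : QuasiPhanTypes F V)) |>.filter
          fun l => l.1 = i ∨ l.1 = j).card ≤ 2 := by
      refine (Finset.card_le_card_of_injOn Subtype.val (t := {i, j}) ?_
        Subtype.val_injective.injOn).trans Finset.card_le_two
      intro l hl
      simpa using (Finset.mem_filter.1 hl).2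
    refine fun g hg => C.injectiveOnSubgroup_range ⟨_, hcard⟩ g (C.lift_le_range ?_ hg)
    intro l hl
    rw [Finset.mem_filter]
    exact ⟨Finset.mem_image.2 ⟨⟨l.1, Finset.mem_Ico.2 l.2⟩, Finset.mem_attach _ _, rfl⟩,
      by simpa using hl⟩

/-- An element of a parabolic has the same image as some element of the lift of its type. Both lie
in the range of that parabolic, where the projection is injective, so they agree; hence rank at most
one already generates the completion. -/
theorem lift_eq_top (hs : s.IsAlt) (hF : ∃ t : F, t ≠ 0 ∧ t ≠ 1)
    (hC : IsSymplecticFlag s C.toFlag) :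
    C.lift (Finset.Ico 1 (finrank F V) : Finset ℕ) = ⊤ := by
  rw [eq_top_iff, ← GroupAmalgam.iSup_range_toCompletion]
  refine iSup_le fun M => ?_
  rintro _ ⟨a, rfl⟩
  have h := C.amalgamSubtype_mem M a
  rw [parabolic_eq, ← C.map_lift hs hF hC] at h
  obtain ⟨q, hq, e⟩ := h
  have hqM := C.lift_le_range (M := M) (fun i hi => by
    obtain ⟨j, hj, e⟩ := hi
    exact Subtype.ext e ▸ hj) hq
  have h1 := C.injectiveOnSubgroup_range M
    (q⁻¹ * (PreGeometry.parabolicAmalgam (symplecticGroupOf s) C 2).toCompletion M a)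
    (mul_mem (inv_mem hqM) ⟨a, rfl⟩) (by
      rw [map_mul, map_inv, e, parabolicCompletionHom_toCompletion, inv_mul_cancel])
  rw [inv_mul_eq_one] at h1
  rw [← h1]
  refine C.lift_mono ?_ hq
  rintro _ ⟨i, -, rfl⟩
  simpa using i.2

end PreGeometry.Chamber

end Chamber

theorem exists_ne_zero_ne_one {F : Type u} [Field F] (hF : 3 ≤ ENat.card F) :
    ∃ t : F, t ≠ 0 ∧ t ≠ 1 := by
  by_contra! h
  have h1 : (Set.univ : Set F) ⊆ {0, 1} := by
    intro t _
    by_cases h0 : t = 0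
    · exact Or.inl h0
    · exact Or.inr (h t h0)
  have h2 := Set.encard_le_encard h1
  rw [Set.encard_univ, Set.encard_pair zero_ne_one] at h2
  exact absurd (hF.trans h2) (by decide)

theorem mainTheorem8 {F : Type u} {V : Type v} [Field F] [AddCommGroup V] [Module F V]
    [FiniteDimensional F V] (s : LinearMap.BilinForm F V) (hs : s.IsAlt)
    (hrank : finrank F (subspaceRadical s ⊤) ≤ 1)
    (hF : 3 ≤ ENat.card F) (hV : 4 ≤ finrank F V)
    (C : (quasiPhanGeometry s).Chamber) :
    Function.Bijective
      (PreGeometry.parabolicCompletionHom (symplecticGroupOf s) C 2) := by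
  have hF' := exists_ne_zero_ne_one hF
  have hC := C.isSymplecticFlag hs hrank (by omega)
  have htop := C.lift_eq_top hs hF' hC
  constructor
  · rw [injective_iff_map_eq_one]
    intro g
    refine (C.isRankTwoCover hs hF' hC).injectiveOnSubgroup_finset
      (hC.hasProductDecomposition hs) (n := finrank F V)
      (fun a b ha hab hb => hC.isSimplyConnectedAt hs hF' ha hab hb) _
      (Finset.Ico 1 (finrank F V)) rfl (fun i hi => Finset.mem_Ico.1 hi) g ?_
    rw [htop]
    trivial
  · rw [← MonoidHom.range_eq_top, MonoidHom.range_eq_map, ← htop, C.map_lift hs hF' hC,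
      eq_top_iff]
    -- Outside the full type set only `⊥` and `⊤` occur, so the stabilizer is the whole group.
    intro g _ i hi
    have h := fun h0 hn => hi (Finset.mem_coe.2 (Finset.mem_Ico.2 ⟨h0, hn⟩))
    rcases Nat.eq_zero_or_pos i with rfl | h0
    · rw [C.toFlag_zero]
      exact Submodule.map_bot _
    · rw [C.toFlag_of_le h0 (not_lt.1 (h h0))]
      exact (LinearMap.range_eq_map _).symm.trans (LinearEquiv.range g.1)
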